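/- Let $d\ge 3$ and $0<\kappa<\frac{d-2}{2}$. Let $F$ be a centered Gaussian noise on $(0,\infty)\times\mathbb R^d$, defined on some probability space, that is white in time and has the Riesz kernel of index $2$ as spatial covariance: $(F(A))_A$ is a centered Gaussian family indexed by the bounded Borel sets $A\subset(0,\infty)\times\mathbb R^d$ with $$\mathbb E[F(A)F(B)]=\int_0^\infty\!\int_{\mathbb R^d}\!\int_{\mathbb R^d}\mathbf 1_A(s,x)\,\mathbf 1_B(s,y)\,\|x-y\|^{-2}\,dx\,dy\,ds .$$ Let $G_t(x)=(2\pi t)^{-d/2}e^{-\|x\|^2/(2t)}$ be the heat kernel and $B_R=\{x\in\mathbb R^d:\|x\|<R\}$. For $n\ge 0$ and $R>0$ let $I^{(n)}_1(\mathbf 1_{B_R})$ be the integral over $B_R$ of the $n$-th Wiener chaos at time $1$ of the stochastic heat equation $\partial_tu=\frac12\Delta u+\kappa u\dot F$, $u(0,\cdot)=1$, that is, the multiple Wiener–Itô integral $$I^{(n)}_1(\mathbf 1_{B_R})=\int g_{n,R}(s_1,y_1,\dots,s_n,y_n)\,F(dy_1\,ds_1)\cdots F(dy_n\,ds_n)$$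 of the kernel which, with $s_{n+1}=1$ and $y_{n+1}=x$, is $$g_{n,R}(s_1,y_1,\dots,s_n,y_n)=\kappa^n\,\mathbf 1_{\{0<s_1<\dots<s_n<1\}}\int_{B_R}\prod_{i=1}^nG_{s_{i+1}-s_i}(y_{i+1}-y_i)\,dx .$$ Here the multiple integral of order $n$ is the extension by $L^2$-limits of $\mathbf 1_{A_1\times\dots\times A_n}\mapsto F(A_1)\cdots F(A_n)$, for sets $A_i$ with pairwise disjoint projections to the time axis, and of its linear combinations; kernels $g$ are approximated in the norm whose square is $\int |g(s,y)|\,|g(s,z)|\prod_{i=1}^n\|y_i-z_i\|^{-2}\,dy\,dz\,ds$. Then all the random variables $I^{(n)}_1(\mathbf 1_{B_R})$ are well defined and square integrable, $\sum_{n\ge2}\operatorname{Var}[I^{(n)}_1(\mathbf 1_{B_R})]<\infty$ for every $R>0$, and $$\lim_{R\to\infty}\frac1{R^{2d-2}}\sum_{n=2}^\infty\operatorname{Var}\big[I^{(n)}_1(\mathbf 1_{B_R})\big]=0 .$$ -/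

import Mathlib

open MeasureTheory ProbabilityTheory Filter Topology
open scoped ENNReal

noncomputable section

namespace CriticalSHE

/-- The Euclidean space `ℝ^d`. -/
abbrev Space (d : ℕ) : Type := EuclideanSpace ℝ (Fin d)

/-- The standard heat kernel `G_t(x) = (2 π t)^{-d/2} exp (-‖x‖² / (2 t))`, used for `t > 0`. -/
def heatKernel {d : ℕ} (t : ℝ) (x : Space d) : ℝ :=
  (2 * Real.pi * t) ^ (-(d : ℝ) / 2) * Real.exp (-‖x‖ ^ 2 / (2 * t))

/-! ### The noise -/

/-- Bounded Borel subsets of `(0, ∞) × ℝ^d`. -/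
structure NoiseSet (d : ℕ) where
  carrier : Set (ℝ × Space d)
  measurableSet : MeasurableSet carrier
  isBounded : Bornology.IsBounded carrier
  pos_time : ∀ p ∈ carrier, 0 < p.1

/-- `F` is a centered Gaussian noise on `(0, ∞) × ℝ^d`, white in time, whose spatial covariance is
the Riesz kernel of index `2`: formally `E[Ḟ(s,x) Ḟ(t,y)] = δ(t - s) ‖x - y‖⁻²`. -/
structure IsRieszNoise {d : ℕ} {Ω : Type*} [MeasurableSpace Ω] (F : NoiseSet d → Ω → ℝ)
    (P : Measure Ω) : Prop where
  isGaussianProcess : IsGaussianProcess F P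
  integral_eq_zero : ∀ A, ∫ ω, F A ω ∂P = 0
  covariance_eq : ∀ A B, ∫ ω, F A ω * F B ω ∂P =
    ∫ s : ℝ, ∫ x in {x | (s, x) ∈ A.carrier}, ∫ y in {y | (s, y) ∈ B.carrier}, (‖x - y‖ ^ 2)⁻¹

/-! ### Multiple Wiener–Itô integrals -/

/-- Elementary kernels of order `n`: finite linear combinations of indicators of products
`A₁ × ⋯ × Aₙ`, where no two of the factors `A₁, …, Aₙ` contain points with the same time. -/
structure ElementaryKernel (d n : ℕ) where
  size : ℕ
  coeff : Fin size → ℝ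
  box : Fin size → Fin n → NoiseSet d
  disjoint_time : ∀ j, Pairwise fun i i' ↦
    Disjoint (Prod.fst '' (box j i).carrier) (Prod.fst '' (box j i').carrier)

/-- The function `∑ⱼ cⱼ 1_{Aⱼ₁ × ⋯ × Aⱼₙ}` of `n` space-time points. -/
def ElementaryKernel.toFun {d n : ℕ} (e : ElementaryKernel d n) (p : Fin n → ℝ × Space d) : ℝ :=
  ∑ j, e.coeff j * ∏ i, (e.box j i).carrier.indicator (fun _ ↦ (1 : ℝ)) (p i)

/-- The multiple integral `∑ⱼ cⱼ F(Aⱼ₁) ⋯ F(Aⱼₙ)` of an elementary kernel. -/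
def ElementaryKernel.integral {d n : ℕ} {Ω : Type*} (e : ElementaryKernel d n)
    (F : NoiseSet d → Ω → ℝ) (ω : Ω) : ℝ :=
  ∑ j, e.coeff j * ∏ i, F (e.box j i) ω

/-- The square of the norm of `|g|` in the `n`-fold tensor power of the Hilbert space of the noise,
`∫ |g(s,y)| |g(s,z)| ∏ᵢ ‖yᵢ - zᵢ‖⁻² dy dz ds`. -/
def rieszNormSq {d n : ℕ} (g : (Fin n → ℝ × Space d) → ℝ) : ℝ≥0∞ :=
  ∫⁻ s : Fin n → ℝ, ∫⁻ y : Fin n → Space d, ∫⁻ z : Fin n → Space d,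
    ‖g fun i ↦ (s i, y i)‖ₑ * ‖g fun i ↦ (s i, z i)‖ₑ * ∏ i, (‖y i - z i‖ₑ ^ 2)⁻¹

/-- `X` is (a version of) the multiple Wiener–Itô integral of the kernel `g` with respect to `F`:
the `L²(P)`-limit of the integrals of elementary kernels that approximate `g`. -/
def IsMultipleIntegral {d n : ℕ} {Ω : Type*} [MeasurableSpace Ω] (F : NoiseSet d → Ω → ℝ)
    (P : Measure Ω) (g : (Fin n → ℝ × Space d) → ℝ) (X : Ω → ℝ) : Prop :=
  AEMeasurable g ∧ MemLp X 2 P ∧ ∃ e : ℕ → ElementaryKernel d n,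
    Tendsto (fun k ↦ rieszNormSq fun p ↦ (e k).toFun p - g p) atTop (𝓝 0) ∧
    Tendsto (fun k ↦ eLpNorm (fun ω ↦ (e k).integral F ω - X ω) 2 P) atTop (𝓝 0)

open Classical in
/-- The multiple Wiener–Itô integral of `g` with respect to `F` (with value `0` if `g` is not
integrable in this sense). -/
def multipleIntegral {d n : ℕ} {Ω : Type*} [MeasurableSpace Ω] (F : NoiseSet d → Ω → ℝ)
    (P : Measure Ω) (g : (Fin n → ℝ × Space d) → ℝ) : Ω → ℝ :=
  if h : ∃ X, IsMultipleIntegral F P g X then h.choose else 0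

/-! ### The Wiener chaoses of the stochastic heat equation -/

/-- The kernel of `I_t^{(n)}(f)`: at `(s₁, y₁), …, (sₙ, yₙ)` with `0 < s₁ < ⋯ < sₙ < t` it is
`κⁿ ∫ f(x) ∏ᵢ G_{sᵢ₊₁ - sᵢ}(yᵢ₊₁ - yᵢ) dx`, where `sₙ₊₁ = t` and `yₙ₊₁ = x`; elsewhere it is `0`. -/
def chaosKernel {d : ℕ} (κ t : ℝ) (f : Space d → ℝ) (n : ℕ) (p : Fin n → ℝ × Space d) : ℝ :=
  open Classical in
  if (∀ i, 0 < (p i).1 ∧ (p i).1 < t) ∧ StrictMono (fun i ↦ (p i).1) then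
    κ ^ n * ∫ x, f x * ∏ i : Fin n,
      let q : Fin (n + 1) → ℝ × Space d := Fin.snoc p (t, x)
      heatKernel ((q i.succ).1 - (q i.castSucc).1) ((q i.succ).2 - (q i.castSucc).2)
  else 0

/-- The integral `I_t^{(n)}(f)` of `f` against the `n`-th Wiener chaos of the solution of
`∂_t u = ½ Δ u + κ u Ḟ`, `u(0, ·) = 1`. -/
def chaos {d : ℕ} {Ω : Type*} [MeasurableSpace Ω] (F : NoiseSet d → Ω → ℝ) (P : Measure Ω)
    (κ t : ℝ) (n : ℕ) (f : Space d → ℝ) : Ω → ℝ :=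
  multipleIntegral F P (chaosKernel κ t f n)

/-- The indicator function of the open ball `B_R` of radius `R` centered at the origin. -/
def ballIndicator (d : ℕ) (R : ℝ) : Space d → ℝ :=
  (Metric.ball (0 : Space d) R).indicator fun _ ↦ 1

end CriticalSHE

end

/-! All kernels are nonnegative, so the analysis reduces to the two-point function u_n(t,x,x')
(`twoPoint`), whose double integral over B_R dominates the squared norm of the n-th kernel.
Splitting off the latest noise point gives (`twoPoint_succ`) u_{n+1}(t,x,x') = κ² ∫_0^t ∫∫
G_{t-s}(x-y) G_{t-s}(x'-z) ‖y-z‖⁻² u_n(s,y,z) dy dz ds. The difference of two independent heat flows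
has generator Δ, and Δ‖x‖^{-b} = -b(d-2-b)‖x‖^{-b-2}. Integrated over all times, the two flows thus
turn ‖y-z‖^{-b-2} into ‖x-x'‖^{-b}/(b(d-2-b)), and a bound u_n ≤ C‖x-x'‖^{-b} propagates with the
factor κ²/(b(d-2-b)). At b = (d-2)/2, the optimal exponent in Hardy's inequality, this factor is
4κ²/(d-2)² < 1. The computation is done by writing Riesz kernels as mixtures of heat kernels, so
that only the semigroup property and scaling are needed.

The recursion starts from u_0 = 1, that is b = 0, where the constant is infinite. Since t-s ≤ 1, a
weight (t-s)^{-θ} with 0 ≤ θ < 1 may be inserted; it raises the exponent from b to b+2θ at a finite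
cost (`lintegral_heat_flow_le`). The first d steps use a small θ to climb to (d-2)/2; from then on θ
= 0 and the constants decay geometrically. For n ≥ 2 the very last step uses a θ close to 1 instead:
as b is already bounded away from 0, the resulting exponent γ lies strictly between 2 and d,
uniformly in n (`twoPoint_add_two_le`). The integral of ‖x-x'‖^{-γ} over B_R × B_R is O(R^{2d-γ}) =
o(R^{2d-2}). For n = 1 that step would start from b = 0 and reach only exponents below 2.

On the probabilistic side, Wick's formula turns the second moment of an elementary integral into a
sum over permutations. For time-ordered kernels only the identity survives, so no n! appears. For
arbitrary elementary kernels, positive definiteness of the Riesz kernel gives a bound with n!; it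
yields convergence of the integrals and lets any approximating sequence be compared with an ordered
one (`lintegral_enorm_sq_le_of_isMultipleIntegral`). -/

noncomputable section

namespace CriticalSHE

/-! ### The heat kernel -/

section HeatKernel

variable {d : ℕ}

lemma heatKernel_nonneg {t : ℝ} (ht : 0 ≤ t) (x : Space d) : 0 ≤ heatKernel t x := by
  unfold heatKernel; positivity

@[fun_prop]
lemma measurable_heatKernel : Measurable fun p : ℝ × Space d ↦ heatKernel p.1 p.2 := by
  unfold heatKernel; fun_prop

@[fun_prop]
lemma Measurable.heatKernel {α : Type*} [MeasurableSpace α] {f : α → ℝ} {g : α → Space d}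
    (hf : Measurable f) (hg : Measurable g) :
    Measurable fun a ↦ heatKernel (f a) (g a) :=
  measurable_heatKernel.comp (hf.prodMk hg)

lemma heatKernel_neg (t : ℝ) (x : Space d) : heatKernel t (-x) = heatKernel t x := by
  simp [heatKernel]

lemma heatKernel_sub_comm (t : ℝ) (x y : Space d) :
    heatKernel t (x - y) = heatKernel t (y - x) := by
  rw [← heatKernel_neg, neg_sub]

/-- Completing the square in `y`: the midpoint of a Gaussian bridge has mean `(t / (s + t)) • x` and
variance parameter `s * t / (s + t)`. -/
lemma heatKernel_mul_heatKernel {s t : ℝ} (hs : 0 < s) (ht : 0 < t) (x y : Space d) :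
    heatKernel s (x - y) * heatKernel t y =
      heatKernel (s + t) x *
        heatKernel (s * t / (s + t)) (y - (t / (s + t)) • x) := by
  have hst : 0 < s + t := by positivity
  have h1 : ‖x - y‖ ^ 2 = ‖x‖ ^ 2 - 2 * inner ℝ x y + ‖y‖ ^ 2 := norm_sub_sq_real x y
  have h2 : ‖y - (t / (s + t)) • x‖ ^ 2 = ‖y‖ ^ 2 - 2 * ((t / (s + t)) * inner ℝ x y)
      + (t / (s + t)) ^ 2 * ‖x‖ ^ 2 := by
    rw [norm_sub_sq_real, inner_smul_right, norm_smul, mul_pow, real_inner_comm,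
      Real.norm_of_nonneg (by positivity)]
  have h3 : (2 * Real.pi * s) ^ (-(d : ℝ) / 2) * (2 * Real.pi * t) ^ (-(d : ℝ) / 2) =
      (2 * Real.pi * (s + t)) ^ (-(d : ℝ) / 2) *
        (2 * Real.pi * (s * t / (s + t))) ^ (-(d : ℝ) / 2) := by
    rw [← Real.mul_rpow (by positivity) (by positivity),
      ← Real.mul_rpow (by positivity) (by positivity)]
    congr 1
    field_simp
  have h4 : -‖x - y‖ ^ 2 / (2 * s) + -‖y‖ ^ 2 / (2 * t) =
      -‖x‖ ^ 2 / (2 * (s + t)) +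
        -‖y - (t / (s + t)) • x‖ ^ 2 / (2 * (s * t / (s + t))) := by
    rw [h1, h2]
    field_simp
    ring
  unfold heatKernel
  rw [mul_mul_mul_comm, ← Real.exp_add, h3, h4, Real.exp_add]
  ring

lemma lintegral_heatKernel {t : ℝ} (ht : 0 < t) :
    ∫⁻ x : Space d, ENNReal.ofReal (heatKernel t x) = 1 := by
  have hb : 0 < 1 / (2 * t) := by positivity
  have h := GaussianFourier.integral_rexp_neg_mul_sq_norm (V := Space d) hb
  have h0 : (0 : ℝ) < (Real.pi / (1 / (2 * t))) ^ ((d : ℝ) / 2) := by positivity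
  simp only [finrank_euclideanSpace, Fintype.card_fin] at h
  have hi : Integrable fun x : Space d ↦ Real.exp (-(1 / (2 * t)) * ‖x‖ ^ 2) := by
    -- A non-integrable function has integral `0` by convention, whereas the value in `h` is
    -- positive.
    by_contra hc
    rw [integral_undef hc] at h
    exact h0.ne h
  have he : (fun x : Space d ↦ heatKernel t x) = fun x ↦
      (2 * Real.pi * t) ^ (-(d : ℝ) / 2) * Real.exp (-(1 / (2 * t)) * ‖x‖ ^ 2) := by
    funext x
    unfold heatKernel
    congr 2
    field_simp
  have hi' : Integrable fun x : Space d ↦ heatKernel t x := by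
    rw [he]; exact hi.const_mul _
  rw [← ofReal_integral_eq_lintegral_ofReal hi' (ae_of_all _ fun x ↦ heatKernel_nonneg ht.le x),
    he, integral_const_mul, h, neg_div, Real.rpow_neg (by positivity)]
  rw [show Real.pi / (1 / (2 * t)) = 2 * Real.pi * t by field_simp, inv_mul_cancel₀ (by positivity),
    ENNReal.ofReal_one]

/-- The semigroup property of the heat kernel. -/
lemma lintegral_heatKernel_mul_heatKernel {s t : ℝ} (hs : 0 < s) (ht : 0 < t) (x z : Space d) :
    ∫⁻ y, ENNReal.ofReal (heatKernel s (x - y)) * ENNReal.ofReal (heatKernel t (y - z)) =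
      ENNReal.ofReal (heatKernel (s + t) (x - z)) := by
  have hst : 0 < s * t / (s + t) := by positivity
  rw [← lintegral_add_right_eq_self _ z]
  have h (y : Space d) : ENNReal.ofReal (heatKernel s (x - (y + z))) *
      ENNReal.ofReal (heatKernel t (y + z - z)) = ENNReal.ofReal (heatKernel (s + t) (x - z)) *
        ENNReal.ofReal (heatKernel (s * t / (s + t)) (y - (t / (s + t)) • (x - z))) := by
    rw [← ENNReal.ofReal_mul (heatKernel_nonneg hs.le _),
      ← ENNReal.ofReal_mul (heatKernel_nonneg (by positivity) _),
      ← heatKernel_mul_heatKernel hs ht]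
    congr 3
    · abel_nf
    · abel_nf
  simp_rw [h]
  rw [lintegral_const_mul _ (by fun_prop),
    lintegral_sub_right_eq_self (fun y ↦ ENNReal.ofReal (heatKernel (s * t / (s + t)) y)),
    lintegral_heatKernel hst, mul_one]

/-- The constant in the representation of `‖x‖ ^ (-b)` as a mixture of heat kernels. -/
def rieszConst (d : ℕ) (b : ℝ) : ℝ :=
  (2 * Real.pi) ^ (-(d : ℝ) / 2) * 2 ^ (b / 2) * Real.Gamma (b / 2)

lemma rieszConst_pos {b : ℝ} (hb : 0 < b) : 0 < rieszConst d b := by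
  have := Real.Gamma_pos_of_pos (half_pos hb)
  unfold rieszConst; positivity

/-- The functional equation of Gamma; it produces the factor `b` of the Hardy constant `b * (d - 2 -
b)`. -/
lemma rieszConst_add_two {b : ℝ} (hb : 0 < b) : rieszConst d (b + 2) = b * rieszConst d b := by
  unfold rieszConst
  rw [add_div, div_self two_ne_zero, Real.Gamma_add_one (by positivity),
    Real.rpow_add_one two_ne_zero]
  ring

lemma rpow_mul_heatKernel {b τ : ℝ} (hτ : 0 < τ) (x : Space d) :
    τ ^ (((d : ℝ) - b) / 2 - 1) * heatKernel τ x = (2 * Real.pi) ^ (-(d : ℝ) / 2) *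
      (τ ^ (-(b / 2) - 1) * Real.exp (-(‖x‖ ^ 2 / 2) * τ⁻¹)) := by
  unfold heatKernel
  rw [Real.mul_rpow (by positivity) hτ.le]
  rw [show -(b / 2) - 1 = (((d : ℝ) - b) / 2 - 1) + (-(d : ℝ) / 2) by ring, Real.rpow_add hτ,
    show -‖x‖ ^ 2 / (2 * τ) = -(‖x‖ ^ 2 / 2) * τ⁻¹ by field_simp]
  ring

/-- The substitution `τ ↦ τ⁻¹` in Euler's integral for Gamma. -/
lemma integral_rpow_mul_exp_inv {a c : ℝ} (ha : 0 < a) (hc : 0 < c) :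
    IntegrableOn (fun τ : ℝ ↦ τ ^ (-a - 1) * Real.exp (-c * τ⁻¹)) (Set.Ioi 0) ∧
    ∫ τ in Set.Ioi (0 : ℝ), τ ^ (-a - 1) * Real.exp (-c * τ⁻¹) = c ^ (-a) * Real.Gamma a := by
  have h := Real.integral_rpow_mul_exp_neg_mul_Ioi ha hc
  have hpos : 0 < (1 / c) ^ a * Real.Gamma a := by
    have := Real.Gamma_pos_of_pos ha
    positivity
  have hi : IntegrableOn (fun t : ℝ ↦ t ^ (a - 1) * Real.exp (-(c * t))) (Set.Ioi 0) := by
    by_contra hcon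
    rw [integral_undef hcon] at h
    exact hpos.ne h
  have hcongr : ∀ τ ∈ Set.Ioi (0 : ℝ), (|(-1 : ℝ)| * τ ^ ((-1 : ℝ) - 1)) •
      ((τ ^ (-1 : ℝ)) ^ (a - 1) * Real.exp (-(c * τ ^ (-1 : ℝ)))) =
      τ ^ (-a - 1) * Real.exp (-c * τ⁻¹) := by
    intro τ hτ
    have hτ : 0 < τ := hτ
    rw [← Real.rpow_mul hτ.le, abs_neg, abs_one, one_mul, smul_eq_mul, ← mul_assoc,
      ← Real.rpow_add hτ, Real.rpow_neg_one, neg_mul]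
    congr 2 <;> ring
  constructor
  · rw [← integrableOn_Ioi_comp_rpow_iff _ (show (-1 : ℝ) ≠ 0 by norm_num)] at hi
    exact hi.congr_fun hcongr measurableSet_Ioi
  · rw [← integral_comp_rpow_Ioi _ (show (-1 : ℝ) ≠ 0 by norm_num)] at h
    rw [← setIntegral_congr_fun measurableSet_Ioi hcongr, h, Real.rpow_neg hc.le, one_div,
      Real.inv_rpow hc.le]

/-- The Riesz kernel `‖x‖ ^ (-b)` as a mixture of heat kernels. -/
lemma lintegral_rpow_mul_heatKernel {b : ℝ} (hb : 0 < b) (x : Space d) :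
    ∫⁻ τ in Set.Ioi (0 : ℝ), ENNReal.ofReal (τ ^ (((d : ℝ) - b) / 2 - 1)) *
      ENNReal.ofReal (heatKernel τ x) = ENNReal.ofReal (rieszConst d b) * ‖x‖ₑ ^ (-b) := by
  have h1 : ∀ τ ∈ Set.Ioi (0 : ℝ), ENNReal.ofReal (τ ^ (((d : ℝ) - b) / 2 - 1)) *
      ENNReal.ofReal (heatKernel τ x) = ENNReal.ofReal ((2 * Real.pi) ^ (-(d : ℝ) / 2)) *
        ENNReal.ofReal (τ ^ (-(b / 2) - 1) * Real.exp (-(‖x‖ ^ 2 / 2) * τ⁻¹)) := by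
    intro τ hτ
    have hτ : 0 < τ := hτ
    rw [← ENNReal.ofReal_mul (by positivity), rpow_mul_heatKernel hτ,
      ENNReal.ofReal_mul (by positivity)]
  rw [setLIntegral_congr_fun measurableSet_Ioi h1, lintegral_const_mul _ (by fun_prop)]
  -- On the diagonal both sides are `∞`: the exponential equals `1` and no pure power is integrable
  -- on the half-line.
  rcases eq_or_ne x 0 with rfl | hx
  · have h2 : ∫⁻ τ in Set.Ioi (0 : ℝ), ENNReal.ofReal
        (τ ^ (-(b / 2) - 1) * Real.exp (-(‖(0 : Space d)‖ ^ 2 / 2) * τ⁻¹)) = ∞ := by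
      by_contra hcon
      apply not_integrableOn_Ioi_rpow (-(b / 2) - 1)
      refine ⟨by fun_prop, ?_⟩
      rw [hasFiniteIntegral_iff_ofReal]
      · simpa [lt_top_iff_ne_top] using hcon
      · filter_upwards [ae_restrict_mem measurableSet_Ioi] with τ hτ
        exact Real.rpow_nonneg (le_of_lt hτ) _
    rw [h2, enorm_zero, ENNReal.zero_rpow_of_neg (by linarith), ENNReal.mul_top, ENNReal.mul_top]
    · simpa using rieszConst_pos hb
    · simp; positivity
  · have hx' : 0 < ‖x‖ := norm_pos_iff.mpr hx
    obtain ⟨hi, he⟩ := integral_rpow_mul_exp_inv (half_pos hb) (show 0 < ‖x‖ ^ 2 / 2 by positivity)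
    rw [← ofReal_integral_eq_lintegral_ofReal hi, he]
    · rw [← ofReal_norm, ENNReal.ofReal_rpow_of_pos hx', ← ENNReal.ofReal_mul (by positivity),
        ← ENNReal.ofReal_mul (rieszConst_pos hb).le]
      congr 1
      unfold rieszConst
      rw [Real.div_rpow (by positivity) (by positivity), ← Real.rpow_natCast,
        ← Real.rpow_mul hx'.le, Real.rpow_neg zero_le_two]
      simp only [Nat.cast_ofNat, mul_neg]
      rw [mul_div_cancel₀ _ two_ne_zero]
      field_simp
    · filter_upwards [ae_restrict_mem measurableSet_Ioi] with τ hτ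
      have hτ : 0 < τ := hτ
      positivity

lemma setLIntegral_Ioi_comp_mul_left {c : ℝ} (hc : 0 < c) {f : ℝ → ℝ≥0∞} (hf : Measurable f) :
    ∫⁻ x in Set.Ioi 0, f (c * x) = ENNReal.ofReal c⁻¹ * ∫⁻ x in Set.Ioi 0, f x := by
  have h := Real.map_volume_mul_left hc.ne'
  rw [← lintegral_indicator measurableSet_Ioi, ← lintegral_indicator measurableSet_Ioi,
    ← abs_of_pos (inv_pos.mpr hc), ← smul_eq_mul, ← lintegral_smul_measure, ← h,
    lintegral_map (hf.indicator measurableSet_Ioi) (by fun_prop)]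
  refine lintegral_congr fun x ↦ ?_
  simp [Set.indicator, hc]

/-- The Euler-type integral that governs the smoothing of Riesz kernels by the heat flow. -/
def smoothingConst (θ p : ℝ) : ℝ≥0∞ :=
  ∫⁻ ρ in Set.Ioi (0 : ℝ), ENNReal.ofReal (ρ ^ (-θ) * (1 + 2 * ρ) ^ (-(p - θ) - 1))

/-- Near `0` the integrand is at most `ρ ^ (-θ)`, integrable since `θ < 1`; near infinity the powers
combine to `ρ ^ (-p - 1)`. -/
lemma smoothingConst_lt_top {θ p : ℝ} (hθ : θ < 1) (hp : 0 < p) : smoothingConst θ p < ∞ := by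
  unfold smoothingConst
  rw [← Set.Ioc_union_Ioi_eq_Ioi zero_le_one]
  refine (lintegral_union_le _ _ _).trans_lt (ENNReal.add_lt_top.mpr ⟨?_, ?_⟩)
  · have hi : IntegrableOn (fun ρ : ℝ ↦ ρ ^ (-θ)) (Set.Ioc 0 1) := by
      rw [← intervalIntegrable_iff_integrableOn_Ioc_of_le zero_le_one]
      exact intervalIntegral.intervalIntegrable_rpow' (by linarith)
    refine (setLIntegral_mono' measurableSet_Ioc fun ρ hρ ↦ ?_).trans_lt hi.lintegral_lt_top
    refine ENNReal.ofReal_le_ofReal (mul_le_of_le_one_right (Real.rpow_nonneg hρ.1.le _) ?_)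
    exact Real.rpow_le_one_of_one_le_of_nonpos (by linarith [hρ.1]) (by linarith)
  · have hi : IntegrableOn (fun ρ : ℝ ↦ ρ ^ (-p - 1)) (Set.Ioi 1) :=
      integrableOn_Ioi_rpow_of_lt (by linarith) one_pos
    refine (setLIntegral_mono' measurableSet_Ioi fun ρ hρ ↦ ?_).trans_lt hi.lintegral_lt_top
    have hρ : 1 < ρ := hρ
    have hρ0 : 0 < ρ := by linarith
    refine ENNReal.ofReal_le_ofReal ?_
    rw [show -p - 1 = -θ + (-(p - θ) - 1) by ring, Real.rpow_add hρ0]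
    refine mul_le_mul_of_nonneg_left ?_ (by positivity)
    exact Real.rpow_le_rpow_of_nonpos hρ0 (by linarith) (by linarith)

/-- For `θ = 0` the integral is elementary. With `p = (d - 2 - b) / 2` the bound supplies the other
factor `d - 2 - b` of the Hardy constant. -/
lemma smoothingConst_zero_le {p : ℝ} (hp : 0 < p) :
    smoothingConst 0 p ≤ ENNReal.ofReal (1 / (2 * p)) := by
  have hm : Measurable fun ρ : ℝ ↦ ENNReal.ofReal ((1 + ρ) ^ (-p - 1)) := by fun_prop
  have h1 : smoothingConst 0 p = ENNReal.ofReal 2⁻¹ *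
      ∫⁻ ρ in Set.Ioi (0 : ℝ), ENNReal.ofReal ((1 + ρ) ^ (-p - 1)) := by
    rw [← setLIntegral_Ioi_comp_mul_left two_pos hm]
    simp [smoothingConst]
  have h2 : ∫⁻ ρ in Set.Ioi (0 : ℝ), ENNReal.ofReal ((1 + ρ) ^ (-p - 1)) =
      ∫⁻ ρ in Set.Ioi (1 : ℝ), ENNReal.ofReal (ρ ^ (-p - 1)) := by
    rw [← lintegral_indicator measurableSet_Ioi, ← lintegral_indicator measurableSet_Ioi,
      ← lintegral_add_left_eq_self ((Set.Ioi (1 : ℝ)).indicator _) 1]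
    refine lintegral_congr fun x ↦ ?_
    simp [Set.indicator]
  have hi : IntegrableOn (fun ρ : ℝ ↦ ρ ^ (-p - 1)) (Set.Ioi 1) :=
    integrableOn_Ioi_rpow_of_lt (by linarith) one_pos
  rw [h1, h2, ← ofReal_integral_eq_lintegral_ofReal hi,
    integral_Ioi_rpow_of_lt (by linarith) one_pos, ← ENNReal.ofReal_mul (by positivity)]
  · refine ENNReal.ofReal_le_ofReal (le_of_eq ?_)
    rw [Real.one_rpow, sub_add_cancel]
    field_simp
  · filter_upwards [ae_restrict_mem measurableSet_Ioi] with ρ hρ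
    exact Real.rpow_nonneg (zero_le_one.trans (le_of_lt hρ)) _

/-- The semigroup property used twice: the times `r`, `τ`, `r` add up. -/
lemma lintegral_lintegral_heatKernel {r τ : ℝ} (hr : 0 < r) (hτ : 0 < τ) (x x' : Space d) :
    ∫⁻ y, ∫⁻ z, ENNReal.ofReal (heatKernel r (x - y)) * ENNReal.ofReal (heatKernel r (x' - z)) *
      ENNReal.ofReal (heatKernel τ (y - z)) =
      ENNReal.ofReal (heatKernel (τ + 2 * r) (x - x')) := by
  have h (y : Space d) : ∫⁻ z, ENNReal.ofReal (heatKernel r (x - y)) *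
      ENNReal.ofReal (heatKernel r (x' - z)) * ENNReal.ofReal (heatKernel τ (y - z)) =
      ENNReal.ofReal (heatKernel r (x - y)) * ENNReal.ofReal (heatKernel (τ + r) (y - x')) := by
    rw [← lintegral_heatKernel_mul_heatKernel hτ hr, ← lintegral_const_mul _ (by fun_prop)]
    refine lintegral_congr fun z ↦ ?_
    rw [heatKernel_sub_comm r x' z]
    ring
  simp_rw [h]
  rw [lintegral_heatKernel_mul_heatKernel hr (by positivity)]
  congr 2
  ring

/-- Two independent heat flows acting on a Riesz kernel. -/
lemma lintegral_heatKernel_mul_enorm_rpow {r b : ℝ} (hr : 0 < r) (hb : 0 < b) (x x' : Space d) :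
    ENNReal.ofReal (rieszConst d b) * ∫⁻ y, ∫⁻ z, ENNReal.ofReal (heatKernel r (x - y)) *
      ENNReal.ofReal (heatKernel r (x' - z)) * ‖y - z‖ₑ ^ (-b) =
    ∫⁻ τ in Set.Ioi (0 : ℝ), ENNReal.ofReal (τ ^ (((d : ℝ) - b) / 2 - 1)) *
      ENNReal.ofReal (heatKernel (τ + 2 * r) (x - x')) := by
  have h1 : ∀ τ ∈ Set.Ioi (0 : ℝ), ENNReal.ofReal (τ ^ (((d : ℝ) - b) / 2 - 1)) *
      ENNReal.ofReal (heatKernel (τ + 2 * r) (x - x')) =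
      ∫⁻ y, ∫⁻ z, ENNReal.ofReal (heatKernel r (x - y)) * ENNReal.ofReal (heatKernel r (x' - z)) *
        (ENNReal.ofReal (τ ^ (((d : ℝ) - b) / 2 - 1)) * ENNReal.ofReal (heatKernel τ (y - z))) := by
    intro τ hτ
    rw [← lintegral_lintegral_heatKernel hr hτ, ← lintegral_const_mul _ (by fun_prop)]
    refine lintegral_congr fun y ↦ ?_
    rw [← lintegral_const_mul _ (by fun_prop)]
    refine lintegral_congr fun z ↦ ?_
    ring
  rw [setLIntegral_congr_fun measurableSet_Ioi h1]
  symm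
  rw [lintegral_lintegral_swap (by fun_prop), ← lintegral_const_mul _ (by fun_prop)]
  refine lintegral_congr fun y ↦ ?_
  rw [lintegral_lintegral_swap (by fun_prop), ← lintegral_const_mul _ (by fun_prop)]
  refine lintegral_congr fun z ↦ ?_
  rw [lintegral_const_mul _ (by fun_prop), lintegral_rpow_mul_heatKernel hb]
  ring

/-- Scaling decouples the two integrals: `r = τ ρ` turns the time `τ + 2 r` into `(1 + 2 ρ) τ`, and
rescaling `τ` then splits off the integral in `ρ`. What remains is again a mixture of heat kernels,
hence a Riesz kernel with a new index. -/
lemma lintegral_rpow_lintegral_heatKernel_add {p θ : ℝ} (u : Space d) :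
    ∫⁻ r in Set.Ioi (0 : ℝ), ENNReal.ofReal (r ^ (-θ)) * ∫⁻ τ in Set.Ioi (0 : ℝ),
      ENNReal.ofReal (τ ^ (p - 1)) * ENNReal.ofReal (heatKernel (τ + 2 * r) u) =
    smoothingConst θ p * ∫⁻ τ in Set.Ioi (0 : ℝ), ENNReal.ofReal (τ ^ (p - θ)) *
      ENNReal.ofReal (heatKernel τ u) := by
  have h1 : ∀ τ ∈ Set.Ioi (0 : ℝ), ∫⁻ r in Set.Ioi (0 : ℝ), ENNReal.ofReal (r ^ (-θ)) *
      (ENNReal.ofReal (τ ^ (p - 1)) * ENNReal.ofReal (heatKernel (τ + 2 * r) u)) =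
      ∫⁻ ρ in Set.Ioi (0 : ℝ), ENNReal.ofReal (ρ ^ (-θ)) * (ENNReal.ofReal (τ ^ (p - θ)) *
        ENNReal.ofReal (heatKernel ((1 + 2 * ρ) * τ) u)) := by
    intro τ hτ
    have hτ : 0 < τ := hτ
    have h := setLIntegral_Ioi_comp_mul_left hτ (f := fun r ↦ ENNReal.ofReal (r ^ (-θ)) *
      (ENNReal.ofReal (τ ^ (p - 1)) * ENNReal.ofReal (heatKernel (τ + 2 * r) u))) (by fun_prop)
    have h' : ENNReal.ofReal τ * ENNReal.ofReal τ⁻¹ = 1 := by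
      rw [← ENNReal.ofReal_mul hτ.le, mul_inv_cancel₀ hτ.ne', ENNReal.ofReal_one]
    rw [← one_mul (lintegral _ _), ← h', mul_assoc, ← h, ← lintegral_const_mul _ (by fun_prop)]
    refine setLIntegral_congr_fun measurableSet_Ioi fun ρ hρ ↦ ?_
    have hρ : 0 < ρ := hρ
    have e : τ * (τ * ρ) ^ (-θ) * τ ^ (p - 1) = ρ ^ (-θ) * τ ^ (p - θ) := by
      rw [Real.mul_rpow hτ.le hρ.le, show p - θ = 1 + -θ + (p - 1) by ring, Real.rpow_add hτ,
        Real.rpow_add hτ, Real.rpow_one]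
      ring
    have e' := congrArg ENNReal.ofReal e
    rw [ENNReal.ofReal_mul (by positivity), ENNReal.ofReal_mul (by positivity),
      ENNReal.ofReal_mul (by positivity)] at e'
    rw [show τ + 2 * (τ * ρ) = (1 + 2 * ρ) * τ by ring]
    simp only [← mul_assoc]
    rw [e']
  have h2 : ∀ ρ ∈ Set.Ioi (0 : ℝ), ∫⁻ τ in Set.Ioi (0 : ℝ), ENNReal.ofReal (ρ ^ (-θ)) *
      (ENNReal.ofReal (τ ^ (p - θ)) * ENNReal.ofReal (heatKernel ((1 + 2 * ρ) * τ) u)) =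
      ENNReal.ofReal (ρ ^ (-θ) * (1 + 2 * ρ) ^ (-(p - θ) - 1)) *
        ∫⁻ τ in Set.Ioi (0 : ℝ), ENNReal.ofReal (τ ^ (p - θ)) *
          ENNReal.ofReal (heatKernel τ u) := by
    intro ρ hρ
    have hρ : 0 < ρ := hρ
    have hc : 0 < 1 + 2 * ρ := by positivity
    have h := setLIntegral_Ioi_comp_mul_left hc (f := fun τ ↦ ENNReal.ofReal (τ ^ (p - θ)) *
      ENNReal.ofReal (heatKernel τ u)) (by fun_prop)
    rw [show -(p - θ) - 1 = -(p - θ) + -1 by ring, Real.rpow_add hc, Real.rpow_neg_one,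
      ← mul_assoc, ENNReal.ofReal_mul (by positivity), mul_assoc, ← h,
      ← lintegral_const_mul _ (by fun_prop)]
    refine setLIntegral_congr_fun measurableSet_Ioi fun τ hτ ↦ ?_
    have hτ : 0 < τ := hτ
    have e : ρ ^ (-θ) * τ ^ (p - θ) =
        ρ ^ (-θ) * (1 + 2 * ρ) ^ (-(p - θ)) * ((1 + 2 * ρ) * τ) ^ (p - θ) := by
      rw [Real.mul_rpow hc.le hτ.le, Real.rpow_neg hc.le]
      field_simp
    have e' := congrArg ENNReal.ofReal e
    rw [ENNReal.ofReal_mul (by positivity), ENNReal.ofReal_mul (by positivity)] at e'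
    simp only [← mul_assoc]
    rw [e']
  calc
    _ = ∫⁻ r in Set.Ioi (0 : ℝ), ∫⁻ τ in Set.Ioi (0 : ℝ), ENNReal.ofReal (r ^ (-θ)) *
        (ENNReal.ofReal (τ ^ (p - 1)) * ENNReal.ofReal (heatKernel (τ + 2 * r) u)) :=
      lintegral_congr fun r ↦ (lintegral_const_mul _ (by fun_prop)).symm
    _ = _ := by
      rw [lintegral_lintegral_swap (by fun_prop), setLIntegral_congr_fun measurableSet_Ioi h1,
        lintegral_lintegral_swap (by fun_prop), setLIntegral_congr_fun measurableSet_Ioi h2,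
        lintegral_mul_const _ (by fun_prop)]
      rfl

/-- The constant in the estimate of the heat flow of a Riesz kernel, integrated in time. -/
def flowConst (d : ℕ) (b θ : ℝ) : ℝ≥0∞ :=
  smoothingConst θ (((d : ℝ) - 2 - b) / 2) *
    (ENNReal.ofReal (rieszConst d (b + 2 * θ)) / ENNReal.ofReal (rieszConst d (b + 2)))

lemma flowConst_lt_top {b θ : ℝ} (hb : 0 ≤ b) (hbd : b < (d : ℝ) - 2) (hθ : θ < 1) :
    flowConst d b θ < ∞ := by
  refine ENNReal.mul_lt_top (smoothingConst_lt_top hθ (by linarith))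
    (ENNReal.div_lt_top ENNReal.ofReal_ne_top ?_)
  simpa using rieszConst_pos (by linarith)

/-- This is the inverse of the eigenvalue in `-Δ ‖x‖ ^ (-b) = b (d - 2 - b) ‖x‖ ^ (-b - 2)`,
obtained from the ratio `1 / b` of the two Riesz constants. -/
lemma flowConst_zero_le {b : ℝ} (hb : 0 < b) (hbd : b < (d : ℝ) - 2) :
    flowConst d b 0 ≤ ENNReal.ofReal (1 / (b * (d - 2 - b))) := by
  have hA : 0 < rieszConst d b := rieszConst_pos hb
  have hA' : 0 < d - 2 - b := by linarith
  unfold flowConst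
  rw [mul_zero, add_zero, rieszConst_add_two hb, ← ENNReal.ofReal_div_of_pos (by positivity)]
  refine (mul_le_mul_left (smoothingConst_zero_le (by linarith)) _).trans (le_of_eq ?_)
  rw [← ENNReal.ofReal_mul (by positivity)]
  congr 1
  field_simp

/-- Hardy-type estimate: two independent heat flows, integrated in time, improve the singularity
of a Riesz kernel. -/
lemma lintegral_heat_flow_le {b θ t : ℝ} (hb : 0 ≤ b) (hθ : 0 ≤ θ)
    (hpos : 0 < b + 2 * θ) (ht : t ≤ 1) (x x' : Space d) :
    ∫⁻ s in Set.Ioo 0 t, ∫⁻ y, ∫⁻ z, ENNReal.ofReal (heatKernel (t - s) (x - y)) *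
      ENNReal.ofReal (heatKernel (t - s) (x' - z)) * ‖y - z‖ₑ ^ (-(b + 2)) ≤
    flowConst d b θ * ‖x - x'‖ₑ ^ (-(b + 2 * θ)) := by
  have hA : ENNReal.ofReal (rieszConst d (b + 2)) ≠ 0 := by
    simpa using rieszConst_pos (by linarith)
  set A := ENNReal.ofReal (rieszConst d (b + 2)) with hAdef
  set f : ℝ → ℝ≥0∞ := fun r ↦ ∫⁻ y, ∫⁻ z, ENNReal.ofReal (heatKernel r (x - y)) *
      ENNReal.ofReal (heatKernel r (x' - z)) * ‖y - z‖ₑ ^ (-(b + 2)) with hf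
  set p := ((d : ℝ) - 2 - b) / 2 with hp
  -- With `r = t - s ≤ 1` the weight `r ^ (-θ)` is at least `1`. Extending the range of `r` to all
  -- positive times then makes the scaling argument available.
  have h1 : ∫⁻ s in Set.Ioo 0 t, f (t - s) ≤
      ∫⁻ r in Set.Ioi 0, ENNReal.ofReal (r ^ (-θ)) * f r := by
    rw [← lintegral_indicator measurableSet_Ioo, ← lintegral_indicator measurableSet_Ioi,
      ← lintegral_sub_left_eq_self _ t]
    refine lintegral_mono fun s ↦ ?_
    by_cases hs : t - s ∈ Set.Ioo 0 t
    · have h0 : s ∈ Set.Ioi (0 : ℝ) := by simpa using hs.2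
      have h0' : 0 < s := h0
      have h1' : s < t := by simpa using hs.1
      rw [Set.indicator_of_mem hs, Set.indicator_of_mem h0, sub_sub_cancel]
      refine le_mul_of_one_le_left' ?_
      rw [ENNReal.one_le_ofReal]
      exact Real.one_le_rpow_of_pos_of_le_one_of_nonpos h0' (by linarith) (by linarith)
    · rw [Set.indicator_of_notMem hs]
      exact zero_le
  have h2 : ∀ r ∈ Set.Ioi (0 : ℝ), ENNReal.ofReal (r ^ (-θ)) * f r =
      A⁻¹ * (ENNReal.ofReal (r ^ (-θ)) * ∫⁻ τ in Set.Ioi (0 : ℝ),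
      ENNReal.ofReal (τ ^ (p - 1)) * ENNReal.ofReal (heatKernel (τ + 2 * r) (x - x'))) := by
    intro r hr
    have h := lintegral_heatKernel_mul_enorm_rpow hr (show 0 < b + 2 by linarith) x x'
    rw [show ((d : ℝ) - (b + 2)) / 2 = p by rw [hp]; ring] at h
    rw [← h, ← hAdef, mul_left_comm (ENNReal.ofReal (r ^ (-θ))), ← mul_assoc,
      ENNReal.inv_mul_cancel hA ENNReal.ofReal_ne_top, one_mul]
  refine h1.trans (le_of_eq ?_)
  rw [setLIntegral_congr_fun measurableSet_Ioi h2, lintegral_const_mul _ (by fun_prop),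
    lintegral_rpow_lintegral_heatKernel_add,
    show p - θ = ((d : ℝ) - (b + 2 * θ)) / 2 - 1 by rw [hp]; ring,
    lintegral_rpow_mul_heatKernel hpos, flowConst, ← hAdef, ← hp, ENNReal.div_eq_inv_mul]
  ring

end HeatKernel

/-! ### The positive definite pairing of the noise -/

lemma lintegral_fin_prod_eq_prod {n : ℕ} {E : Type*} [MeasureSpace E]
    [SigmaFinite (volume : Measure E)] (f : Fin n → E → ℝ≥0∞) (hf : ∀ i, Measurable (f i)) :
    ∫⁻ x : Fin n → E, ∏ i, f i (x i) = ∏ i, ∫⁻ x, f i x := by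
  induction n with
  | zero => simp [volume_pi]
  | succ n ih =>
    rw [← (volume_preserving_piFinSuccAbove (fun _ : Fin (n + 1) ↦ E) 0).symm.lintegral_comp_emb
      (MeasurableEquiv.measurableEmbedding _)]
    simp only [MeasurableEquiv.piFinSuccAbove_symm_apply, Fin.insertNthEquiv,
      Fin.prod_univ_succ, Fin.insertNth_zero, Equiv.coe_fn_mk, Fin.cons_succ, Fin.cons_zero]
    rw [← ih _ fun i ↦ hf _]
    exact lintegral_prod_mul (μ := volume) (ν := volume) (f := f 0)
      (g := fun x : Fin n → E ↦ ∏ i, f i.succ (x i))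
      (hf 0).aemeasurable (Finset.measurable_prod _ fun i _ ↦
        (hf i.succ).comp (measurable_pi_apply i)).aemeasurable

section Pairing

variable {d n : ℕ}

/-- The bilinear form `∫ a(s,y) b(s,z) ∏ᵢ ‖yᵢ - zᵢ‖⁻² dy dz ds` on nonnegative kernels. -/
def rieszPairing (a b : (Fin n → ℝ × Space d) → ℝ≥0∞) : ℝ≥0∞ :=
  ∫⁻ s : Fin n → ℝ, ∫⁻ y : Fin n → Space d, ∫⁻ z : Fin n → Space d,
    a (fun i ↦ (s i, y i)) * b (fun i ↦ (s i, z i)) * ∏ i, (‖y i - z i‖ₑ ^ 2)⁻¹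

lemma rieszNormSq_eq_rieszPairing (g : (Fin n → ℝ × Space d) → ℝ) :
    rieszNormSq g = rieszPairing (fun p ↦ ‖g p‖ₑ) (fun p ↦ ‖g p‖ₑ) := rfl

lemma rieszPairing_mono {a a' b b' : (Fin n → ℝ × Space d) → ℝ≥0∞} (ha : ∀ p, a p ≤ a' p)
    (hb : ∀ p, b p ≤ b' p) : rieszPairing a b ≤ rieszPairing a' b' := by
  unfold rieszPairing
  gcongr with s y z
  · exact ha _
  · exact hb _

lemma rieszNormSq_mono {g h : (Fin n → ℝ × Space d) → ℝ} (H : ∀ p, ‖g p‖ ≤ ‖h p‖) :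
    rieszNormSq g ≤ rieszNormSq h :=
  rieszPairing_mono (fun p ↦ enorm_le_iff_norm_le.mpr (H p))
    (fun p ↦ enorm_le_iff_norm_le.mpr (H p))

/-- The square root of the Riesz kernel of index `2`. -/
def rieszRoot (q : ℝ × Space d) (y : Space d) : ℝ≥0∞ :=
  (Set.Ioi (0 : ℝ)).indicator (fun τ ↦ ((ENNReal.ofReal (rieszConst d 2))⁻¹ *
    ENNReal.ofReal (τ ^ (((d : ℝ) - 2) / 2 - 1))) ^ (1 / 2 : ℝ)) q.1 *
    ENNReal.ofReal (heatKernel (q.1 / 2) (y - q.2))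

@[fun_prop]
lemma measurable_rieszRoot :
    Measurable fun p : (ℝ × Space d) × Space d ↦ rieszRoot p.1 p.2 := by
  unfold rieszRoot
  have h : Measurable ((Set.Ioi (0 : ℝ)).indicator (fun τ ↦ ((ENNReal.ofReal (rieszConst d 2))⁻¹ *
    ENNReal.ofReal (τ ^ (((d : ℝ) - 2) / 2 - 1))) ^ (1 / 2 : ℝ))) :=
    Measurable.indicator (by fun_prop) measurableSet_Ioi
  fun_prop

@[fun_prop]
lemma Measurable.rieszRoot {α : Type*} [MeasurableSpace α] {f : α → ℝ × Space d}
    {g : α → Space d} (hf : Measurable f) (hg : Measurable g) :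
    Measurable fun a ↦ rieszRoot (f a) (g a) :=
  measurable_rieszRoot.comp (hf.prodMk hg)

lemma enorm_rpow_neg_two (x : Space d) : ‖x‖ₑ ^ (-2 : ℝ) = (‖x‖ₑ ^ 2)⁻¹ := by
  rw [ENNReal.rpow_neg, ENNReal.rpow_two]

/-- Each heat kernel of time `τ` in the mixture is split into two of time `τ / 2`. The Riesz kernel
thereby becomes a Gram kernel, which is its positive definiteness. -/
lemma lintegral_rieszRoot_mul_rieszRoot (y z : Space d) :
    ∫⁻ q, rieszRoot q y * rieszRoot q z = (‖y - z‖ₑ ^ 2)⁻¹ := by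
  have h1 (q : ℝ × Space d) : rieszRoot q y * rieszRoot q z =
      (Set.Ioi (0 : ℝ)).indicator (fun τ ↦ (ENNReal.ofReal (rieszConst d 2))⁻¹ *
      ENNReal.ofReal (τ ^ (((d : ℝ) - 2) / 2 - 1))) q.1 *
      (ENNReal.ofReal (heatKernel (q.1 / 2) (y - q.2)) *
        ENNReal.ofReal (heatKernel (q.1 / 2) (q.2 - z))) := by
    unfold rieszRoot
    rw [heatKernel_sub_comm _ z, mul_mul_mul_comm]
    congr 1
    by_cases hq : q.1 ∈ Set.Ioi (0 : ℝ)
    · rw [Set.indicator_of_mem hq, Set.indicator_of_mem hq,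
        ← ENNReal.rpow_add_of_nonneg _ _ (by norm_num) (by norm_num)]
      norm_num
    · simp [Set.indicator_of_notMem hq]
  have hA : ENNReal.ofReal (rieszConst d 2) ≠ 0 := by simpa using rieszConst_pos two_pos
  have hm : Measurable ((Set.Ioi (0 : ℝ)).indicator (fun τ ↦ (ENNReal.ofReal (rieszConst d 2))⁻¹ *
    ENNReal.ofReal (τ ^ (((d : ℝ) - 2) / 2 - 1)))) :=
    Measurable.indicator (by fun_prop) measurableSet_Ioi
  simp_rw [h1]
  rw [Measure.volume_eq_prod, lintegral_prod _ (by fun_prop), ← enorm_rpow_neg_two,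
    ← one_mul (‖y - z‖ₑ ^ (-2 : ℝ)), ← ENNReal.inv_mul_cancel hA ENNReal.ofReal_ne_top, mul_assoc,
    ← lintegral_rpow_mul_heatKernel two_pos, ← lintegral_const_mul _ (by fun_prop),
    ← lintegral_indicator measurableSet_Ioi]
  refine lintegral_congr fun τ ↦ ?_
  by_cases hτ : τ ∈ Set.Ioi (0 : ℝ)
  · have hτ' : 0 < τ / 2 := half_pos hτ
    simp only [Set.indicator_of_mem hτ]
    rw [lintegral_const_mul _ (by fun_prop), lintegral_heatKernel_mul_heatKernel hτ' hτ',
      add_halves, mul_assoc]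
  · simp [Set.indicator_of_notMem hτ]

/-- The transform that turns the pairing of the noise into an `L²` inner product. -/
def rieszTransform (a : (Fin n → ℝ × Space d) → ℝ≥0∞) (s : Fin n → ℝ)
    (q : Fin n → ℝ × Space d) : ℝ≥0∞ :=
  ∫⁻ y : Fin n → Space d, a (fun i ↦ (s i, y i)) * ∏ i, rieszRoot (q i) (y i)

@[fun_prop]
lemma measurable_rieszTransform {a : (Fin n → ℝ × Space d) → ℝ≥0∞} (ha : Measurable a) :
    Measurable fun p : (Fin n → ℝ) × (Fin n → ℝ × Space d) ↦ rieszTransform a p.1 p.2 := by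
  unfold rieszTransform
  fun_prop

lemma rieszPairing_eq_lintegral_rieszTransform {a b : (Fin n → ℝ × Space d) → ℝ≥0∞}
    (ha : Measurable a) (hb : Measurable b) :
    rieszPairing a b = ∫⁻ s, ∫⁻ q, rieszTransform a s q * rieszTransform b s q := by
  unfold rieszPairing
  refine lintegral_congr fun s ↦ ?_
  have h (q : Fin n → ℝ × Space d) : rieszTransform a s q * rieszTransform b s q =
      ∫⁻ y : Fin n → Space d, ∫⁻ z : Fin n → Space d,
      a (fun i ↦ (s i, y i)) * b (fun i ↦ (s i, z i)) *
        ∏ i, (rieszRoot (q i) (y i) * rieszRoot (q i) (z i)) := by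
    unfold rieszTransform
    rw [← lintegral_mul_const _ (by fun_prop)]
    refine lintegral_congr fun y ↦ ?_
    rw [← lintegral_const_mul _ (by fun_prop)]
    refine lintegral_congr fun z ↦ ?_
    rw [Finset.prod_mul_distrib]
    ring
  simp_rw [h]
  symm
  rw [lintegral_lintegral_swap (by fun_prop)]
  refine lintegral_congr fun y ↦ ?_
  rw [lintegral_lintegral_swap (by fun_prop)]
  refine lintegral_congr fun z ↦ ?_
  rw [lintegral_const_mul _ (by fun_prop)]
  congr 1
  rw [lintegral_fin_prod_eq_prod (fun i q ↦ rieszRoot q (y i) * rieszRoot q (z i))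
    (fun i ↦ by fun_prop)]
  exact Finset.prod_congr rfl fun i _ ↦ lintegral_rieszRoot_mul_rieszRoot _ _

lemma two_mul_mul_le_add (u v : ℝ≥0∞) : 2 * (u * v) ≤ u * u + v * v := by
  rcases eq_or_ne u ∞ with rfl | hu
  · simp
  rcases eq_or_ne v ∞ with rfl | hv
  · simp
  lift u to NNReal using hu
  lift v to NNReal using hv
  norm_cast
  have := two_mul_le_add_sq u v
  nlinarith

/-- Cauchy–Schwarz in additive form: after the transform it is the pointwise inequality `2uv ≤ u² +
v²`. Mere positivity of the kernel would not suffice. -/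
lemma two_mul_rieszPairing_le {a b : (Fin n → ℝ × Space d) → ℝ≥0∞}
    (ha : Measurable a) (hb : Measurable b) :
    2 * rieszPairing a b ≤ rieszPairing a a + rieszPairing b b := by
  rw [rieszPairing_eq_lintegral_rieszTransform ha hb,
    rieszPairing_eq_lintegral_rieszTransform ha ha, rieszPairing_eq_lintegral_rieszTransform hb hb,
    ← lintegral_const_mul _ (by fun_prop), ← lintegral_add_left (by fun_prop)]
  refine lintegral_mono fun s ↦ ?_
  rw [← lintegral_const_mul _ (by fun_prop), ← lintegral_add_left (by fun_prop)]
  exact lintegral_mono fun q ↦ two_mul_mul_le_add _ _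

/-- Replaces the triangle inequality; the factor `2` avoids square roots in `ℝ≥0∞`. -/
lemma rieszPairing_add_self_le {a b : (Fin n → ℝ × Space d) → ℝ≥0∞}
    (ha : Measurable a) (hb : Measurable b) :
    rieszPairing (fun p ↦ a p + b p) (fun p ↦ a p + b p) ≤
      2 * (rieszPairing a a + rieszPairing b b) := by
  have hab : Measurable fun p ↦ a p + b p := ha.add hb
  rw [rieszPairing_eq_lintegral_rieszTransform hab hab,
    rieszPairing_eq_lintegral_rieszTransform ha ha, rieszPairing_eq_lintegral_rieszTransform hb hb,
    ← lintegral_add_left (by fun_prop), ← lintegral_const_mul _ (by fun_prop)]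
  refine lintegral_mono fun s ↦ ?_
  rw [← lintegral_add_left (by fun_prop), ← lintegral_const_mul _ (by fun_prop)]
  refine lintegral_mono fun q ↦ ?_
  have h : rieszTransform (fun p ↦ a p + b p) s q =
      rieszTransform a s q + rieszTransform b s q := by
    unfold rieszTransform
    rw [← lintegral_add_left (by fun_prop)]
    simp_rw [add_mul]
  rw [h]
  calc
    _ = rieszTransform a s q * rieszTransform a s q + rieszTransform b s q * rieszTransform b s q +
      2 * (rieszTransform a s q * rieszTransform b s q) := by ring
    _ ≤ _ := by rw [two_mul (_ + _)]; gcongr; exact two_mul_mul_le_add _ _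

lemma rieszNormSq_add_le {g h : (Fin n → ℝ × Space d) → ℝ} (hg : Measurable g)
    (hh : Measurable h) :
    rieszNormSq (fun p ↦ g p + h p) ≤ 2 * (rieszNormSq g + rieszNormSq h) :=
  (rieszPairing_mono (fun _ ↦ enorm_add_le _ _) fun _ ↦ enorm_add_le _ _).trans
    (rieszPairing_add_self_le hg.enorm hh.enorm)

lemma rieszNormSq_neg (g : (Fin n → ℝ × Space d) → ℝ) :
    rieszNormSq (fun p ↦ -g p) = rieszNormSq g := by
  simp [rieszNormSq]

lemma rieszNormSq_sub_comm (g h : (Fin n → ℝ × Space d) → ℝ) :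
    rieszNormSq (fun p ↦ g p - h p) = rieszNormSq (fun p ↦ h p - g p) := by
  rw [← rieszNormSq_neg]
  simp

lemma rieszNormSq_sub_le {f g h : (Fin n → ℝ × Space d) → ℝ} (hf : Measurable f)
    (hg : Measurable g) (hh : Measurable h) :
    rieszNormSq (fun p ↦ f p - h p) ≤
      2 * (rieszNormSq (fun p ↦ f p - g p) + rieszNormSq (fun p ↦ g p - h p)) := by
  simpa using rieszNormSq_add_le (g := fun p ↦ f p - g p) (h := fun p ↦ g p - h p)
    (hf.sub hg) (hg.sub hh)

lemma rieszNormSq_const_mul (c : ℝ) {g : (Fin n → ℝ × Space d) → ℝ} (hg : Measurable g) :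
    rieszNormSq (fun p ↦ c * g p) = ‖c‖ₑ ^ 2 * rieszNormSq g := by
  unfold rieszNormSq
  rw [← lintegral_const_mul _ (by fun_prop)]
  refine lintegral_congr fun s ↦ ?_
  rw [← lintegral_const_mul _ (by fun_prop)]
  refine lintegral_congr fun y ↦ ?_
  rw [← lintegral_const_mul _ (by fun_prop)]
  refine lintegral_congr fun z ↦ ?_
  rw [enorm_mul, enorm_mul]
  ring

instance sigmaFinite_space_prod : SigmaFinite (volume : Measure (Space d × Space d)) :=
  inferInstance

/-- The pairing as a single integral over `n` triples `(sᵢ, yᵢ, zᵢ)`. -/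
lemma rieszPairing_eq_lintegral {a b : (Fin n → ℝ × Space d) → ℝ≥0∞}
    (ha : Measurable a) (hb : Measurable b) :
    rieszPairing a b = ∫⁻ q : Fin n → ℝ × Space d × Space d,
      a (fun i ↦ ((q i).1, (q i).2.1)) * b (fun i ↦ ((q i).1, (q i).2.2)) *
        ∏ i, (‖(q i).2.1 - (q i).2.2‖ₑ ^ 2)⁻¹ := by
  rw [← (volume_measurePreserving_arrowProdEquivProdArrow ℝ (Space d × Space d)
    (Fin n)).symm.lintegral_comp_emb (MeasurableEquiv.measurableEmbedding _),
    Measure.volume_eq_prod, lintegral_prod _ (by fun_prop)]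
  refine lintegral_congr fun s ↦ ?_
  rw [← (volume_measurePreserving_arrowProdEquivProdArrow (Space d) (Space d)
    (Fin n)).symm.lintegral_comp_emb (MeasurableEquiv.measurableEmbedding _),
    Measure.volume_eq_prod, lintegral_prod _ (by fun_prop)]
  rfl

lemma rieszPairing_comp_perm {a b : (Fin n → ℝ × Space d) → ℝ≥0∞}
    (ha : Measurable a) (hb : Measurable b) (σ : Equiv.Perm (Fin n)) :
    rieszPairing (fun p ↦ a fun i ↦ p (σ i)) (fun p ↦ b fun i ↦ p (σ i)) = rieszPairing a b := by
  rw [rieszPairing_eq_lintegral (by fun_prop) (by fun_prop), rieszPairing_eq_lintegral ha hb,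
    ← (volume_measurePreserving_piCongrLeft (fun _ : Fin n ↦ ℝ × Space d × Space d)
      σ).lintegral_comp_emb (MeasurableEquiv.measurableEmbedding _)]
  refine lintegral_congr fun q ↦ ?_
  rw [← Equiv.prod_comp σ]
  simp [MeasurableEquiv.coe_piCongrLeft, Equiv.piCongrLeft_apply_apply]

/-- Dominated convergence for the norm of the noise. -/
lemma tendsto_rieszNormSq_zero {f : ℕ → (Fin n → ℝ × Space d) → ℝ}
    {G : (Fin n → ℝ × Space d) → ℝ} (hf : ∀ m, Measurable (f m)) (hG : Measurable G)
    (hlim : ∀ p, Tendsto (fun m ↦ f m p) atTop (𝓝 0)) (hle : ∀ m p, ‖f m p‖ ≤ ‖G p‖)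
    (hfin : rieszNormSq G < ∞) :
    Tendsto (fun m ↦ rieszNormSq (f m)) atTop (𝓝 0) := by
  simp only [rieszNormSq_eq_rieszPairing] at hfin ⊢
  rw [rieszPairing_eq_lintegral (by fun_prop) (by fun_prop)] at hfin
  have he (m : ℕ) := rieszPairing_eq_lintegral (hf m).enorm (hf m).enorm
  simp_rw [he]
  rw [← lintegral_zero (μ := (volume : Measure (Fin n → ℝ × Space d × Space d)))]
  refine tendsto_lintegral_of_dominated_convergence _ (fun m ↦ ?_) (fun m ↦ ?_) hfin.ne ?_
  · have := hf m
    fun_prop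
  · refine ae_of_all _ fun q ↦ ?_
    exact mul_le_mul' (mul_le_mul' (enorm_le_iff_norm_le.mpr (hle _ _))
      (enorm_le_iff_norm_le.mpr (hle _ _))) le_rfl
  · filter_upwards [ae_lt_top (by fun_prop) hfin.ne] with q hq
    have hl (p : Fin n → ℝ × Space d) : Tendsto (fun m ↦ ‖f m p‖ₑ) atTop (𝓝 0) := by
      simpa using (hlim p).enorm
    -- Multiplication by `∞` is not continuous at `0`. Where the kernel is infinite, finiteness of
    -- the dominating integrand forces its other factor to vanish, and with it every term of the
    -- sequence.
    by_cases hk : ∏ i, (‖(q i).2.1 - (q i).2.2‖ₑ ^ 2)⁻¹ = ∞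
    · rw [hk] at hq ⊢
      have h0 : ‖G fun i ↦ ((q i).1, (q i).2.1)‖ₑ * ‖G fun i ↦ ((q i).1, (q i).2.2)‖ₑ = 0 := by
        by_contra hne
        rw [ENNReal.mul_top hne] at hq
        exact hq.ne rfl
      refine tendsto_const_nhds.congr fun m ↦ ?_
      have : ‖f m fun i ↦ ((q i).1, (q i).2.1)‖ₑ * ‖f m fun i ↦ ((q i).1, (q i).2.2)‖ₑ = 0 :=
        le_antisymm ((mul_le_mul' (enorm_le_iff_norm_le.mpr (hle _ _))
          (enorm_le_iff_norm_le.mpr (hle _ _))).trans h0.le) zero_le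
      rw [this, zero_mul]
    · have h1 := ENNReal.Tendsto.mul (hl fun i ↦ ((q i).1, (q i).2.1)) (Or.inr ENNReal.zero_ne_top)
        (hl fun i ↦ ((q i).1, (q i).2.2)) (Or.inr ENNReal.zero_ne_top)
      simpa using ENNReal.Tendsto.mul_const h1 (Or.inr hk)

end Pairing

/-! ### Moments of centered Gaussian families -/

section Wick

variable {Ω T : Type*} {mΩ : MeasurableSpace Ω} {P : Measure Ω} {X : T → Ω → ℝ}

/-- All moments of `Z` are finite. -/
def HasMoments (Z : Ω → ℝ) (P : Measure Ω) : Prop := ∀ p : ℝ≥0∞, p ≠ ∞ → MemLp Z p P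

lemma HasMoments.mul {Z W : Ω → ℝ} (hZ : HasMoments Z P) (hW : HasMoments W P) :
    HasMoments (fun ω ↦ Z ω * W ω) P := by
  intro p hp
  have h2 : 2 * p ≠ ∞ := ENNReal.mul_ne_top (by simp) hp
  have : ENNReal.HolderTriple (2 * p) (2 * p) p := ⟨by
    rw [← two_mul, ENNReal.mul_inv (by simp) (by simp), ← mul_assoc,
      ENNReal.mul_inv_cancel (by simp) (by simp), one_mul]⟩
  exact MemLp.mul (hW _ h2) (hZ _ h2)

lemma HasMoments.const_mul {Z : Ω → ℝ} (hZ : HasMoments Z P) (c : ℝ) :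
    HasMoments (fun ω ↦ c * Z ω) P := fun p hp ↦ (hZ p hp).const_mul c

lemma HasMoments.sum {ι : Type*} {Z : ι → Ω → ℝ} (s : Finset ι)
    (hZ : ∀ i ∈ s, HasMoments (Z i) P) : HasMoments (fun ω ↦ ∑ i ∈ s, Z i ω) P :=
  fun p hp ↦ memLp_finsetSum s fun i hi ↦ hZ i hi p hp

lemma HasMoments.prod [IsFiniteMeasure P] {ι : Type*} {Z : ι → Ω → ℝ} (s : Finset ι)
    (hZ : ∀ i ∈ s, HasMoments (Z i) P) : HasMoments (fun ω ↦ ∏ i ∈ s, Z i ω) P := by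
  classical
  induction s using Finset.induction_on with
  | empty => intro p hp; simpa using memLp_const 1
  | insert a s ha ih =>
    simp_rw [Finset.prod_insert ha]
    exact (hZ a (by simp)).mul (ih fun i hi ↦ hZ i (by simp [hi]))

lemma HasMoments.integrable {Z : Ω → ℝ} (hZ : HasMoments Z P) : Integrable Z P :=
  memLp_one_iff_integrable.mp (hZ 1 (by simp))

lemma hasMoments_of_isGaussianProcess (hX : IsGaussianProcess X P) (t : T) :
    HasMoments (X t) P := fun _ hp ↦ (hX.hasGaussianLaw_eval t).memLp hp

/-- A finite linear combination of the family `X`. -/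
def combination (X : T → Ω → ℝ) (c : T →₀ ℝ) (ω : Ω) : ℝ := c.sum fun t a ↦ a * X t ω

lemma combination_zero (ω : Ω) : combination X 0 ω = 0 := by simp [combination]

lemma combination_add_single (c : T →₀ ℝ) (t : T) (u : ℝ) (ω : Ω) :
    combination X (c + Finsupp.single t u) ω = combination X c ω + u * X t ω := by
  classical
  unfold combination
  rw [Finsupp.sum_add_index' (by simp) (by intros; ring), Finsupp.sum_single_index (by simp)]

lemma hasGaussianLaw_combination (hX : IsGaussianProcess X P) (c : T →₀ ℝ) :
    HasGaussianLaw (combination X c) P :=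
  (hX.smul c).hasGaussianLaw_fun_sum (I := c.support)

/-- The exponentially tilted expectation `E[Z exp (i Y)]`, where `Y = ∑ₜ c t • X t`. -/
def tilted (X : T → Ω → ℝ) (P : Measure Ω) (Z : Ω → ℝ) (c : T →₀ ℝ) : ℂ :=
  ∫ ω, (Z ω : ℂ) * Complex.exp (combination X c ω * Complex.I) ∂P

lemma tilted_zero (Z : Ω → ℝ) : tilted X P Z 0 = ((∫ ω, Z ω ∂P : ℝ) : ℂ) := by
  simp only [tilted, combination_zero, Complex.ofReal_zero, zero_mul, Complex.exp_zero, mul_one]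
  exact integral_ofReal

lemma tilted_one (hX : IsGaussianProcess X P) (h0 : ∀ t, ∫ ω, X t ω ∂P = 0) (c : T →₀ ℝ) :
    tilted X P (fun _ ↦ 1) c =
      Complex.exp (-((∫ ω, combination X c ω * combination X c ω ∂P : ℝ) : ℂ) / 2) := by
  have hg := hasGaussianLaw_combination hX c
  have hm : ∫ ω, combination X c ω ∂P = 0 := by
    simp only [combination, Finsupp.sum]
    rw [integral_finsetSum _ fun t _ ↦
      ((hasMoments_of_isGaussianProcess hX t).const_mul _).integrable]
    simp [integral_const_mul, h0]
  have hv : Var[combination X c; P] = ∫ ω, combination X c ω * combination X c ω ∂P := by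
    rw [variance_of_integral_eq_zero hg.aemeasurable hm]
    simp_rw [sq]
  have h := charFun_gaussianReal (μ := ∫ ω, combination X c ω ∂P)
    (v := Var[combination X c; P].toNNReal) 1
  rw [← hg.map_eq_gaussianReal, charFun_apply_real, integral_map hg.aemeasurable
    (by fun_prop), hm, Real.coe_toNNReal _ (variance_nonneg _ _), hv] at h
  simp only [tilted, Complex.ofReal_one, one_mul]
  simpa [neg_div] using h

/-- Differentiation under the integral brings down `i X t`. The imaginary exponential has modulus
one, so `|Z X t|` is a dominating function and finite moments are enough. -/
lemma hasDerivAt_tilted [IsProbabilityMeasure P] (hX : IsGaussianProcess X P) {Z : Ω → ℝ}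
    (hZ : HasMoments Z P) (c : T →₀ ℝ) (t : T) :
    HasDerivAt (fun u : ℝ ↦ tilted X P Z (c + Finsupp.single t u))
      (Complex.I * tilted X P (fun ω ↦ Z ω * X t ω) c) 0 := by
  have hXt := hasMoments_of_isGaussianProcess hX t
  have hZm : AEMeasurable Z P := hZ.integrable.aemeasurable
  have hXm : AEMeasurable (X t) P := hXt.integrable.aemeasurable
  have hYm : AEMeasurable (combination X c) P := (hasGaussianLaw_combination hX c).aemeasurable
  have h := hasDerivAt_integral_of_dominated_loc_of_deriv_le (μ := P) (𝕜 := ℝ) (x₀ := 0)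
    (s := Set.univ) (bound := fun ω ↦ ‖Z ω * X t ω‖)
    (F := fun u ω ↦ (Z ω : ℂ) * Complex.exp (((combination X c ω + u * X t ω : ℝ) : ℂ) * Complex.I))
    (F' := fun u ω ↦ Complex.I * (((Z ω * X t ω : ℝ) : ℂ) *
      Complex.exp (((combination X c ω + u * X t ω : ℝ) : ℂ) * Complex.I)))
    univ_mem ?_ ?_ ?_ ?_ ?_ ?_
  · have h2 := h.2
    simp only [zero_mul, add_zero, integral_const_mul] at h2
    simpa only [tilted, combination_add_single] using h2
  · exact Eventually.of_forall fun u ↦ by fun_prop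
  · refine hZ.integrable.mono (by fun_prop) (ae_of_all _ fun ω ↦ ?_)
    rw [norm_mul, Complex.norm_exp_ofReal_mul_I, mul_one, Complex.norm_real]
  · fun_prop
  · refine ae_of_all _ fun ω u _ ↦ ?_
    rw [norm_mul, norm_mul, Complex.norm_exp_ofReal_mul_I, mul_one, Complex.norm_real,
      Complex.norm_I, one_mul]
  · exact (hZ.mul hXt).integrable.norm
  · refine ae_of_all _ fun ω u _ ↦ ?_
    have h1 : HasDerivAt (fun u : ℝ ↦ combination X c ω + u * X t ω) (X t ω) u := by
      simpa using ((hasDerivAt_id u).mul_const (X t ω)).const_add (combination X c ω)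
    have h2 := ((h1.ofReal_comp.mul_const Complex.I).cexp).const_mul (Z ω : ℂ)
    refine h2.congr_deriv ?_
    push_cast
    ring

lemma hasMoments_combination (hX : IsGaussianProcess X P) (c : T →₀ ℝ) :
    HasMoments (combination X c) P := fun _ hp ↦ (hasGaussianLaw_combination hX c).memLp hp

lemma integral_mul_combination_add_single (hX : IsGaussianProcess X P) {Z : Ω → ℝ}
    (hZ : HasMoments Z P) (c : T →₀ ℝ) (t : T) (u : ℝ) :
    ∫ ω, Z ω * combination X (c + Finsupp.single t u) ω ∂P =
      ∫ ω, Z ω * combination X c ω ∂P + u * ∫ ω, Z ω * X t ω ∂P := by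
  simp_rw [combination_add_single, mul_add]
  rw [integral_add (hZ.mul (hasMoments_combination hX c)).integrable, ← integral_const_mul]
  · congr 2
    funext ω
    ring
  · exact (hZ.mul ((hasMoments_of_isGaussianProcess hX t).const_mul u)).integrable

/-- The Gaussian characteristic function `exp (-E[Y²] / 2)` is differentiated in the direction `X
t`, once under the integral and once in closed form. -/
lemma tilted_eval [IsProbabilityMeasure P] (hX : IsGaussianProcess X P)
    (h0 : ∀ t, ∫ ω, X t ω ∂P = 0) (c : T →₀ ℝ) (t : T) :
    tilted X P (X t) c = Complex.I * ((∫ ω, X t ω * combination X c ω ∂P : ℝ) : ℂ) *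
      tilted X P (fun _ ↦ 1) c := by
  have h1 := hasDerivAt_tilted hX (Z := fun _ ↦ 1) (fun p _ ↦ memLp_const 1) c t
  have hXt := hasMoments_of_isGaussianProcess hX t
  have hY := hasMoments_combination hX c
  have hsq (u : ℝ) : ∫ ω, combination X (c + Finsupp.single t u) ω *
      combination X (c + Finsupp.single t u) ω ∂P =
      ∫ ω, combination X c ω * combination X c ω ∂P + 2 * u * ∫ ω, X t ω * combination X c ω ∂P +
        u ^ 2 * ∫ ω, X t ω * X t ω ∂P := by
    rw [integral_mul_combination_add_single hX (hasMoments_combination hX _)]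
    simp_rw [mul_comm (combination X (c + Finsupp.single t u) _)]
    rw [integral_mul_combination_add_single hX hY, integral_mul_combination_add_single hX hXt]
    simp_rw [mul_comm (combination X c _) (X t _)]
    ring
  set a := ∫ ω, combination X c ω * combination X c ω ∂P
  set b := ∫ ω, X t ω * combination X c ω ∂P
  set e := ∫ ω, X t ω * X t ω ∂P
  have h2 : HasDerivAt (fun u : ℝ ↦ tilted X P (fun _ ↦ 1) (c + Finsupp.single t u))
      (Complex.exp (-(a : ℂ) / 2) * (-(b : ℂ))) 0 := by
    simp_rw [tilted_one hX h0, hsq]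
    have hq : HasDerivAt (fun u : ℝ ↦ -(a + 2 * u * b + u ^ 2 * e) / 2) (-b) 0 := by
      have := (((((hasDerivAt_id (0 : ℝ)).const_mul 2).mul_const b).const_add a).add
        (((hasDerivAt_id (0 : ℝ)).pow 2).mul_const e)).neg.div_const 2
      exact this.congr_deriv (by simp; ring)
    have := hq.ofReal_comp.cexp
    convert this using 1
    · funext u; push_cast; rfl
    · push_cast
      simp
  have h3 := h1.unique h2
  simp only [one_mul] at h3
  rw [tilted_one hX h0]
  have h4 : tilted X P (X t) c = -Complex.I * (Complex.I * tilted X P (X t) c) := by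
    rw [← mul_assoc]; simp
  rw [h4]
  change _ * (Complex.I * tilted X P (fun ω ↦ X t ω) c) = _
  rw [h3]
  ring

/-- Gaussian integration by parts for tilted moments. -/
lemma tilted_mul_prod [IsProbabilityMeasure P] (hX : IsGaussianProcess X P)
    (h0 : ∀ t, ∫ ω, X t ω ∂P = 0) {ι : Type*} [DecidableEq ι] (s : Finset ι) (f : ι → T) (t : T)
    (c : T →₀ ℝ) :
    tilted X P (fun ω ↦ X t ω * ∏ i ∈ s, X (f i) ω) c =
      ∑ k ∈ s, ((∫ ω, X t ω * X (f k) ω ∂P : ℝ) : ℂ) *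
        tilted X P (fun ω ↦ ∏ i ∈ s.erase k, X (f i) ω) c +
      Complex.I * ((∫ ω, X t ω * combination X c ω ∂P : ℝ) : ℂ) *
        tilted X P (fun ω ↦ ∏ i ∈ s, X (f i) ω) c := by
  induction s using Finset.induction_on generalizing c with
  | empty => simpa using tilted_eval hX h0 c t
  | insert l s hl ih =>
    have hm (t : T) := hasMoments_of_isGaussianProcess hX t
    have hp (s : Finset ι) : HasMoments (fun ω ↦ ∏ i ∈ s, X (f i) ω) P :=
      HasMoments.prod s fun i _ ↦ hm _
    -- The formula for `insert l s` is the derivative in direction `f l` of the formula for `s`.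
    -- Differentiating the covariance with the tilt (`hb`) creates the new summand `k = l`.
    have h1 := hasDerivAt_tilted hX ((hm t).mul (hp s)) c (f l)
    have hb : HasDerivAt (fun u : ℝ ↦ Complex.I *
        ((∫ ω, X t ω * combination X (c + Finsupp.single (f l) u) ω ∂P : ℝ) : ℂ))
        (Complex.I * ((∫ ω, X t ω * X (f l) ω ∂P : ℝ) : ℂ)) 0 := by
      simp_rw [integral_mul_combination_add_single hX (hm t)]
      have := (((hasDerivAt_id (0 : ℝ)).mul_const (∫ ω, X t ω * X (f l) ω ∂P)).const_add
        (∫ ω, X t ω * combination X c ω ∂P)).ofReal_comp.const_mul Complex.I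
      simpa using this
    have h2 := (HasDerivAt.fun_sum fun k (_ : k ∈ s) ↦ (hasDerivAt_tilted hX (hp (s.erase k)) c
      (f l)).const_mul ((∫ ω, X t ω * X (f k) ω ∂P : ℝ) : ℂ)).add
      (hb.mul (hasDerivAt_tilted hX (hp s) c (f l)))
    have h3 := h1.unique (h2.congr_of_eventuallyEq (Eventually.of_forall fun u ↦ ih _))
    simp only [Finsupp.single_zero, add_zero] at h3
    have h4 : ∀ k ∈ s, (insert l s).erase k = insert l (s.erase k) := fun k hk ↦
      Finset.erase_insert_of_ne (by rintro rfl; exact hl hk)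
    have h5 : ∀ k ∈ s, tilted X P (fun ω ↦ ∏ i ∈ (insert l s).erase k, X (f i) ω) c =
        tilted X P (fun ω ↦ (∏ i ∈ s.erase k, X (f i) ω) * X (f l) ω) c := by
      intro k hk
      rw [h4 k hk]
      simp_rw [Finset.prod_insert (fun h ↦ hl (Finset.mem_of_mem_erase h)), mul_comm (X (f l) _)]
    rw [Finset.sum_insert hl, Finset.erase_insert hl,
      Finset.sum_congr rfl fun k hk ↦ by rw [h5 k hk]]
    simp_rw [Finset.prod_insert hl, mul_comm (X (f l) _), ← mul_assoc]
    have h6 : Complex.I ≠ 0 := Complex.I_ne_zero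
    refine mul_left_cancel₀ h6 ?_
    rw [h3]
    simp_rw [mul_left_comm _ Complex.I, ← Finset.mul_sum]
    ring

/-- Wick's recursion for the moments of a centered Gaussian family. -/
lemma integral_mul_prod [IsProbabilityMeasure P] (hX : IsGaussianProcess X P)
    (h0 : ∀ t, ∫ ω, X t ω ∂P = 0) {ι : Type*} [DecidableEq ι] (s : Finset ι) (f : ι → T) (t : T) :
    ∫ ω, X t ω * ∏ i ∈ s, X (f i) ω ∂P =
      ∑ k ∈ s, (∫ ω, X t ω * X (f k) ω ∂P) * ∫ ω, ∏ i ∈ s.erase k, X (f i) ω ∂P := by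
  have h := tilted_mul_prod hX h0 s f t 0
  simp only [tilted_zero, combination_zero, mul_zero, integral_zero, Complex.ofReal_zero,
    zero_mul, add_zero] at h
  exact_mod_cast h

/-- The mixed moments of two families of pairwise uncorrelated Gaussian variables. -/
theorem integral_prod_mul_prod [IsProbabilityMeasure P] (hX : IsGaussianProcess X P)
    (h0 : ∀ t, ∫ ω, X t ω ∂P = 0) {n : ℕ} (A B : Fin n → T)
    (hA : Pairwise fun i j ↦ ∫ ω, X (A i) ω * X (A j) ω ∂P = 0) :
    ∫ ω, (∏ i, X (A i) ω) * ∏ i, X (B i) ω ∂P =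
      ∑ σ : Equiv.Perm (Fin n), ∏ i, ∫ ω, X (A i) ω * X (B (σ i)) ω ∂P := by
  induction n with
  | zero => simp
  | succ n ih =>
    have h := integral_mul_prod hX h0 (Finset.univ : Finset (Fin n ⊕ Fin (n + 1)))
      (Sum.elim (fun i ↦ A i.succ) B) (A 0)
    -- The first variable is uncorrelated with the other `A i`, so its Wick partner must be some `B
    -- k`.
    have hl (i : Fin n) : ∫ ω, X (A 0) ω * X (A i.succ) ω ∂P = 0 := hA (Fin.succ_ne_zero i).symm
    -- The indices other than `k` are enumerated by `Equiv.swap 0 k j.succ`, to match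
    -- `Equiv.Perm.decomposeFin` below.
    have hr (k : Fin (n + 1)) (ω : Ω) : ∏ i ∈ (Finset.univ : Finset (Fin n ⊕ Fin (n + 1))).erase
        (Sum.inr k), X (Sum.elim (fun i ↦ A i.succ) B i) ω =
        (∏ i : Fin n, X (A i.succ) ω) * ∏ j : Fin n, X (B (Equiv.swap 0 k j.succ)) ω := by
      have hs : (∏ i : Fin n, X (A i.succ) ω) * ∏ j : Fin n, X (B (Equiv.swap 0 k j.succ)) ω =
          ∏ i : Fin n ⊕ Fin n, Sum.elim (fun i : Fin n ↦ X (A i.succ) ω)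
            (fun j : Fin n ↦ X (B (Equiv.swap 0 k j.succ)) ω) i := by
        rw [Fintype.prod_sum_type]
        rfl
      rw [hs]
      symm
      refine Finset.prod_bij (fun i _ ↦ Sum.map id (fun j : Fin n ↦ Equiv.swap 0 k j.succ) i)
        ?_ ?_ ?_ ?_
      · rintro (i | j) _
        · simp
        · simp only [Sum.map_inr, Finset.mem_erase, ne_eq, Sum.inr.injEq, Finset.mem_univ, and_true]
          intro hj
          have := congrArg (Equiv.swap 0 k) hj
          simp at this
      · rintro (i | i) _ (j | j) _ hij
        · simpa using hij
        · simp at hij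
        · simp at hij
        · simpa using hij
      · rintro (i | j) hj
        · exact ⟨Sum.inl i, by simp, rfl⟩
        · have hjk : j ≠ k := by simpa using hj
          have hne : Equiv.swap 0 k j ≠ 0 := by
            intro hc
            apply hjk
            have := congrArg (Equiv.swap 0 k) hc
            simpa using this
          obtain ⟨m, hm⟩ := Fin.exists_succ_eq.mpr hne
          exact ⟨Sum.inr m, by simp, by simp [hm]⟩
      · rintro (i | j) _ <;> simp
    simp only [Fintype.sum_sum_type, Fintype.prod_sum_type, Sum.elim_inl, Sum.elim_inr, hl,
      zero_mul, Finset.sum_const_zero, zero_add, hr] at h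
    have hlhs (ω : Ω) : (∏ i, X (A i) ω) * ∏ i, X (B i) ω =
        X (A 0) ω * ((∏ i : Fin n, X (A i.succ) ω) * ∏ i, X (B i) ω) := by
      rw [Fin.prod_univ_succ, mul_assoc]
    simp_rw [hlhs]
    rw [h, ← Equiv.sum_comp Equiv.Perm.decomposeFin.symm, Fintype.sum_prod_type]
    refine Finset.sum_congr rfl fun k _ ↦ ?_
    rw [ih (fun i ↦ A i.succ) (fun j ↦ B (Equiv.swap 0 k j.succ))
      (fun i j hij ↦ hA (fun hc ↦ hij (Fin.succ_injective _ hc))), Finset.mul_sum]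
    refine Finset.sum_congr rfl fun σ _ ↦ ?_
    rw [Fin.prod_univ_succ]
    simp only [Equiv.Perm.decomposeFin_symm_apply_zero, Equiv.Perm.decomposeFin_symm_apply_succ]

end Wick

/-! ### Integrability of the Riesz kernel -/

section Riesz

variable {d : ℕ}

/-- The constant in the integral of `‖x‖ ^ (-γ)` over a ball. -/
def ballConst (d : ℕ) (γ : ℝ) : ℝ :=
  d * (volume : Measure (Space d)).real (Metric.ball 0 1) / (d - γ)

lemma lintegral_ball_enorm_rpow_le {γ R : ℝ} (hγd : γ < d) (hd : 0 < d)
    (hR : 0 < R) :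
    ∫⁻ x in Metric.ball (0 : Space d) R, ‖x‖ₑ ^ (-γ) ≤
      ENNReal.ofReal (ballConst d γ * R ^ (d - γ)) := by
  have : Nontrivial (Space d) := by
    have : Nonempty (Fin d) := ⟨⟨0, hd⟩⟩
    infer_instance
  have hpow : ∀ y ∈ Set.Ioo (0 : ℝ) R, y ^ (Module.finrank ℝ (Space d) - 1) • y ^ (-γ) =
      y ^ ((d : ℝ) - 1 - γ) := by
    intro y hy
    rw [finrank_euclideanSpace, Fintype.card_fin, smul_eq_mul, ← Real.rpow_natCast,
      ← Real.rpow_add hy.1, Nat.cast_sub hd]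
    congr 1
    push_cast
    ring
  have h_int : IntegrableOn (fun x : Space d ↦ ‖x‖ ^ (-γ)) (Metric.ball 0 R) := by
    rw [integrableOn_fun_norm_addHaar volume (f := fun y ↦ y ^ (-γ)),
      integrableOn_congr_fun hpow measurableSet_Ioo]
    refine IntegrableOn.mono_set ?_ Set.Ioo_subset_Ioc_self
    rw [← intervalIntegrable_iff_integrableOn_Ioc_of_le hR.le]
    exact intervalIntegral.intervalIntegrable_rpow' (by linarith)
  have hval : ∫ x in Metric.ball (0 : Space d) R, ‖x‖ ^ (-γ) = ballConst d γ * R ^ (d - γ) := by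
    have h1 : ∫ x in Metric.ball (0 : Space d) R, ‖x‖ ^ (-γ) =
        ∫ x : Space d, (Set.Iio R).indicator (fun y : ℝ ↦ y ^ (-γ)) ‖x‖ := by
      rw [← integral_indicator measurableSet_ball]
      congr 1 with x
      simp [Set.indicator]
    have h2 : ∫ y in Set.Ioi (0 : ℝ), y ^ (Module.finrank ℝ (Space d) - 1) •
        (Set.Iio R).indicator (fun y : ℝ ↦ y ^ (-γ)) y =
          ∫ y in (0 : ℝ)..R, y ^ ((d : ℝ) - 1 - γ) := by
      rw [intervalIntegral.integral_of_le hR.le, integral_Ioc_eq_integral_Ioo,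
        ← setIntegral_congr_fun measurableSet_Ioo hpow, ← Set.Ioi_inter_Iio,
        ← setIntegral_indicator measurableSet_Iio]
      congr 1 with y
      simp [Set.indicator]
    rw [h1, integral_fun_norm_addHaar, h2, integral_rpow (Or.inl (by linarith)),
      Real.zero_rpow (by linarith), finrank_euclideanSpace, Fintype.card_fin]
    unfold ballConst
    rw [show (d : ℝ) - 1 - γ + 1 = d - γ by ring]
    simp only [nsmul_eq_mul, smul_eq_mul]
    ring
  rw [← hval, ofReal_integral_eq_lintegral_ofReal h_int
    (ae_of_all _ fun x ↦ Real.rpow_nonneg (norm_nonneg _) _)]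
  refine le_of_eq (lintegral_congr_ae (ae_restrict_of_ae ?_))
  -- The real and the extended power may disagree at the origin, which is a null set.
  filter_upwards [Measure.ae_ne volume (0 : Space d)] with x hx
  rw [← ofReal_norm, ENNReal.ofReal_rpow_of_pos (norm_pos_iff.mpr hx)]

/-- The double integral of a Riesz kernel over a ball. -/
lemma lintegral_ball_ball_enorm_rpow_le {γ R : ℝ} (hγd : γ < d) (hd : 0 < d) (hR : 0 < R) :
    ∫⁻ x in Metric.ball (0 : Space d) R, ∫⁻ y in Metric.ball (0 : Space d) R, ‖x - y‖ₑ ^ (-γ) ≤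
      ENNReal.ofReal (ballConst d γ * (2 * R) ^ (d - γ)) *
        volume (Metric.ball (0 : Space d) R) := by
  rw [← setLIntegral_const]
  refine setLIntegral_mono' measurableSet_ball fun x hx ↦ ?_
  -- Differences of two points of the ball lie in the ball of twice the radius.
  refine le_trans ?_ (lintegral_ball_enorm_rpow_le hγd hd (show 0 < 2 * R by positivity))
  rw [← lintegral_indicator measurableSet_ball, ← lintegral_indicator measurableSet_ball,
    ← lintegral_sub_left_eq_self _ x]
  refine lintegral_mono fun y ↦ ?_
  by_cases hy : x - y ∈ Metric.ball (0 : Space d) R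
  · have hy' : y ∈ Metric.ball (0 : Space d) (2 * R) := by
      rw [mem_ball_zero_iff] at *
      calc ‖y‖ = ‖x - (x - y)‖ := by rw [sub_sub_cancel]
        _ ≤ ‖x‖ + ‖x - y‖ := norm_sub_le _ _
        _ < 2 * R := by linarith
    rw [Set.indicator_of_mem hy, Set.indicator_of_mem hy', sub_sub_cancel]
  · rw [Set.indicator_of_notMem hy]
    exact zero_le

end Riesz

/-! ### Second moments of the integrals of elementary kernels -/

section Covariance

variable {d : ℕ}

/-- The density of the covariance of `F(A)` and `F(B)`. -/
def covDensity (A B : NoiseSet d) (q : ℝ × Space d × Space d) : ℝ :=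
  A.carrier.indicator (fun _ ↦ (1 : ℝ)) (q.1, q.2.1) *
    B.carrier.indicator (fun _ ↦ (1 : ℝ)) (q.1, q.2.2) * (‖q.2.1 - q.2.2‖ ^ 2)⁻¹

@[fun_prop]
lemma measurable_indicator_noiseSet (A : NoiseSet d) :
    Measurable (A.carrier.indicator fun _ ↦ (1 : ℝ)) :=
  measurable_const.indicator A.measurableSet

lemma NoiseSet.exists_bound (A : NoiseSet d) :
    ∃ M : ℝ, 0 < M ∧ ∀ p ∈ A.carrier, |p.1| < M ∧ ‖p.2‖ < M := by
  obtain ⟨M, hM⟩ := A.isBounded.exists_norm_le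
  refine ⟨max M 0 + 1, by positivity, fun p hp ↦ ?_⟩
  have h := hM p hp
  have h1 := norm_fst_le p
  have h2 := norm_snd_le p
  rw [Real.norm_eq_abs] at h1
  have h3 := le_max_left M 0
  constructor <;> linarith

/-- Only an inequality: at the origin the real inverse is `0` and the extended one is `∞`. -/
lemma enorm_inv_norm_sq_le (x : Space d) : ‖(‖x‖ ^ 2)⁻¹‖ₑ ≤ (‖x‖ₑ ^ 2)⁻¹ := by
  rcases eq_or_ne x 0 with rfl | hx
  · simp
  · have : 0 < ‖x‖ := norm_pos_iff.mpr hx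
    rw [enorm_inv (by positivity), enorm_pow, enorm_norm]

lemma enorm_prod_real {ι : Type*} (s : Finset ι) (f : ι → ℝ) :
    ‖∏ i ∈ s, f i‖ₑ = ∏ i ∈ s, ‖f i‖ₑ := by
  simp only [enorm_eq_nnnorm, nnnorm_prod, ENNReal.ofNNReal_finsetProd]

/-- Bounded sets fit into a time interval times a ball, on which index `2 < d` is integrable. -/
lemma lintegral_indicator_mul_indicator_lt_top (hd : 3 ≤ d) (A B : NoiseSet d) :
    ∫⁻ q : ℝ × Space d × Space d, ‖A.carrier.indicator (fun _ ↦ (1 : ℝ)) (q.1, q.2.1)‖ₑ *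
      ‖B.carrier.indicator (fun _ ↦ (1 : ℝ)) (q.1, q.2.2)‖ₑ * (‖q.2.1 - q.2.2‖ₑ ^ 2)⁻¹ < ∞ := by
  obtain ⟨M, hM, hA⟩ := A.exists_bound
  obtain ⟨M', hM', hB⟩ := B.exists_bound
  have hd' : (3 : ℝ) ≤ d := by exact_mod_cast hd
  set K := max M M' with hK
  have hK0 : 0 < K := lt_max_of_lt_left hM
  have hle (q : ℝ × Space d × Space d) : ‖A.carrier.indicator (fun _ ↦ (1 : ℝ)) (q.1, q.2.1)‖ₑ *
      ‖B.carrier.indicator (fun _ ↦ (1 : ℝ)) (q.1, q.2.2)‖ₑ * (‖q.2.1 - q.2.2‖ₑ ^ 2)⁻¹ ≤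
      (Set.Ioo (-K) K).indicator (fun _ ↦ 1) q.1 *
      ((Metric.ball (0 : Space d) K).indicator (fun _ ↦ 1) q.2.1 *
      ((Metric.ball (0 : Space d) K).indicator (fun _ ↦ 1) q.2.2 *
        ‖q.2.1 - q.2.2‖ₑ ^ (-2 : ℝ))) := by
    by_cases h1 : (q.1, q.2.1) ∈ A.carrier
    · by_cases h2 : (q.1, q.2.2) ∈ B.carrier
      · have h3 := hA _ h1
        have h4 := hB _ h2
        have h5 : q.1 ∈ Set.Ioo (-K) K := abs_lt.mp (h3.1.trans_le (le_max_left _ _))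
        have h6 : q.2.1 ∈ Metric.ball (0 : Space d) K := by
          rw [mem_ball_zero_iff]; exact h3.2.trans_le (le_max_left M M')
        have h7 : q.2.2 ∈ Metric.ball (0 : Space d) K := by
          rw [mem_ball_zero_iff]; exact h4.2.trans_le (le_max_right M M')
        rw [Set.indicator_of_mem h5, Set.indicator_of_mem h6, Set.indicator_of_mem h7, one_mul,
          one_mul, one_mul, enorm_rpow_neg_two, Set.indicator_of_mem h1,
          Set.indicator_of_mem h2, enorm_one, one_mul, one_mul]
      · simp [Set.indicator_of_notMem h2]
    · simp [Set.indicator_of_notMem h1]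
  have hm1 : Measurable ((Set.Ioo (-K) K).indicator fun _ ↦ (1 : ℝ≥0∞)) :=
    measurable_const.indicator measurableSet_Ioo
  have hm2 : Measurable ((Metric.ball (0 : Space d) K).indicator fun _ ↦ (1 : ℝ≥0∞)) :=
    measurable_const.indicator measurableSet_ball
  refine (lintegral_mono hle).trans_lt ?_
  rw [Measure.volume_eq_prod, lintegral_prod_mul (f := (Set.Ioo (-K) K).indicator fun _ ↦ 1)
    (g := fun q : Space d × Space d ↦ (Metric.ball (0 : Space d) K).indicator (fun _ ↦ 1) q.1 *
      ((Metric.ball (0 : Space d) K).indicator (fun _ ↦ 1) q.2 * ‖q.1 - q.2‖ₑ ^ (-2 : ℝ)))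
    (by fun_prop) (by fun_prop)]
  refine ENNReal.mul_lt_top ?_ ?_
  · simp [lintegral_indicator measurableSet_Ioo]
  · rw [Measure.volume_eq_prod, lintegral_prod _ (by fun_prop)]
    have h8 := lintegral_ball_ball_enorm_rpow_le (d := d) (γ := 2) (by linarith) (by lia) hK0
    refine lt_of_le_of_lt (le_trans (le_of_eq ?_) h8)
      (ENNReal.mul_lt_top ENNReal.ofReal_lt_top measure_ball_lt_top)
    rw [← lintegral_indicator measurableSet_ball]
    refine lintegral_congr fun x ↦ ?_
    dsimp only
    rw [lintegral_const_mul _ (by fun_prop)]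
    by_cases hx : x ∈ Metric.ball (0 : Space d) K
    · rw [Set.indicator_of_mem hx, Set.indicator_of_mem hx, one_mul,
        ← lintegral_indicator measurableSet_ball]
      refine lintegral_congr fun y ↦ ?_
      by_cases hy : y ∈ Metric.ball (0 : Space d) K
      · simp [Set.indicator_of_mem hy]
      · simp [Set.indicator_of_notMem hy]
    · simp [Set.indicator_of_notMem hx]

lemma integrable_covDensity (hd : 3 ≤ d) (A B : NoiseSet d) : Integrable (covDensity A B) := by
  refine ⟨(by unfold covDensity; fun_prop : Measurable (covDensity A B)).aestronglyMeasurable, ?_⟩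
  refine (lintegral_mono fun q ↦ ?_).trans_lt (lintegral_indicator_mul_indicator_lt_top hd A B)
  unfold covDensity
  rw [enorm_mul, enorm_mul]
  exact mul_le_mul' le_rfl (enorm_inv_norm_sq_le _)

variable {Ω : Type*} [MeasurableSpace Ω] {P : Measure Ω} {F : NoiseSet d → Ω → ℝ}

lemma IsRieszNoise.integral_mul_eq (hF : IsRieszNoise F P) (hd : 3 ≤ d) (A B : NoiseSet d) :
    ∫ ω, F A ω * F B ω ∂P = ∫ q, covDensity A B q := by
  have hi := integrable_covDensity hd A B
  rw [hF.covariance_eq, Measure.volume_eq_prod, integral_prod _ hi]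
  refine integral_congr_ae ?_
  filter_upwards [hi.prod_right_ae] with s hs
  have hA : MeasurableSet {x | (s, x) ∈ A.carrier} :=
    A.measurableSet.preimage measurable_prodMk_left
  have hB : MeasurableSet {y | (s, y) ∈ B.carrier} :=
    B.measurableSet.preimage measurable_prodMk_left
  rw [Measure.volume_eq_prod, integral_prod _ hs, ← integral_indicator hA]
  congr 1 with x
  by_cases hx : (s, x) ∈ A.carrier
  · rw [Set.indicator_of_mem (by exact hx), ← integral_indicator hB]
    congr 1 with y
    by_cases hy : (s, y) ∈ B.carrier
    · simp [covDensity, hx, hy]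
    · simp [covDensity, hy]
  · simp [covDensity, hx]

lemma covDensity_eq_zero {A B : NoiseSet d}
    (h : Disjoint (Prod.fst '' A.carrier) (Prod.fst '' B.carrier)) (q : ℝ × Space d × Space d) :
    covDensity A B q = 0 := by
  unfold covDensity
  by_cases h1 : (q.1, q.2.1) ∈ A.carrier
  · by_cases h2 : (q.1, q.2.2) ∈ B.carrier
    · exact absurd ⟨_, h2, rfl⟩ (Set.disjoint_left.mp h ⟨_, h1, rfl⟩)
    · simp [h2]
  · simp [h1]

variable {n : ℕ}

@[fun_prop]
lemma ElementaryKernel.measurable_toFun (e : ElementaryKernel d n) : Measurable e.toFun := by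
  unfold ElementaryKernel.toFun
  fun_prop

lemma hasMoments_integral [IsProbabilityMeasure P] (hF : IsRieszNoise F P)
    (e : ElementaryKernel d n) : HasMoments (e.integral F) P := by
  unfold ElementaryKernel.integral
  exact HasMoments.sum _ fun j _ ↦ (HasMoments.prod _ fun i _ ↦
    hasMoments_of_isGaussianProcess hF.isGaussianProcess _).const_mul _

lemma integral_prod_mul_prod_noise [IsProbabilityMeasure P] (hF : IsRieszNoise F P) (hd : 3 ≤ d)
    (A B : Fin n → NoiseSet d) (hA : Pairwise fun i j ↦
      Disjoint (Prod.fst '' (A i).carrier) (Prod.fst '' (A j).carrier)) :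
    ∫ ω, (∏ i, F (A i) ω) * ∏ i, F (B i) ω ∂P =
      ∑ σ : Equiv.Perm (Fin n), ∫ q : Fin n → ℝ × Space d × Space d,
        ∏ i, covDensity (A i) (B (σ i)) (q i) := by
  rw [integral_prod_mul_prod hF.isGaussianProcess hF.integral_eq_zero]
  · refine Finset.sum_congr rfl fun σ _ ↦ ?_
    rw [integral_fintype_prod_volume_eq_prod (fun i ↦ covDensity (A i) (B (σ i)))]
    exact Finset.prod_congr rfl fun i _ ↦ hF.integral_mul_eq hd _ _
  · intro i j hij
    simp [hF.integral_mul_eq hd, covDensity_eq_zero (hA hij)]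

/-- Reindexing the second product by `σ` moves the permutation from the sets to the points, so that
the double sum refactors into two values of the kernel. -/
lemma sum_sum_prod_covDensity (e : ElementaryKernel d n) (σ : Equiv.Perm (Fin n))
    (q : Fin n → ℝ × Space d × Space d) :
    ∑ j, ∑ k, e.coeff j * e.coeff k * ∏ i, covDensity (e.box j i) (e.box k (σ i)) (q i) =
      e.toFun (fun i ↦ ((q i).1, (q i).2.1)) *
        e.toFun (fun i ↦ ((q (σ.symm i)).1, (q (σ.symm i)).2.2)) *
        ∏ i, (‖(q i).2.1 - (q i).2.2‖ ^ 2)⁻¹ := by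
  unfold ElementaryKernel.toFun covDensity
  rw [Finset.sum_mul_sum, Finset.sum_mul]
  refine Finset.sum_congr rfl fun j _ ↦ ?_
  rw [Finset.sum_mul]
  refine Finset.sum_congr rfl fun k _ ↦ ?_
  rw [Finset.prod_mul_distrib, Finset.prod_mul_distrib, ← Equiv.prod_comp σ fun i ↦
    (e.box k i).carrier.indicator (fun _ ↦ (1 : ℝ)) ((q (σ.symm i)).1, (q (σ.symm i)).2.2)]
  simp only [Equiv.symm_apply_apply]
  ring

/-- The second moment of the integral of an elementary kernel is controlled by the pairings of the
kernel with its permutations. -/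
lemma lintegral_enorm_integral_sq_le [IsProbabilityMeasure P] (hF : IsRieszNoise F P) (hd : 3 ≤ d)
    (e : ElementaryKernel d n) :
    ∫⁻ ω, ‖e.integral F ω‖ₑ ^ 2 ∂P ≤ ∑ σ : Equiv.Perm (Fin n),
      rieszPairing (fun p ↦ ‖e.toFun p‖ₑ) (fun p ↦ ‖e.toFun fun i ↦ p (σ.symm i)‖ₑ) := by
  have hI := hasMoments_integral hF e
  have hm (A : NoiseSet d) := hasMoments_of_isGaussianProcess hF.isGaussianProcess A
  have h_int (j k : Fin e.size) (σ : Equiv.Perm (Fin n)) : Integrable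
      fun q : Fin n → ℝ × Space d × Space d ↦
        ∏ i, covDensity (e.box j i) (e.box k (σ i)) (q i) :=
    Integrable.fintype_prod fun i ↦ integrable_covDensity hd _ _
  have h1 : ∫ ω, e.integral F ω * e.integral F ω ∂P = ∑ σ : Equiv.Perm (Fin n),
      ∫ q : Fin n → ℝ × Space d × Space d, e.toFun (fun i ↦ ((q i).1, (q i).2.1)) *
        e.toFun (fun i ↦ ((q (σ.symm i)).1, (q (σ.symm i)).2.2)) *
        ∏ i, (‖(q i).2.1 - (q i).2.2‖ ^ 2)⁻¹ := by
    have h2 (ω : Ω) : e.integral F ω * e.integral F ω = ∑ j, ∑ k, e.coeff j * e.coeff k *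
        ((∏ i, F (e.box j i) ω) * ∏ i, F (e.box k i) ω) := by
      unfold ElementaryKernel.integral
      rw [Finset.sum_mul_sum]
      exact Finset.sum_congr rfl fun j _ ↦ Finset.sum_congr rfl fun k _ ↦ by ring
    have h3 (j k : Fin e.size) : Integrable (fun ω ↦ e.coeff j * e.coeff k *
        ((∏ i, F (e.box j i) ω) * ∏ i, F (e.box k i) ω)) P :=
      (((HasMoments.prod _ fun i _ ↦ hm _).mul (HasMoments.prod _ fun i _ ↦ hm _)).const_mul
        _).integrable
    simp_rw [h2, ← sum_sum_prod_covDensity]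
    rw [integral_finsetSum _ fun j _ ↦ integrable_finsetSum _ fun k _ ↦ h3 j k]
    have h4 (σ : Equiv.Perm (Fin n)) : ∫ q : Fin n → ℝ × Space d × Space d,
        ∑ j, ∑ k, e.coeff j * e.coeff k * ∏ i, covDensity (e.box j i) (e.box k (σ i)) (q i) =
        ∑ j, ∑ k, e.coeff j * e.coeff k * ∫ q : Fin n → ℝ × Space d × Space d,
          ∏ i, covDensity (e.box j i) (e.box k (σ i)) (q i) := by
      rw [integral_finsetSum _ fun j _ ↦ integrable_finsetSum _ fun k _ ↦ (h_int j k σ).const_mul _]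
      refine Finset.sum_congr rfl fun j _ ↦ ?_
      rw [integral_finsetSum _ fun k _ ↦ (h_int j k σ).const_mul _]
      exact Finset.sum_congr rfl fun k _ ↦ integral_const_mul _ _
    simp_rw [h4]
    rw [Finset.sum_comm]
    refine Finset.sum_congr rfl fun j _ ↦ ?_
    rw [Finset.sum_comm, integral_finsetSum _ fun k _ ↦ h3 j k]
    refine Finset.sum_congr rfl fun k _ ↦ ?_
    rw [integral_const_mul, integral_prod_mul_prod_noise hF hd _ _ (e.disjoint_time j),
      Finset.mul_sum]
  have h5 : ∫⁻ ω, ‖e.integral F ω‖ₑ ^ 2 ∂P =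
      ENNReal.ofReal (∫ ω, e.integral F ω * e.integral F ω ∂P) := by
    rw [ofReal_integral_eq_lintegral_ofReal (hI.mul hI).integrable
      (ae_of_all _ fun ω ↦ mul_self_nonneg _)]
    refine lintegral_congr fun ω ↦ ?_
    rw [← sq, ← Real.enorm_of_nonneg (sq_nonneg _), enorm_pow]
  rw [h5, h1]
  -- Signs are discarded from here on; only an upper bound in terms of the absolute kernel is
  -- needed.
  refine (ENNReal.ofReal_le_ofReal (le_abs_self _)).trans ?_
  rw [← Real.norm_eq_abs, ofReal_norm]
  refine (enorm_sum_le _ _).trans (Finset.sum_le_sum fun σ _ ↦ ?_)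
  rw [rieszPairing_eq_lintegral (by fun_prop) (by fun_prop)]
  refine (enorm_integral_le_lintegral_enorm _).trans (lintegral_mono fun q ↦ ?_)
  rw [enorm_mul, enorm_mul]
  refine mul_le_mul' le_rfl ?_
  rw [enorm_prod_real]
  exact Finset.prod_le_prod' fun i _ ↦ enorm_inv_norm_sq_le _

/-- By positive definiteness and invariance of the pairing under simultaneous permutations, each of
the `n!` terms is at most the one of the identity. -/
lemma lintegral_enorm_integral_sq_le_factorial [IsProbabilityMeasure P] (hF : IsRieszNoise F P)
    (hd : 3 ≤ d) (e : ElementaryKernel d n) :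
    ∫⁻ ω, ‖e.integral F ω‖ₑ ^ 2 ∂P ≤ n.factorial * rieszNormSq e.toFun := by
  refine (lintegral_enorm_integral_sq_le hF hd e).trans ?_
  have h (σ : Equiv.Perm (Fin n)) : rieszPairing (fun p ↦ ‖e.toFun p‖ₑ)
      (fun p ↦ ‖e.toFun fun i ↦ p (σ.symm i)‖ₑ) ≤ rieszNormSq e.toFun := by
    have h1 := two_mul_rieszPairing_le (a := fun p ↦ ‖e.toFun p‖ₑ)
      (b := fun p ↦ ‖e.toFun fun i ↦ p (σ.symm i)‖ₑ) (by fun_prop) (by fun_prop)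
    rw [rieszPairing_comp_perm (a := fun p ↦ ‖e.toFun p‖ₑ) (b := fun p ↦ ‖e.toFun p‖ₑ)
      (by fun_prop) (by fun_prop) σ.symm, ← rieszNormSq_eq_rieszPairing, ← two_mul] at h1
    exact (ENNReal.mul_le_mul_iff_right (by simp) (by simp)).mp h1
  refine (Finset.sum_le_sum fun σ _ ↦ h σ).trans (le_of_eq ?_)
  simp [Finset.card_univ, Fintype.card_perm]

/-- Kernels that vanish outside the set of strictly increasing times. -/
def IsOrdered (g : (Fin n → ℝ × Space d) → ℝ) : Prop :=
  ∀ p, g p ≠ 0 → StrictMono fun i ↦ (p i).1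

/-- Only the identity contributes, because times can be increasing in just one order. The absence of
`n!` is what makes the sum over the chaoses converge. -/
lemma lintegral_enorm_integral_sq_le_of_isOrdered [IsProbabilityMeasure P] (hF : IsRieszNoise F P)
    (hd : 3 ≤ d) (e : ElementaryKernel d n) (he : IsOrdered e.toFun) :
    ∫⁻ ω, ‖e.integral F ω‖ₑ ^ 2 ∂P ≤ rieszNormSq e.toFun := by
  refine (lintegral_enorm_integral_sq_le hF hd e).trans (le_of_eq ?_)
  rw [Finset.sum_eq_single 1]
  · rfl
  · intro σ _ hσ
    unfold rieszPairing
    have h (s : Fin n → ℝ) (y z : Fin n → Space d) : ‖e.toFun fun i ↦ (s i, y i)‖ₑ *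
        ‖e.toFun fun i ↦ (s (σ.symm i), z (σ.symm i))‖ₑ = 0 := by
      by_contra hc
      rw [mul_eq_zero, not_or, enorm_eq_zero, enorm_eq_zero] at hc
      have h1 := he _ hc.1
      have h2 := he _ hc.2
      have h3 : StrictMono σ.symm := fun i j hij ↦ h1.lt_iff_lt.mp (h2 hij)
      have h4 : σ.symm = 1 := by
        refine Equiv.ext fun i ↦ ?_
        exact congrFun ((h3.range_inj strictMono_id).mp (by
          rw [σ.symm.surjective.range_eq, Set.range_id])) i
      exact hσ (by rw [← Equiv.symm_symm σ, h4]; rfl)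
    simp [h]
  · simp

end Covariance

/-! ### Approximation by elementary kernels -/

section Approximation

variable {d n : ℕ}

/-- The sum of two elementary kernels. -/
def ElementaryKernel.add (e e' : ElementaryKernel d n) : ElementaryKernel d n where
  size := e.size + e'.size
  coeff := Fin.append e.coeff e'.coeff
  box := Fin.append e.box e'.box
  disjoint_time j := by
    refine Fin.addCases (fun i ↦ ?_) (fun i ↦ ?_) j
    · simpa using e.disjoint_time i
    · simpa using e'.disjoint_time i

lemma ElementaryKernel.toFun_add (e e' : ElementaryKernel d n) (p : Fin n → ℝ × Space d) :
    (e.add e').toFun p = e.toFun p + e'.toFun p := by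
  unfold ElementaryKernel.toFun ElementaryKernel.add
  rw [Fin.sum_univ_add]
  simp

lemma ElementaryKernel.integral_add {Ω : Type*} (e e' : ElementaryKernel d n)
    (F : NoiseSet d → Ω → ℝ) (ω : Ω) :
    (e.add e').integral F ω = e.integral F ω + e'.integral F ω := by
  unfold ElementaryKernel.integral ElementaryKernel.add
  rw [Fin.sum_univ_add]
  simp

/-- A multiple of an elementary kernel. -/
def ElementaryKernel.smul (c : ℝ) (e : ElementaryKernel d n) : ElementaryKernel d n where
  size := e.size
  coeff j := c * e.coeff j
  box := e.box
  disjoint_time := e.disjoint_time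

lemma ElementaryKernel.toFun_smul (c : ℝ) (e : ElementaryKernel d n)
    (p : Fin n → ℝ × Space d) : (e.smul c).toFun p = c * e.toFun p := by
  simp only [ElementaryKernel.toFun, ElementaryKernel.smul, Finset.mul_sum, mul_assoc]
  rfl

lemma ElementaryKernel.integral_smul {Ω : Type*} (c : ℝ) (e : ElementaryKernel d n)
    (F : NoiseSet d → Ω → ℝ) (ω : Ω) : (e.smul c).integral F ω = c * e.integral F ω := by
  simp only [ElementaryKernel.integral, ElementaryKernel.smul, Finset.mul_sum, mul_assoc]
  rfl

/-- The difference of two elementary kernels. -/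
def ElementaryKernel.sub (e e' : ElementaryKernel d n) : ElementaryKernel d n :=
  e.add (e'.smul (-1))

lemma ElementaryKernel.toFun_sub (e e' : ElementaryKernel d n) (p : Fin n → ℝ × Space d) :
    (e.sub e').toFun p = e.toFun p - e'.toFun p := by
  simp [ElementaryKernel.sub, toFun_add, toFun_smul, sub_eq_add_neg]

lemma ElementaryKernel.integral_sub {Ω : Type*} (e e' : ElementaryKernel d n)
    (F : NoiseSet d → Ω → ℝ) (ω : Ω) :
    (e.sub e').integral F ω = e.integral F ω - e'.integral F ω := by
  simp [ElementaryKernel.sub, integral_add, integral_smul, sub_eq_add_neg]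

/-- The factors of a box follow one another in time. -/
def IsOrderedBox (A : Fin n → NoiseSet d) : Prop :=
  ∀ i j, i < j → ∀ p ∈ (A i).carrier, ∀ q ∈ (A j).carrier, p.1 < q.1

/-- The subset of `(ℝ × ℝ^d)^n` described by a box. -/
def boxSet (A : Fin n → NoiseSet d) : Set (Fin n → ℝ × Space d) :=
  Set.univ.pi fun i ↦ (A i).carrier

lemma measurableSet_boxSet (A : Fin n → NoiseSet d) : MeasurableSet (boxSet A) :=
  MeasurableSet.univ_pi fun i ↦ (A i).measurableSet

lemma boxSet_indicator (A : Fin n → NoiseSet d) (p : Fin n → ℝ × Space d) :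
    (boxSet A).indicator (fun _ ↦ (1 : ℝ)) p =
      ∏ i, (A i).carrier.indicator (fun _ ↦ (1 : ℝ)) (p i) := by
  by_cases h : p ∈ boxSet A
  · rw [Set.indicator_of_mem h, Finset.prod_eq_one]
    intro i _
    exact Set.indicator_of_mem (h i (Set.mem_univ i)) _
  · rw [Set.indicator_of_notMem h]
    have : ∃ i, p i ∉ (A i).carrier := by simpa [boxSet] using h
    obtain ⟨i, hi⟩ := this
    exact (Finset.prod_eq_zero (Finset.mem_univ i) (Set.indicator_of_notMem hi _)).symm

/-- The elementary kernel of a single box. -/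
def ElementaryKernel.single (A : Fin n → NoiseSet d) (hA : IsOrderedBox A) :
    ElementaryKernel d n where
  size := 1
  coeff _ := 1
  box _ := A
  disjoint_time _ i j hij := by
    refine Set.disjoint_left.mpr ?_
    rintro _ ⟨p, hp, rfl⟩ ⟨q, hq, hpq⟩
    rcases lt_or_gt_of_ne hij with h | h
    · exact (hA _ _ h p hp q hq).ne hpq.symm
    · exact (hA _ _ h q hq p hp).ne hpq

lemma ElementaryKernel.toFun_single (A : Fin n → NoiseSet d) (hA : IsOrderedBox A) :
    (ElementaryKernel.single A hA).toFun = (boxSet A).indicator fun _ ↦ (1 : ℝ) := by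
  funext p
  rw [boxSet_indicator]
  change ∑ _j : Fin 1, 1 * ∏ i, (A i).carrier.indicator (fun _ ↦ (1 : ℝ)) (p i) = _
  simp

lemma rieszNormSq_boxSet_lt_top (hd : 3 ≤ d) (A : Fin n → NoiseSet d) :
    rieszNormSq ((boxSet A).indicator fun _ ↦ (1 : ℝ)) < ∞ := by
  have hm : Measurable ((boxSet A).indicator fun _ ↦ (1 : ℝ)) :=
    measurable_const.indicator (measurableSet_boxSet A)
  rw [rieszNormSq_eq_rieszPairing, rieszPairing_eq_lintegral (by fun_prop) (by fun_prop)]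
  simp_rw [boxSet_indicator, enorm_prod_real, ← Finset.prod_mul_distrib]
  rw [lintegral_fin_prod_eq_prod (fun i (q : ℝ × Space d × Space d) ↦
    ‖(A i).carrier.indicator (fun _ ↦ (1 : ℝ)) (q.1, q.2.1)‖ₑ *
      ‖(A i).carrier.indicator (fun _ ↦ (1 : ℝ)) (q.1, q.2.2)‖ₑ * (‖q.2.1 - q.2.2‖ₑ ^ 2)⁻¹)
    (fun i ↦ by fun_prop)]
  exact ENNReal.prod_lt_top fun i _ ↦ lintegral_indicator_mul_indicator_lt_top hd _ _

/-- `g` is a limit of ordered elementary kernels. -/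
def IsApproximable (g : (Fin n → ℝ × Space d) → ℝ) : Prop :=
  ∀ ε : ℝ≥0∞, 0 < ε → ∃ e : ElementaryKernel d n, IsOrdered e.toFun ∧
    rieszNormSq (fun p ↦ e.toFun p - g p) < ε

lemma rieszNormSq_zero : rieszNormSq (fun _ : Fin n → ℝ × Space d ↦ (0 : ℝ)) = 0 := by
  simp [rieszNormSq]

lemma isApproximable_toFun (e : ElementaryKernel d n) (he : IsOrdered e.toFun) :
    IsApproximable e.toFun := fun ε hε ↦ ⟨e, he, by simpa [rieszNormSq_zero] using hε⟩

lemma IsApproximable.of_tendsto {g : (Fin n → ℝ × Space d) → ℝ}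
    {f : ℕ → (Fin n → ℝ × Space d) → ℝ} (hg : Measurable g) (hf : ∀ m, Measurable (f m))
    (hfa : ∀ m, IsApproximable (f m))
    (h : Tendsto (fun m ↦ rieszNormSq fun p ↦ f m p - g p) atTop (𝓝 0)) : IsApproximable g := by
  intro ε hε
  have hε' : 0 < ε / 4 := ENNReal.div_pos hε.ne' (by simp)
  obtain ⟨m, hm⟩ := (h.eventually (gt_mem_nhds hε')).exists
  obtain ⟨e, heo, he⟩ := hfa m _ hε'
  refine ⟨e, heo, (rieszNormSq_sub_le (by fun_prop) (hf m) hg).trans_lt ?_⟩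
  calc
    _ < 2 * (ε / 4 + ε / 4) := by
      rw [ENNReal.mul_lt_mul_iff_right (by simp) (by simp)]
      exact ENNReal.add_lt_add he hm
    _ = 4 * (ε / 4) := by ring
    _ ≤ ε := ENNReal.mul_div_le

lemma IsOrdered.add {g h : (Fin n → ℝ × Space d) → ℝ} (hg : IsOrdered g) (hh : IsOrdered h) :
    IsOrdered fun p ↦ g p + h p := by
  intro p hp
  by_cases h0 : g p = 0
  · exact hh p fun h1 ↦ hp (by simp [h0, h1])
  · exact hg p h0

lemma IsApproximable.add {g h : (Fin n → ℝ × Space d) → ℝ} (hgm : Measurable g)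
    (hhm : Measurable h) (hg : IsApproximable g) (hh : IsApproximable h) :
    IsApproximable fun p ↦ g p + h p := by
  intro ε hε
  have hε' : 0 < ε / 4 := ENNReal.div_pos hε.ne' (by simp)
  obtain ⟨e, heo, he⟩ := hg _ hε'
  obtain ⟨e', heo', he'⟩ := hh _ hε'
  refine ⟨e.add e', ?_, ?_⟩
  · simpa only [← ElementaryKernel.toFun_add] using heo.add heo'
  · simp_rw [ElementaryKernel.toFun_add, add_sub_add_comm]
    refine (rieszNormSq_add_le (by fun_prop) (by fun_prop)).trans_lt ?_
    calc
      _ < 2 * (ε / 4 + ε / 4) := by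
        rw [ENNReal.mul_lt_mul_iff_right (by simp) (by simp)]
        exact ENNReal.add_lt_add he he'
      _ = 4 * (ε / 4) := by ring
      _ ≤ ε := ENNReal.mul_div_le

lemma IsApproximable.const_mul {g : (Fin n → ℝ × Space d) → ℝ} (hgm : Measurable g)
    (hg : IsApproximable g) (c : ℝ) : IsApproximable fun p ↦ c * g p := by
  intro ε hε
  -- The summand `1` keeps the divisor nonzero when `c = 0`.
  have hc : ‖c‖ₑ ^ 2 + 1 ≠ ∞ := by simp
  obtain ⟨e, heo, he⟩ := hg (ε / (‖c‖ₑ ^ 2 + 1)) (ENNReal.div_pos hε.ne' hc)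
  refine ⟨e.smul c, fun p hp ↦ heo p fun h0 ↦ hp (by simp [ElementaryKernel.toFun_smul, h0]), ?_⟩
  simp_rw [ElementaryKernel.toFun_smul, ← mul_sub]
  rw [rieszNormSq_const_mul c (by fun_prop)]
  calc
    _ ≤ (‖c‖ₑ ^ 2 + 1) * rieszNormSq (fun p ↦ e.toFun p - g p) := by gcongr; simp
    _ < (‖c‖ₑ ^ 2 + 1) * (ε / (‖c‖ₑ ^ 2 + 1)) := by
      rw [ENNReal.mul_lt_mul_iff_right (by simp) hc]
      exact he
    _ ≤ ε := ENNReal.mul_div_le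

lemma isApproximable_zero : IsApproximable (fun _ : Fin n → ℝ × Space d ↦ (0 : ℝ)) := by
  have h : (fun _ : Fin n → ℝ × Space d ↦ (0 : ℝ)) = ElementaryKernel.toFun
      ⟨0, Fin.elim0, fun j ↦ j.elim0, fun j ↦ j.elim0⟩ := by
    funext p
    simp [ElementaryKernel.toFun]
  rw [h]
  refine isApproximable_toFun _ fun p hp ↦ ?_
  simp [ElementaryKernel.toFun] at hp

/-- The intersection of a noise set with a measurable set. -/
def NoiseSet.inter (A : NoiseSet d) (t : Set (ℝ × Space d)) (ht : MeasurableSet t) :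
    NoiseSet d where
  carrier := A.carrier ∩ t
  measurableSet := A.measurableSet.inter ht
  isBounded := A.isBounded.subset Set.inter_subset_left
  pos_time p hp := A.pos_time p hp.1

lemma isApproximable_boxSet {A : Fin n → NoiseSet d} (hA : IsOrderedBox A) :
    IsApproximable ((boxSet A).indicator fun _ ↦ (1 : ℝ)) := by
  rw [← ElementaryKernel.toFun_single A hA]
  refine isApproximable_toFun _ fun p hp ↦ ?_
  rw [ElementaryKernel.toFun_single] at hp
  have h : p ∈ boxSet A := Set.mem_of_indicator_ne_zero hp
  exact fun i j hij ↦ hA i j hij _ (h i trivial) _ (h j trivial)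

/-- Induction from the π-system of product sets. Working inside a fixed box keeps complements and
countable unions dominated by an indicator of finite norm. -/
lemma isApproximable_inter_boxSet (hd : 3 ≤ d) {A : Fin n → NoiseSet d} (hA : IsOrderedBox A)
    {S : Set (Fin n → ℝ × Space d)} (hS : MeasurableSet S) :
    IsApproximable ((S ∩ boxSet A).indicator fun _ ↦ (1 : ℝ)) := by
  have hD := measurableSet_boxSet A
  have hm {S : Set (Fin n → ℝ × Space d)} (hS : MeasurableSet S) :
      Measurable ((S ∩ boxSet A).indicator fun _ ↦ (1 : ℝ)) :=
    measurable_const.indicator (hS.inter hD)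
  have hpi : IsPiSystem (Set.univ.pi '' Set.univ.pi fun _ : Fin n ↦
      {s : Set (ℝ × Space d) | MeasurableSet s}) := isPiSystem_pi
  induction S, hS using MeasurableSpace.induction_on_inter generateFrom_pi.symm hpi with
  | empty => simpa using isApproximable_zero
  | basic S hS =>
    obtain ⟨t, ht, rfl⟩ := hS
    have ht' (i : Fin n) : MeasurableSet (t i) := ht i trivial
    have h : Set.univ.pi t ∩ boxSet A = boxSet fun i ↦ (A i).inter (t i) (ht' i) := by
      rw [Set.inter_comm]
      exact Set.pi_inter_distrib.symm
    rw [h]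
    exact isApproximable_boxSet fun i j hij p hp q hq ↦ hA i j hij p hp.1 q hq.1
  | compl S hS ih =>
    have h := (isApproximable_boxSet hA).add (measurable_const.indicator hD)
      ((hm hS).const_mul (-1)) (ih.const_mul (hm hS) (-1))
    convert h using 2 with p
    by_cases h1 : p ∈ boxSet A <;> by_cases h2 : p ∈ S <;> simp [h1, h2]
  | iUnion f hfm hf ih =>
    set V : ℕ → Set (Fin n → ℝ × Space d) := fun m ↦ ⋃ i ∈ Finset.range m, f i with hV
    have hVm (m : ℕ) : MeasurableSet (V m) := Finset.measurableSet_biUnion _ fun i _ ↦ hf i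
    have hVs (m : ℕ) : V (m + 1) = V m ∪ f m := by
      simp only [hV, Finset.range_add_one, Finset.set_biUnion_insert]
      exact Set.union_comm _ _
    have hU (m : ℕ) : IsApproximable ((V m ∩ boxSet A).indicator fun _ ↦ (1 : ℝ)) := by
      induction m with
      | zero => simpa [hV] using isApproximable_zero
      | succ m ihm =>
        have h := ihm.add (hm (hVm m)) (hm (hf m)) (ih m)
        convert h using 2 with p
        have hdis : p ∈ f m → p ∉ V m := by
          intro h1 h2
          simp only [hV, Set.mem_iUnion, Finset.mem_range] at h2
          obtain ⟨i, hi, h2⟩ := h2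
          exact Set.disjoint_left.mp (hfm hi.ne) h2 h1
        rw [hVs]
        by_cases h1 : p ∈ boxSet A
        · by_cases h2 : p ∈ f m
          · simp [h1, h2, hdis h2]
          · by_cases h3 : p ∈ V m <;> simp [h1, h2, h3]
        · simp [h1]
    refine IsApproximable.of_tendsto (hm (MeasurableSet.iUnion hf)) (fun m ↦ hm (hVm m)) hU ?_
    refine tendsto_rieszNormSq_zero (G := (boxSet A).indicator fun _ ↦ (1 : ℝ))
      (fun m ↦ (hm (hVm m)).sub (hm (MeasurableSet.iUnion hf)))
      (measurable_const.indicator hD) (fun p ↦ ?_) (fun m p ↦ ?_) (rieszNormSq_boxSet_lt_top hd A)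
    · refine tendsto_const_nhds.congr' ?_
      by_cases h2 : p ∈ ⋃ i, f i
      · obtain ⟨i, hi⟩ := Set.mem_iUnion.mp h2
        filter_upwards [eventually_gt_atTop i] with m hmi
        have h3 : p ∈ V m := by
          simp only [hV, Set.mem_iUnion, Finset.mem_range]
          exact ⟨i, hmi, hi⟩
        by_cases h1 : p ∈ boxSet A
        · rw [Set.indicator_of_mem (Set.mem_inter h3 h1),
            Set.indicator_of_mem (Set.mem_inter h2 h1), sub_self]
        · simp [h1]
      · refine Eventually.of_forall fun m ↦ ?_
        have h3 : p ∉ V m := fun h ↦ h2 (by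
          simp only [hV, Set.mem_iUnion] at h ⊢
          obtain ⟨i, _, hi⟩ := h
          exact ⟨i, hi⟩)
        simp only
        rw [Set.indicator_of_notMem (s := V m ∩ boxSet A) (fun h ↦ h3 h.1),
          Set.indicator_of_notMem (s := (⋃ i, f i) ∩ boxSet A) (fun h ↦ h2 h.1), sub_self]
    · by_cases h1 : p ∈ boxSet A
      · rw [Set.indicator_of_mem h1]
        simp only [Set.indicator]
        split_ifs <;> simp
      · simp [h1]

lemma isApproximable_indicator_simpleFunc (hd : 3 ≤ d) {A : Fin n → NoiseSet d}
    (hA : IsOrderedBox A) (f : SimpleFunc (Fin n → ℝ × Space d) ℝ) :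
    IsApproximable ((boxSet A).indicator f) := by
  have hD := measurableSet_boxSet A
  induction f using SimpleFunc.induction with
  | @const c s hs =>
    have h := (isApproximable_inter_boxSet hd hA hs).const_mul
      (measurable_const.indicator (hs.inter hD)) c
    convert h using 2 with p
    by_cases h1 : p ∈ boxSet A <;> by_cases h2 : p ∈ s <;> simp [h1, h2]
  | @add f g _ hf hg =>
    have h := hf.add (f.measurable.indicator hD) (g.measurable.indicator hD) hg
    convert h using 2 with p
    by_cases h1 : p ∈ boxSet A <;> simp [h1]

lemma isApproximable_indicator (hd : 3 ≤ d) {A : Fin n → NoiseSet d} (hA : IsOrderedBox A)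
    {g : (Fin n → ℝ × Space d) → ℝ} (hg : Measurable g) (hfin : rieszNormSq g < ∞) :
    IsApproximable ((boxSet A).indicator g) := by
  have hD := measurableSet_boxSet A
  set f : ℕ → SimpleFunc (Fin n → ℝ × Space d) ℝ :=
    SimpleFunc.approxOn g hg Set.univ 0 trivial with hf
  refine IsApproximable.of_tendsto (hg.indicator hD) (fun m ↦ (f m).measurable.indicator hD)
    (fun m ↦ isApproximable_indicator_simpleFunc hd hA (f m)) ?_
  -- The approximating simple functions are bounded by `2 ‖g‖`, so the differences are bounded by `3
  -- ‖g‖`.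
  refine tendsto_rieszNormSq_zero (G := fun p ↦ 3 * g p)
    (fun m ↦ ((f m).measurable.indicator hD).sub (hg.indicator hD)) (by fun_prop) (fun p ↦ ?_)
    (fun m p ↦ ?_) ?_
  · by_cases h1 : p ∈ boxSet A
    · simp only [Set.indicator_of_mem h1]
      have := SimpleFunc.tendsto_approxOn hg (s := Set.univ) (h₀ := trivial) (y₀ := 0)
        (x := p) (by simp)
      simpa using this.sub_const (g p)
    · simp [h1]
  · by_cases h1 : p ∈ boxSet A
    · simp only [Set.indicator_of_mem h1]
      have h2 := SimpleFunc.norm_approxOn_zero_le hg (s := Set.univ) trivial p m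
      rw [← hf] at h2
      have h3 := norm_sub_le (f m p) (g p)
      have h4 : ‖3 * g p‖ = 3 * ‖g p‖ := by simp
      linarith
    · simp [h1]
  · rw [rieszNormSq_const_mul _ hg]
    exact ENNReal.mul_lt_top (by simp) hfin

/-- Boxes with rational time intervals and integral radius; empty unless the time intervals follow
one another. -/
def rationalBox (a b : Fin n → ℚ) (M : ℕ) (i : Fin n) : NoiseSet d where
  carrier := {q | ((∀ j, 0 ≤ a j) ∧ ∀ j k, j < k → b j ≤ a k) ∧
    ((a i : ℝ) < q.1 ∧ q.1 < b i) ∧ ‖q.2‖ < M}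
  measurableSet := by
    refine MeasurableSet.inter (MeasurableSet.const _) (MeasurableSet.inter
      (MeasurableSet.inter ?_ ?_) ?_)
    · exact measurableSet_lt measurable_const measurable_fst
    · exact measurableSet_lt measurable_fst measurable_const
    · exact measurableSet_lt measurable_snd.norm measurable_const
  isBounded := by
    refine ((Metric.isBounded_Ioo (a i : ℝ) (b i)).prod
      (Metric.isBounded_ball (x := (0 : Space d)) (r := M))).subset ?_
    rintro q ⟨_, h1, h2⟩
    exact ⟨h1, by simpa using h2⟩
  pos_time := by
    rintro q ⟨h, h1, _⟩
    have : (0 : ℝ) ≤ a i := by exact_mod_cast h.1 i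
    linarith [h1.1]

lemma isOrderedBox_rationalBox (a b : Fin n → ℚ) (M : ℕ) :
    IsOrderedBox (rationalBox (d := d) a b M) := by
  rintro i j hij p ⟨h, hp, _⟩ q ⟨_, hq, _⟩
  have : (b i : ℝ) ≤ a j := by exact_mod_cast h.2 i j hij
  linarith [hp.2, hq.1]

/-- With `δ` below each time and below half of every gap, rational intervals within `δ` of the times
are positive and separated. -/
lemma exists_mem_rationalBox {p : Fin n → ℝ × Space d} (hpos : ∀ i, 0 < (p i).1)
    (hmono : StrictMono fun i ↦ (p i).1) : ∃ a b M, p ∈ boxSet (rationalBox a b M) := by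
  have h1 : ∀ᶠ δ : ℝ in 𝓝[>] 0, (∀ i, δ < (p i).1) ∧
      ∀ i j, i < j → (p i).1 + δ < (p j).1 - δ := by
    refine (eventually_all.mpr fun i ↦ ?_).and (eventually_all.mpr fun i ↦
      eventually_all.mpr fun j ↦ ?_)
    · exact (gt_mem_nhds (hpos i)).filter_mono nhdsWithin_le_nhds
    · by_cases hij : i < j
      · have h2 : 0 < ((p j).1 - (p i).1) / 2 := by
          have := hmono hij
          simp only at this
          linarith
        filter_upwards [(gt_mem_nhds h2).filter_mono nhdsWithin_le_nhds] with δ hδ _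
        linarith
      · exact Eventually.of_forall fun δ h ↦ absurd h hij
  obtain ⟨δ, ⟨hδ1, hδ2⟩, hδ0⟩ := (h1.and self_mem_nhdsWithin).exists
  have hδ0 : 0 < δ := hδ0
  have ha (i : Fin n) : ∃ a : ℚ, (p i).1 - δ < a ∧ (a : ℝ) < (p i).1 :=
    exists_rat_btwn (by linarith)
  have hb (i : Fin n) : ∃ b : ℚ, (p i).1 < b ∧ (b : ℝ) < (p i).1 + δ :=
    exists_rat_btwn (by linarith)
  choose a ha1 ha2 using ha
  choose b hb1 hb2 using hb
  obtain ⟨M, hM⟩ := exists_nat_gt (∑ i, ‖(p i).2‖)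
  refine ⟨a, b, M, fun i _ ↦ ⟨⟨fun j ↦ ?_, fun j k hjk ↦ ?_⟩, ⟨ha2 i, hb1 i⟩, ?_⟩⟩
  · have : (0 : ℝ) ≤ a j := by linarith [ha1 j, hδ1 j]
    exact_mod_cast this
  · have : (b j : ℝ) ≤ a k := by linarith [hb2 j, ha1 k, hδ2 j k hjk]
    exact_mod_cast this
  · exact (Finset.single_le_sum (f := fun i ↦ ‖(p i).2‖) (fun i _ ↦ norm_nonneg _)
      (Finset.mem_univ i)).trans_lt hM

/-- Ordered kernels of finite norm are limits of ordered elementary kernels. -/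
theorem isApproximable_of_isOrdered (hd : 3 ≤ d) {g : (Fin n → ℝ × Space d) → ℝ}
    (hg : Measurable g) (hfin : rieszNormSq g < ∞) (hord : IsOrdered g)
    (hpos : ∀ p, g p ≠ 0 → ∀ i, 0 < (p i).1) : IsApproximable g := by
  obtain ⟨φ, hφ⟩ := exists_surjective_nat ((Fin n → ℚ) × (Fin n → ℚ) × ℕ)
  set A : ℕ → Fin n → NoiseSet d := fun m ↦ rationalBox (φ m).1 (φ m).2.1 (φ m).2.2 with hA
  have hAm (m : ℕ) : MeasurableSet (boxSet (A m)) := measurableSet_boxSet _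
  set U : ℕ → Set (Fin n → ℝ × Space d) := fun m ↦ ⋃ i ∈ Finset.range m, boxSet (A i) with hU
  have hUm (m : ℕ) : MeasurableSet (U m) := Finset.measurableSet_biUnion _ fun i _ ↦ hAm i
  have hUs (m : ℕ) : U (m + 1) = U m ∪ boxSet (A m) := by
    simp only [hU, Finset.range_add_one, Finset.set_biUnion_insert]
    exact Set.union_comm _ _
  have happ (m : ℕ) : IsApproximable ((U m).indicator g) := by
    induction m with
    | zero => simpa [hU] using isApproximable_zero
    | succ m ih =>
      -- Only the part of the new box outside `U m` is added, so that overlapping boxes are not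
      -- counted twice.
      have hn : rieszNormSq ((U m)ᶜ.indicator g) < ∞ :=
        (rieszNormSq_mono fun p ↦ norm_indicator_le_norm_self g p).trans_lt hfin
      have h1 := isApproximable_indicator hd (isOrderedBox_rationalBox (d := d) (φ m).1 (φ m).2.1
        (φ m).2.2) (hg.indicator (hUm m).compl) hn
      have h2 := ih.add (hg.indicator (hUm m)) ((hg.indicator (hUm m).compl).indicator (hAm m)) h1
      convert h2 using 2 with p
      rw [hUs]
      by_cases h3 : p ∈ U m
      · simp [h3, Set.indicator]
      · by_cases h4 : p ∈ boxSet (A m)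
        · simp [h3, h4]
        · simp [h3, h4]
  refine IsApproximable.of_tendsto hg (fun m ↦ hg.indicator (hUm m)) happ ?_
  refine tendsto_rieszNormSq_zero (G := g) (fun m ↦ (hg.indicator (hUm m)).sub hg) hg (fun p ↦ ?_)
    (fun m p ↦ ?_) hfin
  · refine tendsto_const_nhds.congr' ?_
    by_cases h0 : g p = 0
    · refine Eventually.of_forall fun m ↦ ?_
      simp [Set.indicator, h0]
    · obtain ⟨a, b, M, hp⟩ := exists_mem_rationalBox (hpos p h0) (hord p h0)
      obtain ⟨i, hi⟩ := hφ (a, b, M)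
      filter_upwards [eventually_gt_atTop i] with m hm
      have h1 : p ∈ U m := by
        simp only [hU, Set.mem_iUnion, Finset.mem_range]
        exact ⟨i, hm, by simpa [hA, hi] using hp⟩
      rw [Set.indicator_of_mem h1, sub_self]
  · by_cases h1 : p ∈ U m <;> simp [h1]

end Approximation

/-! ### Estimates of the chaos kernels -/

section ChaosKernel

variable {d : ℕ}

/-- The unnormalized density of the path through the points of `p` that ends at `(t, x)`. -/
def pathKernel (κ : ℝ) : (n : ℕ) → (Fin n → ℝ × Space d) → ℝ → Space d → ℝ≥0∞
  | 0, _, _, _ => 1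
  | n + 1, p, t, x => {q : ℝ × ℝ | 0 < q.1 ∧ q.1 < q.2}.indicator (fun _ ↦ 1)
      ((p (Fin.last n)).1, t) * (ENNReal.ofReal κ *
      ENNReal.ofReal (heatKernel (t - (p (Fin.last n)).1) (x - (p (Fin.last n)).2)) *
      pathKernel κ n (Fin.init p) (p (Fin.last n)).1 (p (Fin.last n)).2)

lemma measurable_indicator_lt :
    Measurable ({q : ℝ × ℝ | 0 < q.1 ∧ q.1 < q.2}.indicator fun _ ↦ (1 : ℝ≥0∞)) :=
  measurable_const.indicator ((measurableSet_lt measurable_const measurable_fst).inter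
    (measurableSet_lt measurable_fst measurable_snd))

@[fun_prop]
lemma measurable_pathKernel (κ : ℝ) (n : ℕ) :
    Measurable fun a : (Fin n → ℝ × Space d) × ℝ × Space d ↦ pathKernel κ n a.1 a.2.1 a.2.2 := by
  induction n with
  | zero => exact measurable_const
  | succ n ih =>
    have h1 := measurable_indicator_lt
    have h2 : Measurable fun a : (Fin (n + 1) → ℝ × Space d) × ℝ × Space d ↦
        (Fin.init a.1 : Fin n → ℝ × Space d) := by
      refine measurable_pi_lambda _ fun i ↦ ?_
      simp only [Fin.init]
      fun_prop
    have h3 : Measurable fun a : (Fin (n + 1) → ℝ × Space d) × ℝ × Space d ↦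
        pathKernel κ n (Fin.init a.1) (a.1 (Fin.last n)).1 (a.1 (Fin.last n)).2 :=
      ih.comp (h2.prodMk (by fun_prop))
    unfold pathKernel
    fun_prop

@[fun_prop]
lemma Measurable.pathKernel {α : Type*} [MeasurableSpace α] {κ : ℝ} {n : ℕ}
    {p : α → Fin n → ℝ × Space d} {t : α → ℝ} {x : α → Space d} (hp : Measurable p)
    (ht : Measurable t) (hx : Measurable x) :
    Measurable fun a ↦ pathKernel κ n (p a) (t a) (x a) :=
  (measurable_pathKernel κ n).comp (hp.prodMk (ht.prodMk hx))

/-- The latest point is split off and becomes the endpoint of the remaining path. -/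
lemma ofReal_prod_heatKernel {κ : ℝ} (hκ : 0 ≤ κ) {n : ℕ} {p : Fin n → ℝ × Space d} {t : ℝ}
    (h : ∀ i, 0 < (p i).1 ∧ (p i).1 < t) (hm : StrictMono fun i ↦ (p i).1) (x : Space d) :
    ENNReal.ofReal (κ ^ n * ∏ i : Fin n,
      let q : Fin (n + 1) → ℝ × Space d := Fin.snoc p (t, x)
      heatKernel ((q i.succ).1 - (q i.castSucc).1) ((q i.succ).2 - (q i.castSucc).2)) =
      pathKernel κ n p t x := by
  induction n generalizing t x with
  | zero => simp [pathKernel]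
  | succ n ih =>
    have ih' := ih (p := Fin.init p) (t := (p (Fin.last n)).1)
      (fun i ↦ ⟨(h _).1, hm (Fin.castSucc_lt_last i)⟩)
      (fun i j hij ↦ hm (Fin.castSucc_lt_castSucc_iff.mpr hij)) (p (Fin.last n)).2
    simp only [Prod.mk.eta, Fin.snoc_init_self] at ih'
    rw [pathKernel, ← ih', Set.indicator_of_mem (by exact h (Fin.last n)), one_mul,
      Fin.prod_univ_castSucc]
    simp only [Fin.succ_last, Fin.snoc_last, Fin.snoc_castSucc, Fin.succ_castSucc]
    have hG : 0 ≤ heatKernel (t - (p (Fin.last n)).1) (x - (p (Fin.last n)).2) :=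
      heatKernel_nonneg (by linarith [(h (Fin.last n)).2]) _
    rw [← ENNReal.ofReal_mul hκ, ← ENNReal.ofReal_mul (by positivity)]
    congr 1
    ring

lemma enorm_chaosKernel_le {κ : ℝ} (hκ : 0 ≤ κ) (t : ℝ) (f : Space d → ℝ) (n : ℕ)
    (p : Fin n → ℝ × Space d) :
    ‖chaosKernel κ t f n p‖ₑ ≤ ∫⁻ x, ‖f x‖ₑ * pathKernel κ n p t x := by
  unfold chaosKernel
  split_ifs with h
  · rw [← integral_const_mul]
    refine (enorm_integral_le_lintegral_enorm _).trans (lintegral_mono fun x ↦ ?_)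
    rw [← ofReal_prod_heatKernel hκ h.1 h.2, mul_left_comm, enorm_mul]
    refine mul_le_mul' le_rfl (le_of_eq (Real.enorm_of_nonneg ?_))
    refine mul_nonneg (by positivity) (Finset.prod_nonneg fun i _ ↦ heatKernel_nonneg ?_ _)
    -- The index `i.succ` is generalized to `j` to separate the endpoint from the points of `p`; in
    -- both cases the time increment is nonnegative.
    refine Fin.lastCases (motive := fun j : Fin (n + 1) ↦ ∀ i : Fin n, i.succ = j → 0 ≤
      ((Fin.snoc p (t, x) : Fin (n + 1) → ℝ × Space d) j).1 -
        ((Fin.snoc p (t, x) : Fin (n + 1) → ℝ × Space d) i.castSucc).1) ?_ ?_ i.succ i rfl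
    · intro i _
      simp only [Fin.snoc_last, Fin.snoc_castSucc]
      linarith [(h.1 i).2]
    · intro j i hij
      simp only [Fin.snoc_castSucc]
      have : i < j := by
        have := congrArg Fin.val hij
        simp at this
        exact Fin.lt_def.mpr (by omega)
      have := h.2 this
      simp only at this
      linarith
  · simp

lemma measurable_chaosKernel (κ t : ℝ) {f : Space d → ℝ} (hf : Measurable f) (n : ℕ) :
    Measurable (chaosKernel κ t f n) := by
  have hset : MeasurableSet {p : Fin n → ℝ × Space d |
      (∀ i, 0 < (p i).1 ∧ (p i).1 < t) ∧ StrictMono fun i ↦ (p i).1} := by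
    have h1 : {p : Fin n → ℝ × Space d |
      (∀ i, 0 < (p i).1 ∧ (p i).1 < t) ∧ StrictMono fun i ↦ (p i).1} =
      (⋂ i, ({p | 0 < (p i).1} ∩ {p | (p i).1 < t})) ∩
        ⋂ i, ⋂ j, ⋂ _ : i < j, {p | (p i).1 < (p j).1} := by
      ext p
      simp [StrictMono]
    rw [h1]
    refine (MeasurableSet.iInter fun i ↦ ?_).inter (MeasurableSet.iInter fun i ↦
      MeasurableSet.iInter fun j ↦ MeasurableSet.iInter fun _ ↦ ?_)
    · exact (measurableSet_lt measurable_const (by fun_prop)).inter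
        (measurableSet_lt (by fun_prop) measurable_const)
    · exact measurableSet_lt (by fun_prop) (by fun_prop)
  have hsnoc (j : Fin (n + 1)) : Measurable fun a : (Fin n → ℝ × Space d) × Space d ↦
      (Fin.snoc a.1 (t, a.2) : Fin (n + 1) → ℝ × Space d) j := by
    refine Fin.lastCases ?_ (fun i ↦ ?_) j
    · simp only [Fin.snoc_last]
      fun_prop
    · simp only [Fin.snoc_castSucc]
      fun_prop
  have h_int : Measurable fun a : (Fin n → ℝ × Space d) × Space d ↦ f a.2 * ∏ i : Fin n,
      let q : Fin (n + 1) → ℝ × Space d := Fin.snoc a.1 (t, a.2)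
      heatKernel ((q i.succ).1 - (q i.castSucc).1) ((q i.succ).2 - (q i.castSucc).2) := by
    refine (hf.comp measurable_snd).mul (Finset.measurable_prod _ fun i _ ↦ ?_)
    exact Measurable.heatKernel ((hsnoc _).fst.sub (hsnoc _).fst) ((hsnoc _).snd.sub (hsnoc _).snd)
  unfold chaosKernel
  refine Measurable.ite hset (Measurable.const_mul ?_ _) measurable_const
  exact (StronglyMeasurable.integral_prod_right (ν := volume) h_int.stronglyMeasurable).measurable

/-- The two-point function of the paths that carry the `n`-th chaos. -/
def twoPoint (κ : ℝ) (n : ℕ) (t : ℝ) (x x' : Space d) : ℝ≥0∞ :=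
  ∫⁻ q : Fin n → ℝ × Space d × Space d,
    pathKernel κ n (fun i ↦ ((q i).1, (q i).2.1)) t x *
      pathKernel κ n (fun i ↦ ((q i).1, (q i).2.2)) t x' *
        ∏ i, (‖(q i).2.1 - (q i).2.2‖ₑ ^ 2)⁻¹

lemma twoPoint_zero (κ t : ℝ) (x x' : Space d) : twoPoint κ 0 t x x' = 1 := by
  simp [twoPoint, pathKernel, volume_pi]

lemma rieszNormSq_chaosKernel_le {κ : ℝ} (hκ : 0 ≤ κ) (t : ℝ) {f : Space d → ℝ}
    (hf : Measurable f) (n : ℕ) :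
    rieszNormSq (chaosKernel κ t f n) ≤
      ∫⁻ x, ∫⁻ x', ‖f x‖ₑ * ‖f x'‖ₑ * twoPoint κ n t x x' := by
  rw [rieszNormSq_eq_rieszPairing]
  refine (rieszPairing_mono (enorm_chaosKernel_le hκ t f n)
    (enorm_chaosKernel_le hκ t f n)).trans (le_of_eq ?_)
  rw [rieszPairing_eq_lintegral (by fun_prop) (by fun_prop)]
  have h (q : Fin n → ℝ × Space d × Space d) :
      (∫⁻ x, ‖f x‖ₑ * pathKernel κ n (fun i ↦ ((q i).1, (q i).2.1)) t x) *
      (∫⁻ x, ‖f x‖ₑ * pathKernel κ n (fun i ↦ ((q i).1, (q i).2.2)) t x) *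
        ∏ i, (‖(q i).2.1 - (q i).2.2‖ₑ ^ 2)⁻¹ =
      ∫⁻ x, ∫⁻ x', ‖f x‖ₑ * ‖f x'‖ₑ * (pathKernel κ n (fun i ↦ ((q i).1, (q i).2.1)) t x *
        pathKernel κ n (fun i ↦ ((q i).1, (q i).2.2)) t x' *
          ∏ i, (‖(q i).2.1 - (q i).2.2‖ₑ ^ 2)⁻¹) := by
    rw [mul_assoc, ← lintegral_mul_const _ (by fun_prop)]
    refine lintegral_congr fun x ↦ ?_
    rw [← mul_assoc, ← lintegral_const_mul _ (by fun_prop), ← lintegral_mul_const _ (by fun_prop)]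
    refine lintegral_congr fun x' ↦ ?_
    ring
  simp_rw [h]
  rw [lintegral_lintegral_swap (by fun_prop)]
  refine lintegral_congr fun x ↦ ?_
  rw [lintegral_lintegral_swap (by fun_prop)]
  refine lintegral_congr fun x' ↦ ?_
  rw [lintegral_const_mul _ (by fun_prop)]
  rfl

@[fun_prop]
lemma measurable_twoPoint (κ : ℝ) (n : ℕ) : Measurable fun a : ℝ × Space d × Space d ↦
    twoPoint κ n a.1 a.2.1 a.2.2 := by
  unfold twoPoint
  fun_prop

/-- Conditioning on the latest triple `(s, y, z)`: the earlier points form a two-point function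
ending there, by Tonelli. -/
lemma twoPoint_succ (κ : ℝ) (n : ℕ) (t : ℝ) (x x' : Space d) :
    twoPoint κ (n + 1) t x x' = ∫⁻ s in Set.Ioo 0 t, ∫⁻ y, ∫⁻ z, ENNReal.ofReal κ ^ 2 *
      (ENNReal.ofReal (heatKernel (t - s) (x - y)) * ENNReal.ofReal (heatKernel (t - s) (x' - z)) *
        ((‖y - z‖ₑ ^ 2)⁻¹ * twoPoint κ n s y z)) := by
  have hi := measurable_indicator_lt
  have hm := measurable_twoPoint (d := d) κ n
  have hm' : Measurable fun a : ℝ × Space d × Space d ↦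
    {q : ℝ × ℝ | 0 < q.1 ∧ q.1 < q.2}.indicator (fun _ ↦ 1) (a.1, t) * (ENNReal.ofReal κ ^ 2 *
      (ENNReal.ofReal (heatKernel (t - a.1) (x - a.2.1)) *
        ENNReal.ofReal (heatKernel (t - a.1) (x' - a.2.2)) *
        ((‖a.2.1 - a.2.2‖ₑ ^ 2)⁻¹ * twoPoint κ n a.1 a.2.1 a.2.2))) := by fun_prop
  have h1 : twoPoint κ (n + 1) t x x' = ∫⁻ a : ℝ × Space d × Space d,
      {q : ℝ × ℝ | 0 < q.1 ∧ q.1 < q.2}.indicator (fun _ ↦ 1) (a.1, t) * (ENNReal.ofReal κ ^ 2 *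
      (ENNReal.ofReal (heatKernel (t - a.1) (x - a.2.1)) *
        ENNReal.ofReal (heatKernel (t - a.1) (x' - a.2.2)) *
        ((‖a.2.1 - a.2.2‖ₑ ^ 2)⁻¹ * twoPoint κ n a.1 a.2.1 a.2.2))) := by
    unfold twoPoint
    rw [← (volume_preserving_piFinSuccAbove (fun _ : Fin (n + 1) ↦ ℝ × Space d × Space d)
      (Fin.last n)).symm.lintegral_comp_emb (MeasurableEquiv.measurableEmbedding _),
      Measure.volume_eq_prod, lintegral_prod _ (by fun_prop)]
    refine lintegral_congr fun a ↦ ?_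
    rw [← lintegral_const_mul _ (by fun_prop), ← lintegral_const_mul _ (by fun_prop),
      ← lintegral_const_mul _ (by fun_prop), ← lintegral_const_mul _ (by fun_prop)]
    refine lintegral_congr fun q ↦ ?_
    simp only [MeasurableEquiv.piFinSuccAbove_symm_apply, Fin.insertNthEquiv_apply,
      Fin.insertNth_last', pathKernel, Fin.prod_univ_castSucc, Fin.snoc_last, Fin.snoc_castSucc]
    have hinit1 : (Fin.init fun i : Fin (n + 1) ↦
        ((Fin.snoc q a : Fin (n + 1) → ℝ × Space d × Space d) i |>.1,
        (Fin.snoc q a : Fin (n + 1) → ℝ × Space d × Space d) i |>.2.1)) =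
        fun i ↦ ((q i).1, (q i).2.1) := by
      funext i
      simp [Fin.init]
    have hinit2 : (Fin.init fun i : Fin (n + 1) ↦
        ((Fin.snoc q a : Fin (n + 1) → ℝ × Space d × Space d) i |>.1,
        (Fin.snoc q a : Fin (n + 1) → ℝ × Space d × Space d) i |>.2.2)) =
        fun i ↦ ((q i).1, (q i).2.2) := by
      funext i
      simp [Fin.init]
    rw [hinit1, hinit2]
    by_cases ha : (a.1, t) ∈ {q : ℝ × ℝ | 0 < q.1 ∧ q.1 < q.2}
    · rw [Set.indicator_of_mem ha]
      ring
    · rw [Set.indicator_of_notMem ha]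
      ring
  rw [h1, Measure.volume_eq_prod, lintegral_prod _ hm'.aemeasurable,
    ← lintegral_indicator measurableSet_Ioo]
  refine lintegral_congr fun s ↦ ?_
  by_cases hs : s ∈ Set.Ioo 0 t
  · have hs' : (s, t) ∈ {q : ℝ × ℝ | 0 < q.1 ∧ q.1 < q.2} := hs
    simp only [Set.indicator_of_mem hs, Set.indicator_of_mem hs', one_mul]
    rw [Measure.volume_eq_prod, lintegral_prod _ (by fun_prop)]
  · have hs' : (s, t) ∉ {q : ℝ × ℝ | 0 < q.1 ∧ q.1 < q.2} := hs
    simp [Set.indicator_of_notMem hs, Set.indicator_of_notMem hs']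

lemma inv_mul_enorm_rpow_le (x : Space d) {b : ℝ} (hb : 0 ≤ b) :
    (‖x‖ₑ ^ 2)⁻¹ * ‖x‖ₑ ^ (-b) ≤ ‖x‖ₑ ^ (-(b + 2)) := by
  rcases eq_or_ne x 0 with rfl | hx
  · rw [enorm_zero, ENNReal.zero_rpow_of_neg (show -(b + 2) < 0 by linarith)]
    exact le_top
  · rw [← enorm_rpow_neg_two, ← ENNReal.rpow_add _ _ (by simpa using hx) (by simp)]
    exact le_of_eq (by ring_nf)

/-- One step of the recursion for power bounds on the two-point functions. -/
lemma twoPoint_succ_le {κ : ℝ} {n : ℕ} {b θ : ℝ} {C : ℝ≥0∞} (hb : 0 ≤ b)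
    (hθ : 0 ≤ θ) (hpos : 0 < b + 2 * θ)
    (h : ∀ s ≤ 1, ∀ y z : Space d, twoPoint κ n s y z ≤ C * ‖y - z‖ₑ ^ (-b)) :
    ∀ t ≤ 1, ∀ x x' : Space d, twoPoint κ (n + 1) t x x' ≤
      (C * (ENNReal.ofReal κ ^ 2 * flowConst d b θ)) * ‖x - x'‖ₑ ^ (-(b + 2 * θ)) := by
  intro t ht x x'
  rw [twoPoint_succ]
  calc
    _ ≤ ∫⁻ s in Set.Ioo 0 t, ∫⁻ y, ∫⁻ z, (ENNReal.ofReal κ ^ 2 * C) *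
        (ENNReal.ofReal (heatKernel (t - s) (x - y)) *
        ENNReal.ofReal (heatKernel (t - s) (x' - z)) * ‖y - z‖ₑ ^ (-(b + 2))) := by
      refine setLIntegral_mono' measurableSet_Ioo fun s hs ↦ lintegral_mono fun y ↦
        lintegral_mono fun z ↦ ?_
      rw [mul_assoc (ENNReal.ofReal κ ^ 2) C, mul_left_comm C]
      refine mul_le_mul' le_rfl (mul_le_mul' le_rfl ?_)
      calc
        _ ≤ (‖y - z‖ₑ ^ 2)⁻¹ * (C * ‖y - z‖ₑ ^ (-b)) :=
          mul_le_mul' le_rfl (h s (hs.2.le.trans ht) y z)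
        _ = C * ((‖y - z‖ₑ ^ 2)⁻¹ * ‖y - z‖ₑ ^ (-b)) := by ring
        _ ≤ _ := mul_le_mul' le_rfl (inv_mul_enorm_rpow_le _ hb)
    _ = (ENNReal.ofReal κ ^ 2 * C) * ∫⁻ s in Set.Ioo 0 t, ∫⁻ y, ∫⁻ z,
        ENNReal.ofReal (heatKernel (t - s) (x - y)) *
        ENNReal.ofReal (heatKernel (t - s) (x' - z)) * ‖y - z‖ₑ ^ (-(b + 2)) := by
      rw [← lintegral_const_mul _ (by fun_prop)]
      refine lintegral_congr fun s ↦ ?_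
      rw [← lintegral_const_mul _ (by fun_prop)]
      refine lintegral_congr fun y ↦ ?_
      rw [← lintegral_const_mul _ (by fun_prop)]
    _ ≤ (ENNReal.ofReal κ ^ 2 * C) * (flowConst d b θ * ‖x - x'‖ₑ ^ (-(b + 2 * θ))) :=
      mul_le_mul' le_rfl (lintegral_heat_flow_le hb hθ hpos ht x x')
    _ = _ := by ring

end ChaosKernel

/-! ### Summation over the chaoses -/

section Summation

variable {d : ℕ}

/-- Half of the gain in the exponent of the two-point functions in each of the first `d` steps. -/
def gain (d : ℕ) : ℝ := ((d : ℝ) - 2) / (4 * d)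

/-- The exponent of the power bound on the two-point function of the `n`-th chaos; it increases to
`(d - 2) / 2`, the exponent at which Hardy's inequality is optimal. -/
def boundExponent (d n : ℕ) : ℝ := 2 * gain d * (min n d : ℕ)

/-- The constant of the power bound on the two-point function of the `n`-th chaos. -/
def boundConst (d : ℕ) (κ : ℝ) : ℕ → ℝ≥0∞
  | 0 => 1
  | n + 1 => boundConst d κ n *
      (ENNReal.ofReal κ ^ 2 * flowConst d (boundExponent d n) (if n < d then gain d else 0))

lemma gain_pos (hd : 3 ≤ d) : 0 < gain d := by
  have hd' : (3 : ℝ) ≤ d := by exact_mod_cast hd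
  unfold gain
  exact div_pos (by linarith) (by linarith)

/-- In the climbing steps `gain d` plays the role of `θ`, and `flowConst` is finite only for `θ <
1`. -/
lemma gain_lt_one (hd : 3 ≤ d) : gain d < 1 := by
  have hd' : (3 : ℝ) ≤ d := by exact_mod_cast hd
  unfold gain
  rw [div_lt_one (by linarith)]
  linarith

lemma two_mul_gain_mul (hd : 3 ≤ d) : 2 * gain d * d = ((d : ℝ) - 2) / 2 := by
  have hd' : (3 : ℝ) ≤ d := by exact_mod_cast hd
  unfold gain
  field_simp
  ring

lemma boundExponent_nonneg (hd : 3 ≤ d) (n : ℕ) : 0 ≤ boundExponent d n := by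
  have := gain_pos hd
  unfold boundExponent
  positivity

lemma boundExponent_le (hd : 3 ≤ d) (n : ℕ) : boundExponent d n ≤ ((d : ℝ) - 2) / 2 := by
  have := gain_pos hd
  rw [← two_mul_gain_mul hd]
  unfold boundExponent
  gcongr
  exact min_le_right _ _

lemma two_mul_gain_le_boundExponent (hd : 3 ≤ d) {n : ℕ} (hn : 1 ≤ n) :
    2 * gain d ≤ boundExponent d n := by
  have := gain_pos hd
  unfold boundExponent
  refine le_mul_of_one_le_right (by positivity) ?_
  exact_mod_cast le_min hn (by omega)

lemma boundExponent_succ (n : ℕ) :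
    boundExponent d (n + 1) = boundExponent d n + 2 * (if n < d then gain d else 0) := by
  unfold boundExponent
  split_ifs with h
  · rw [min_eq_left (by omega), min_eq_left (by omega)]
    push_cast
    ring
  · rw [min_eq_right (by omega), min_eq_right (by omega)]
    ring

lemma boundExponent_of_le (hd : 3 ≤ d) {n : ℕ} (hn : d ≤ n) :
    boundExponent d n = ((d : ℝ) - 2) / 2 := by
  rw [boundExponent, min_eq_right hn, two_mul_gain_mul hd]

lemma boundExponent_lt (hd : 3 ≤ d) (n : ℕ) : boundExponent d n < (d : ℝ) - 2 := by
  have hd' : (3 : ℝ) ≤ d := by exact_mod_cast hd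
  linarith [boundExponent_le hd n]

lemma boundConst_lt_top (hd : 3 ≤ d) (κ : ℝ) (n : ℕ) : boundConst d κ n < ∞ := by
  induction n with
  | zero => simp [boundConst]
  | succ n ih =>
    refine ENNReal.mul_lt_top ih (ENNReal.mul_lt_top (by simp) (flowConst_lt_top
      (boundExponent_nonneg hd n) (boundExponent_lt hd n) ?_))
    split_ifs
    · exact gain_lt_one hd
    · exact one_pos

/-- The step from `b = 0` must have `θ > 0`, since the bound requires `b + 2θ > 0`; later steps may
take `θ = 0`. -/
lemma twoPoint_le (hd : 3 ≤ d) (κ : ℝ) (n : ℕ) : ∀ t ≤ 1, ∀ x x' : Space d,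
    twoPoint κ n t x x' ≤ boundConst d κ n * ‖x - x'‖ₑ ^ (-boundExponent d n) := by
  induction n with
  | zero =>
    intro t _ x x'
    simp [twoPoint_zero, boundConst, boundExponent]
  | succ n ih =>
    have h0 : 0 ≤ (if n < d then gain d else 0) := by
      split_ifs
      · exact (gain_pos hd).le
      · exact le_rfl
    have h1 : 0 < boundExponent d n + 2 * (if n < d then gain d else 0) := by
      rw [← boundExponent_succ]
      linarith [two_mul_gain_le_boundExponent hd (Nat.le_add_left 1 n), gain_pos hd]
    have h := twoPoint_succ_le (boundExponent_nonneg hd n) h0 h1 ih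
    rw [← boundExponent_succ] at h
    exact h

/-- The bounds on the chaoses of order at least `d` are dominated by a geometric series. -/
lemma boundConst_add_le (hd : 3 ≤ d) {κ : ℝ} (hκ : 0 < κ) (m : ℕ) :
    boundConst d κ (d + m) ≤
      boundConst d κ d * ENNReal.ofReal (κ ^ 2 / (((d : ℝ) - 2) / 2) ^ 2) ^ m := by
  have hd' : (3 : ℝ) ≤ d := by exact_mod_cast hd
  induction m with
  | zero => simp
  | succ m ih =>
    rw [← add_assoc, boundConst, pow_succ (ENNReal.ofReal (κ ^ 2 / _)),
      ← mul_assoc (boundConst d κ d)]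
    refine mul_le_mul' ih ?_
    rw [if_neg (by omega), boundExponent_of_le hd (by omega)]
    -- The product `b (d - 2 - b)` is largest at this `b`, where both factors coincide.
    have h := flowConst_zero_le (d := d) (b := ((d : ℝ) - 2) / 2) (by linarith) (by linarith)
    refine (mul_le_mul' le_rfl h).trans (le_of_eq ?_)
    rw [← ENNReal.ofReal_pow hκ.le, ← ENNReal.ofReal_mul (by positivity)]
    congr 1
    rw [show (d : ℝ) - 2 - ((d : ℝ) - 2) / 2 = ((d : ℝ) - 2) / 2 by ring]
    ring

/-- Finitely many finite terms precede a geometric series. This is the only place where `κ < (d - 2)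
/ 2` enters. -/
lemma tsum_boundConst_lt_top (hd : 3 ≤ d) {κ : ℝ} (hκ : 0 < κ)
    (hκd : κ < ((d : ℝ) - 2) / 2) : ∑' n, boundConst d κ n < ∞ := by
  have hq : κ ^ 2 / (((d : ℝ) - 2) / 2) ^ 2 < 1 := by
    rw [div_lt_one (pow_pos (hκ.trans hκd) 2)]
    exact pow_lt_pow_left₀ hκd hκ.le two_ne_zero
  rw [← ENNReal.summable.sum_add_tsum_nat_add' (k := d)]
  refine ENNReal.add_lt_top.mpr ⟨ENNReal.sum_lt_top.mpr fun n _ ↦ boundConst_lt_top hd κ n, ?_⟩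
  simp_rw [add_comm _ d]
  refine (ENNReal.tsum_le_tsum fun m ↦ boundConst_add_le hd hκ m).trans_lt ?_
  rw [ENNReal.tsum_mul_left, ENNReal.tsum_geometric]
  refine ENNReal.mul_lt_top (boundConst_lt_top hd κ d) ?_
  rw [ENNReal.inv_lt_top, tsub_pos_iff_lt]
  exact ENNReal.ofReal_lt_one.mpr hq

/-- The exponent of the decay of the chaoses of order at least two. -/
def lowerDecay (d : ℕ) : ℝ := 2 + gain d

/-- The exponent of the singularity of the chaoses of order at least two. -/
def upperDecay (d : ℕ) : ℝ := 2 + ((d : ℝ) - 2) / 2 - gain d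

lemma two_lt_lowerDecay (hd : 3 ≤ d) : 2 < lowerDecay d := by
  unfold lowerDecay; linarith [gain_pos hd]

lemma lowerDecay_le_upperDecay (hd : 3 ≤ d) : lowerDecay d ≤ upperDecay d := by
  have h1 := two_mul_gain_le_boundExponent hd (n := d) (by omega)
  have h2 := boundExponent_le hd d
  unfold lowerDecay upperDecay
  linarith

lemma upperDecay_lt (hd : 3 ≤ d) : upperDecay d < d := by
  have hd' : (3 : ℝ) ≤ d := by exact_mod_cast hd
  unfold upperDecay
  linarith [gain_pos hd]

/-- A common bound for the constants of the last smoothing step. -/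
def decayConst (d : ℕ) : ℝ≥0∞ :=
  ∑ j ∈ Finset.range (d + 1), flowConst d (boundExponent d j) (1 - gain d / 2)

lemma decayConst_lt_top (hd : 3 ≤ d) : decayConst d < ∞ :=
  ENNReal.sum_lt_top.mpr fun j _ ↦ flowConst_lt_top (boundExponent_nonneg hd j)
    (boundExponent_lt hd j) (by linarith [gain_pos hd])

/-- The exponents are stationary from `n = d` on, so only finitely many constants occur. -/
lemma flowConst_le_decayConst (n : ℕ) :
    flowConst d (boundExponent d n) (1 - gain d / 2) ≤ decayConst d := by
  have h : boundExponent d n = boundExponent d (min n d) := by simp [boundExponent]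
  rw [h]
  exact Finset.single_le_sum (f := fun j ↦ flowConst d (boundExponent d j) (1 - gain d / 2))
    (fun _ _ ↦ zero_le) (Finset.mem_range.mpr (by omega))

/-- Depending on whether the norm is below or above `1`, one of the extreme exponents wins. This
replaces exponents varying with `n` by two fixed ones. -/
lemma enorm_rpow_neg_le_add (x : Space d) {a b c : ℝ} (hab : a ≤ b) (hbc : b ≤ c) :
    ‖x‖ₑ ^ (-b) ≤ ‖x‖ₑ ^ (-a) + ‖x‖ₑ ^ (-c) := by
  rcases le_total ‖x‖ₑ 1 with h | h
  · exact le_add_left (ENNReal.rpow_le_rpow_of_exponent_ge h (by linarith))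
  · exact le_add_right (ENNReal.rpow_le_rpow_of_exponent_le h (by linarith))

/-- The last step takes `θ = 1 - gain d / 2` and adds `2 - gain d` to an exponent that is at least
`2 * gain d`, hence passes `2`. That lower bound needs one earlier step, whence the order `n + 2`.
-/
lemma twoPoint_add_two_le (hd : 3 ≤ d) (κ : ℝ) (n : ℕ) {t : ℝ} (ht : t ≤ 1) (x x' : Space d) :
    twoPoint κ (n + 2) t x x' ≤ boundConst d κ (n + 1) * (ENNReal.ofReal κ ^ 2 * decayConst d) *
      (‖x - x'‖ₑ ^ (-lowerDecay d) + ‖x - x'‖ₑ ^ (-upperDecay d)) := by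
  have h0 := gain_pos hd
  have h1 := gain_lt_one hd
  have h2 := two_mul_gain_le_boundExponent hd (Nat.le_add_left 1 n)
  have h3 := boundExponent_le hd (n + 1)
  refine (twoPoint_succ_le (θ := 1 - gain d / 2) (boundExponent_nonneg hd (n + 1)) (by linarith)
    (by linarith) (twoPoint_le hd κ (n + 1)) t ht x x').trans ?_
  refine mul_le_mul' (mul_le_mul' le_rfl (mul_le_mul' le_rfl (flowConst_le_decayConst _)))
    (enorm_rpow_neg_le_add _ ?_ ?_)
  · unfold lowerDecay; linarith
  · unfold upperDecay; linarith

lemma measurable_ballIndicator (R : ℝ) : Measurable (ballIndicator d R) :=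
  measurable_const.indicator measurableSet_ball

lemma rieszNormSq_chaosKernel_ballIndicator_le {κ : ℝ} (hκ : 0 ≤ κ) (n : ℕ) (R : ℝ) :
    rieszNormSq (chaosKernel κ 1 (ballIndicator d R) n) ≤
      ∫⁻ x in Metric.ball (0 : Space d) R, ∫⁻ x' in Metric.ball (0 : Space d) R,
        twoPoint κ n 1 x x' := by
  refine (rieszNormSq_chaosKernel_le hκ 1 (measurable_ballIndicator R) n).trans (le_of_eq ?_)
  rw [← lintegral_indicator measurableSet_ball]
  refine lintegral_congr fun x ↦ ?_
  by_cases hx : x ∈ Metric.ball (0 : Space d) R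
  · rw [Set.indicator_of_mem hx, ← lintegral_indicator measurableSet_ball]
    refine lintegral_congr fun x' ↦ ?_
    by_cases hx' : x' ∈ Metric.ball (0 : Space d) R
    · simp [ballIndicator, Set.indicator_of_mem hx, Set.indicator_of_mem hx']
    · simp [ballIndicator, Set.indicator_of_notMem hx']
  · simp [ballIndicator, Set.indicator_of_notMem hx]

/-- The bound for the double integral of a Riesz kernel over a ball. -/
def ballBound (d : ℕ) (γ R : ℝ) : ℝ≥0∞ :=
  ENNReal.ofReal (ballConst d γ * (2 * R) ^ (d - γ)) * volume (Metric.ball (0 : Space d) R)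

lemma ballBound_lt_top (γ R : ℝ) : ballBound d γ R < ∞ :=
  ENNReal.mul_lt_top ENNReal.ofReal_lt_top measure_ball_lt_top

lemma rieszNormSq_chaosKernel_lt_top (hd : 3 ≤ d) {κ : ℝ} (hκ : 0 ≤ κ) (n : ℕ) {R : ℝ}
    (hR : 0 < R) : rieszNormSq (chaosKernel κ 1 (ballIndicator d R) n) < ∞ := by
  have hd' : (3 : ℝ) ≤ d := by exact_mod_cast hd
  refine (rieszNormSq_chaosKernel_ballIndicator_le hκ n R).trans_lt ?_
  calc
    _ ≤ ∫⁻ x in Metric.ball (0 : Space d) R, ∫⁻ x' in Metric.ball (0 : Space d) R,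
        boundConst d κ n * ‖x - x'‖ₑ ^ (-boundExponent d n) :=
      lintegral_mono fun x ↦ lintegral_mono fun x' ↦ twoPoint_le hd κ n 1 le_rfl x x'
    _ = boundConst d κ n * ∫⁻ x in Metric.ball (0 : Space d) R,
        ∫⁻ x' in Metric.ball (0 : Space d) R, ‖x - x'‖ₑ ^ (-boundExponent d n) := by
      rw [← lintegral_const_mul _ (by fun_prop)]
      exact lintegral_congr fun x ↦ lintegral_const_mul _ (by fun_prop)
    _ ≤ boundConst d κ n * ballBound d (boundExponent d n) R :=
      mul_le_mul' le_rfl (lintegral_ball_ball_enorm_rpow_le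
        (by linarith [boundExponent_lt hd n]) (by omega) hR)
    _ < ∞ := ENNReal.mul_lt_top (boundConst_lt_top hd κ n) (ballBound_lt_top _ _)

/-- The order enters only through `boundConst` and the radius only through `ballBound`, so summing
over the orders is independent of the scaling in `R`. -/
lemma rieszNormSq_chaosKernel_add_two_le (hd : 3 ≤ d) {κ : ℝ} (hκ : 0 ≤ κ) (n : ℕ) {R : ℝ}
    (hR : 0 < R) : rieszNormSq (chaosKernel κ 1 (ballIndicator d R) (n + 2)) ≤
      boundConst d κ (n + 1) * (ENNReal.ofReal κ ^ 2 * decayConst d) *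
        (ballBound d (lowerDecay d) R + ballBound d (upperDecay d) R) := by
  have h1 := upperDecay_lt hd
  have h2 := lowerDecay_le_upperDecay hd
  refine (rieszNormSq_chaosKernel_ballIndicator_le hκ (n + 2) R).trans ?_
  set K := boundConst d κ (n + 1) * (ENNReal.ofReal κ ^ 2 * decayConst d)
  calc
    _ ≤ ∫⁻ x in Metric.ball (0 : Space d) R, ∫⁻ x' in Metric.ball (0 : Space d) R,
        K * (‖x - x'‖ₑ ^ (-lowerDecay d) + ‖x - x'‖ₑ ^ (-upperDecay d)) :=
      lintegral_mono fun x ↦ lintegral_mono fun x' ↦ twoPoint_add_two_le hd κ n le_rfl x x'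
    _ = K * ((∫⁻ x in Metric.ball (0 : Space d) R, ∫⁻ x' in Metric.ball (0 : Space d) R,
          ‖x - x'‖ₑ ^ (-lowerDecay d)) + ∫⁻ x in Metric.ball (0 : Space d) R,
          ∫⁻ x' in Metric.ball (0 : Space d) R, ‖x - x'‖ₑ ^ (-upperDecay d)) := by
      rw [← lintegral_add_left (by fun_prop), ← lintegral_const_mul _ (by fun_prop)]
      refine lintegral_congr fun x ↦ ?_
      rw [← lintegral_add_left (by fun_prop), ← lintegral_const_mul _ (by fun_prop)]
    _ ≤ _ := mul_le_mul' le_rfl (add_le_add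
      (lintegral_ball_ball_enorm_rpow_le (h2.trans_lt h1) (by omega) hR)
      (lintegral_ball_ball_enorm_rpow_le h1 (by omega) hR))

lemma tsum_rieszNormSq_chaosKernel_le (hd : 3 ≤ d) {κ : ℝ} (hκ : 0 ≤ κ) {R : ℝ} (hR : 0 < R) :
    ∑' n, rieszNormSq (chaosKernel κ 1 (ballIndicator d R) (n + 2)) ≤
      (∑' n, boundConst d κ n) * (ENNReal.ofReal κ ^ 2 * decayConst d) *
        (ballBound d (lowerDecay d) R + ballBound d (upperDecay d) R) := by
  refine (ENNReal.tsum_le_tsum fun n ↦ rieszNormSq_chaosKernel_add_two_le hd hκ n hR).trans ?_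
  rw [ENNReal.tsum_mul_right, ENNReal.tsum_mul_right]
  refine mul_le_mul' (mul_le_mul' ?_ le_rfl) le_rfl
  exact ENNReal.tsum_comp_le_tsum_of_injective (Nat.succ_injective) (boundConst d κ)

lemma tendsto_ballBound_div (hd : 3 ≤ d) {γ : ℝ} (hγ : 2 < γ) :
    Tendsto (fun R : ℝ ↦ (ballBound d γ R).toReal / R ^ (2 * d - 2)) atTop (𝓝 0) := by
  have : Nonempty (Fin d) := ⟨⟨0, by omega⟩⟩
  set v := (volume : Measure (Space d)).real (Metric.ball 0 1) with hv
  have h : Tendsto (fun R : ℝ ↦ max (ballConst d γ) 0 * 2 ^ ((d : ℝ) - γ) * v * R ^ (-(γ - 2)))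
      atTop (𝓝 0) := by
    simpa using (tendsto_rpow_neg_atTop (show 0 < γ - 2 by linarith)).const_mul
      (max (ballConst d γ) 0 * 2 ^ ((d : ℝ) - γ) * v)
  refine h.congr' ?_
  filter_upwards [eventually_gt_atTop 0] with R hR
  have hvol : (volume (Metric.ball (0 : Space d) R)).toReal = R ^ d * v := by
    rw [Measure.addHaar_ball _ _ hR.le, ENNReal.toReal_mul, ENNReal.toReal_ofReal (by positivity)]
    simp [hv, Measure.real]
  -- Without an upper bound on `γ` the sign of `ballConst` is unknown, so the truncation in
  -- `ENNReal.ofReal` is kept as a maximum.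
  have hmul : max (ballConst d γ * (2 * R) ^ ((d : ℝ) - γ)) 0 =
      max (ballConst d γ) 0 * (2 * R) ^ ((d : ℝ) - γ) := by
    rw [max_mul_of_nonneg _ _ (by positivity), zero_mul]
  rw [ballBound, ENNReal.toReal_mul, hvol, ENNReal.toReal_ofReal', hmul,
    Real.mul_rpow two_pos.le hR.le]
  have he : R ^ (-(γ - 2)) = R ^ ((d : ℝ) - γ) * R ^ d / R ^ (2 * d - 2) := by
    rw [← Real.rpow_natCast, ← Real.rpow_natCast R (2 * d - 2), ← Real.rpow_add hR,
      ← Real.rpow_sub hR, Nat.cast_sub (by omega)]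
    congr 1
    push_cast
    ring
  rw [he]
  ring

end Summation

/-! ### Existence and second moments of multiple integrals -/

section MultipleIntegral

variable {d n : ℕ} {Ω : Type*} [MeasurableSpace Ω] {P : Measure Ω} {F : NoiseSet d → Ω → ℝ}

lemma eLpNorm_two_sq (X : Ω → ℝ) (P : Measure Ω) : eLpNorm X 2 P ^ 2 = ∫⁻ ω, ‖X ω‖ₑ ^ 2 ∂P := by
  have h := eLpNorm_nnreal_pow_eq_lintegral (f := X) (μ := P) (p := 2) two_ne_zero
  simpa using h

lemma eLpNorm_integral_sub_sq_le [IsProbabilityMeasure P] (hF : IsRieszNoise F P) (hd : 3 ≤ d)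
    (e e' : ElementaryKernel d n) {g : (Fin n → ℝ × Space d) → ℝ} (hg : Measurable g) :
    eLpNorm (fun ω ↦ e.integral F ω - e'.integral F ω) 2 P ^ 2 ≤ n.factorial *
      (2 * (rieszNormSq (fun p ↦ e.toFun p - g p) + rieszNormSq (fun p ↦ e'.toFun p - g p))) := by
  have h := lintegral_enorm_integral_sq_le_factorial hF hd (e.sub e')
  rw [← eLpNorm_two_sq] at h
  simp only [funext (ElementaryKernel.toFun_sub e e'),
    funext (ElementaryKernel.integral_sub e e' F)] at h
  refine h.trans (mul_le_mul' le_rfl ?_)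
  rw [rieszNormSq_sub_comm e'.toFun g]
  exact rieszNormSq_sub_le (by fun_prop) hg (by fun_prop)

/-- Existence of the multiple integral of an approximable kernel. -/
lemma exists_isMultipleIntegral [IsProbabilityMeasure P] (hF : IsRieszNoise F P) (hd : 3 ≤ d)
    {g : (Fin n → ℝ × Space d) → ℝ} (hg : Measurable g) (happ : IsApproximable g) :
    ∃ X, IsMultipleIntegral F P g X := by
  have hn0 : (4 * n.factorial : ℝ≥0∞) ≠ 0 := by simp [Nat.factorial_ne_zero]
  have hnt : (4 * n.factorial : ℝ≥0∞) ≠ ∞ := ENNReal.mul_ne_top (by simp) (by simp)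
  -- Chosen so that `n! * (2 * (δ + δ))` is the square of `2⁻ᵏ`, which makes the `L²` distances
  -- summable.
  set δ : ℕ → ℝ≥0∞ := fun k ↦ ((2 : ℝ≥0∞)⁻¹ ^ k) ^ 2 / (4 * n.factorial) with hδ
  have hδ0 (k : ℕ) : 0 < δ k := ENNReal.div_pos (by simp) hnt
  have hδanti : Antitone δ := by
    intro k l hkl
    refine ENNReal.div_le_div_right (pow_le_pow_left' ?_ 2) _
    exact pow_le_pow_right_of_le_one' (by simp) hkl
  choose e _ he using fun k ↦ happ (δ k) (hδ0 k)
  have hlim0 : Tendsto (fun k ↦ (2 : ℝ≥0∞)⁻¹ ^ k) atTop (𝓝 0) :=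
    ENNReal.tendsto_pow_atTop_nhds_zero_of_lt_one (by simp)
  have hδlim : Tendsto δ atTop (𝓝 0) := by
    have h1 := ENNReal.Tendsto.pow (n := 2) hlim0
    have h2 := ENNReal.Tendsto.div_const h1 (Or.inr hn0)
    simpa using h2
  have hcau (N k l : ℕ) (hk : N ≤ k) (hl : N ≤ l) :
      eLpNorm ((e k).integral F - (e l).integral F) 2 P < (2 : ℝ≥0∞)⁻¹ ^ N := by
    have h1 := eLpNorm_integral_sub_sq_le hF hd (e k) (e l) hg
    refine lt_of_pow_lt_pow_left' 2 (h1.trans_lt ?_)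
    have h2 : rieszNormSq (fun p ↦ (e k).toFun p - g p) < δ N := (he k).trans_le (hδanti hk)
    have h3 : rieszNormSq (fun p ↦ (e l).toFun p - g p) < δ N := (he l).trans_le (hδanti hl)
    calc
      _ < n.factorial * (2 * (δ N + δ N)) := by
        rw [ENNReal.mul_lt_mul_iff_right (by simp [Nat.factorial_ne_zero]) (by simp),
          ENNReal.mul_lt_mul_iff_right (by simp) (by simp)]
        exact ENNReal.add_lt_add h2 h3
      _ = 4 * n.factorial * δ N := by ring
      _ ≤ _ := ENNReal.mul_div_le
  obtain ⟨X, hX, hlim⟩ := Lp.cauchy_complete_eLpNorm (p := 2) (by norm_num)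
    (fun k ↦ hasMoments_integral hF (e k) 2 (by simp))
    (B := fun N ↦ (2 : ℝ≥0∞)⁻¹ ^ N) (by rw [ENNReal.tsum_geometric]; simp) hcau
  refine ⟨X, hg.aemeasurable, hX, e, ?_, hlim⟩
  exact tendsto_of_tendsto_of_tendsto_of_le_of_le tendsto_const_nhds hδlim (fun _ ↦ zero_le)
    fun k ↦ (he k).le

lemma lintegral_enorm_add_sq_le {X Y : Ω → ℝ} (hX : AEMeasurable X P) :
    ∫⁻ ω, ‖X ω + Y ω‖ₑ ^ 2 ∂P ≤ 2 * (∫⁻ ω, ‖X ω‖ₑ ^ 2 ∂P + ∫⁻ ω, ‖Y ω‖ₑ ^ 2 ∂P) := by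
  rw [← lintegral_add_left' (by fun_prop), ← lintegral_const_mul' _ _ (by simp)]
  refine lintegral_mono fun ω ↦ ?_
  calc
    _ ≤ (‖X ω‖ₑ + ‖Y ω‖ₑ) ^ 2 := pow_le_pow_left' (enorm_add_le _ _) 2
    _ = ‖X ω‖ₑ * ‖X ω‖ₑ + ‖Y ω‖ₑ * ‖Y ω‖ₑ + 2 * (‖X ω‖ₑ * ‖Y ω‖ₑ) := by ring
    _ ≤ (‖X ω‖ₑ * ‖X ω‖ₑ + ‖Y ω‖ₑ * ‖Y ω‖ₑ) + (‖X ω‖ₑ * ‖X ω‖ₑ + ‖Y ω‖ₑ * ‖Y ω‖ₑ) := by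
      gcongr
      exact two_mul_mul_le_add _ _
    _ = _ := by ring

/-- The second moment of the multiple integral of an ordered kernel. -/
lemma lintegral_enorm_sq_le_of_isMultipleIntegral [IsProbabilityMeasure P]
    (hF : IsRieszNoise F P) (hd : 3 ≤ d) {g : (Fin n → ℝ × Space d) → ℝ} (hg : Measurable g)
    (happ : IsApproximable g) {X : Ω → ℝ} (hX : IsMultipleIntegral F P g X) :
    ∫⁻ ω, ‖X ω‖ₑ ^ 2 ∂P ≤ 4 * rieszNormSq g := by
  obtain ⟨-, hXL, e, he, heX⟩ := hX
  have hpos (k : ℕ) : (0 : ℝ≥0∞) < ((k : ℝ≥0∞) + 1)⁻¹ := by simp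
  -- The sequence `e` defining `X` need not be ordered. It is compared with an ordered sequence
  -- `e'`, and the factor `n!` multiplies only norms of differences, which vanish in the limit.
  choose e' hord he' using fun k ↦ happ _ (hpos k)
  have hlim' : Tendsto (fun k ↦ rieszNormSq fun p ↦ (e' k).toFun p - g p) atTop (𝓝 0) := by
    refine tendsto_of_tendsto_of_tendsto_of_le_of_le tendsto_const_nhds ?_ (fun _ ↦ zero_le)
      fun k ↦ (he' k).le
    have := (tendsto_add_atTop_iff_nat 1).mpr ENNReal.tendsto_inv_nat_nhds_zero
    simpa using this
  have hXm : AEMeasurable X P := hXL.aestronglyMeasurable.aemeasurable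
  have hIm (e : ElementaryKernel d n) : AEMeasurable (e.integral F) P :=
    (hasMoments_integral hF e).integrable.aemeasurable
  have hle (k : ℕ) : ∫⁻ ω, ‖X ω‖ₑ ^ 2 ∂P ≤
      2 * (2 * (eLpNorm (fun ω ↦ (e k).integral F ω - X ω) 2 P ^ 2 + n.factorial *
        (2 * (rieszNormSq (fun p ↦ (e' k).toFun p - g p) +
          rieszNormSq (fun p ↦ (e k).toFun p - g p)))) +
        2 * (rieszNormSq (fun p ↦ (e' k).toFun p - g p) + rieszNormSq g)) := by
    have h1 := lintegral_enorm_add_sq_le (P := P) (X := fun ω ↦ X ω - (e' k).integral F ω)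
      (Y := (e' k).integral F) (hXm.sub (hIm _))
    have h2 := lintegral_enorm_add_sq_le (P := P) (X := fun ω ↦ (e k).integral F ω - X ω)
      (Y := fun ω ↦ (e' k).integral F ω - (e k).integral F ω) ((hIm _).sub hXm)
    have h3 := lintegral_enorm_integral_sq_le_of_isOrdered hF hd (e' k) (hord k)
    have h4 := rieszNormSq_add_le (g := fun p ↦ (e' k).toFun p - g p) (h := g) (by fun_prop) hg
    have h5 := eLpNorm_integral_sub_sq_le hF hd (e' k) (e k) hg
    have h6 : ∫⁻ ω, ‖X ω - (e' k).integral F ω‖ₑ ^ 2 ∂P =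
        ∫⁻ ω, ‖(e k).integral F ω - X ω + ((e' k).integral F ω - (e k).integral F ω)‖ₑ ^ 2 ∂P := by
      refine lintegral_congr fun ω ↦ ?_
      rw [← enorm_neg]
      congr 2
      ring
    simp only [sub_add_cancel] at h1 h4
    rw [h6] at h1
    rw [← eLpNorm_two_sq (fun ω ↦ (e k).integral F ω - X ω),
      ← eLpNorm_two_sq (fun ω ↦ (e' k).integral F ω - (e k).integral F ω)] at h2
    refine h1.trans (mul_le_mul' le_rfl (add_le_add (h2.trans ?_) (h3.trans h4)))
    exact mul_le_mul' le_rfl (add_le_add le_rfl h5)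
  have ht2 (u : ℕ → ℝ≥0∞) {a c : ℝ≥0∞} (hc : c ≠ ∞) (hu : Tendsto u atTop (𝓝 a)) :
      Tendsto (fun k ↦ c * u k) atTop (𝓝 (c * a)) := ENNReal.Tendsto.const_mul hu (Or.inr hc)
  have hlim := ht2 _ (c := 2) (by simp) ((ht2 _ (c := 2) (by simp)
    ((ENNReal.Tendsto.pow (n := 2) heX).add (ht2 _ (c := n.factorial) (by simp)
      (ht2 _ (c := 2) (by simp) (hlim'.add he))))).add
    (ht2 _ (c := 2) (by simp) (hlim'.add (tendsto_const_nhds (x := rieszNormSq g)))))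
  -- The surviving constant `4` comes from two uses of `(u + v)² ≤ 2 (u² + v²)`.
  have hlim2 := ge_of_tendsto' hlim hle
  refine hlim2.trans (le_of_eq ?_)
  simp only [ne_eq, OfNat.ofNat_ne_zero, not_false_eq_true, zero_pow, add_zero, mul_zero, zero_add]
  ring

end MultipleIntegral

/-! ### The chaoses over a ball: existence and variance. -/

section Chaos

variable {d : ℕ} {Ω : Type*} [MeasurableSpace Ω] {P : Measure Ω} {F : NoiseSet d → Ω → ℝ}

lemma isApproximable_chaosKernel (hd : 3 ≤ d) {κ : ℝ} (hκ : 0 ≤ κ) (n : ℕ) {R : ℝ} (hR : 0 < R) :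
    IsApproximable (chaosKernel κ 1 (ballIndicator d R) n) := by
  refine isApproximable_of_isOrdered hd (measurable_chaosKernel κ 1 (measurable_ballIndicator R) n)
    (rieszNormSq_chaosKernel_lt_top hd hκ n hR) (fun p hp ↦ ?_) (fun p hp i ↦ ?_)
  all_goals
    unfold chaosKernel at hp
    split_ifs at hp with h
    · first | exact h.2 | exact (h.1 i).1
    · exact absurd rfl hp

lemma isMultipleIntegral_chaos [IsProbabilityMeasure P] (hF : IsRieszNoise F P) (hd : 3 ≤ d)
    {κ : ℝ} (hκ : 0 ≤ κ) (n : ℕ) {R : ℝ} (hR : 0 < R) :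
    IsMultipleIntegral F P (chaosKernel κ 1 (ballIndicator d R) n)
      (chaos F P κ 1 n (ballIndicator d R)) := by
  have h := exists_isMultipleIntegral hF hd
    (measurable_chaosKernel κ 1 (measurable_ballIndicator R) n)
    (isApproximable_chaosKernel hd hκ n hR)
  unfold chaos multipleIntegral
  rw [dif_pos h]
  exact h.choose_spec

/-- The second moment dominates the variance, so the mean need not be computed. -/
lemma variance_chaos_le [IsProbabilityMeasure P] (hF : IsRieszNoise F P) (hd : 3 ≤ d)
    {κ : ℝ} (hκ : 0 ≤ κ) (n : ℕ) {R : ℝ} (hR : 0 < R) :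
    Var[chaos F P κ 1 n (ballIndicator d R); P] ≤
      (4 * rieszNormSq (chaosKernel κ 1 (ballIndicator d R) n)).toReal := by
  have hX := isMultipleIntegral_chaos hF hd hκ n hR
  have hm := hX.2.1.aestronglyMeasurable
  refine (variance_le_expectation_sq hm).trans ?_
  simp only [Pi.pow_apply]
  rw [integral_eq_lintegral_of_nonneg_ae (ae_of_all _ fun ω ↦ sq_nonneg _) (by fun_prop)]
  refine ENNReal.toReal_mono (ENNReal.mul_ne_top (by simp)
    (rieszNormSq_chaosKernel_lt_top hd hκ n hR).ne) ?_
  refine le_trans (le_of_eq (lintegral_congr fun ω ↦ ?_))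
    (lintegral_enorm_sq_le_of_isMultipleIntegral hF hd
      (measurable_chaosKernel κ 1 (measurable_ballIndicator R) n)
      (isApproximable_chaosKernel hd hκ n hR) hX)
  rw [← Real.enorm_of_nonneg (sq_nonneg _), enorm_pow]

end Chaos

end CriticalSHE

end

/-! ### The limit theorem. -/

open CriticalSHE in
theorem proposition2 {d : ℕ} (hd : 3 ≤ d) {κ : ℝ} (hκ : 0 < κ) (hκd : κ < ((d : ℝ) - 2) / 2)
    {Ω : Type*} [MeasurableSpace Ω] (P : Measure Ω) [IsProbabilityMeasure P]
    (F : NoiseSet d → Ω → ℝ) (hF : IsRieszNoise F P) :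
    -- every chaos is a well-defined square-integrable multiple Wiener–Itô integral
    (∀ (n : ℕ) (R : ℝ), 0 < R →
      IsMultipleIntegral F P (chaosKernel κ 1 (ballIndicator d R) n)
        (chaos F P κ 1 n (ballIndicator d R))) ∧
    -- the series of the variances of the chaoses of order at least two converges
    (∀ R : ℝ, 0 < R → Summable fun n : ℕ ↦ Var[chaos F P κ 1 (n + 2) (ballIndicator d R); P]) ∧
    -- and it is negligible in the scaling of the central limit theorem
    Tendsto (fun R : ℝ ↦
        (∑' n : ℕ, Var[chaos F P κ 1 (n + 2) (ballIndicator d R); P]) / R ^ (2 * d - 2))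
      atTop (𝓝 0) := by
  -- This constant collects everything that does not depend on `R`.
  set M : ℝ≥0∞ := (∑' n, boundConst d κ n) * (ENNReal.ofReal κ ^ 2 * decayConst d)
  have hM : M < ∞ := ENNReal.mul_lt_top (tsum_boundConst_lt_top hd hκ hκd)
    (ENNReal.mul_lt_top (by simp) (decayConst_lt_top hd))
  have hBt (R : ℝ) : M * (ballBound d (lowerDecay d) R + ballBound d (upperDecay d) R) < ∞ :=
    ENNReal.mul_lt_top hM (ENNReal.add_lt_top.mpr ⟨ballBound_lt_top _ _, ballBound_lt_top _ _⟩)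
  have hle (R : ℝ) (hR : 0 < R) :
      ∑' n, 4 * rieszNormSq (chaosKernel κ 1 (ballIndicator d R) (n + 2)) ≤
        4 * (M * (ballBound d (lowerDecay d) R + ballBound d (upperDecay d) R)) := by
    rw [ENNReal.tsum_mul_left]
    exact mul_le_mul' le_rfl (tsum_rieszNormSq_chaosKernel_le hd hκ.le hR)
  have hlt (R : ℝ) (hR : 0 < R) :
      ∑' n, 4 * rieszNormSq (chaosKernel κ 1 (ballIndicator d R) (n + 2)) ≠ ∞ :=
    ((hle R hR).trans_lt (ENNReal.mul_lt_top (by simp) (hBt R))).ne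
  have hsum (R : ℝ) (hR : 0 < R) :
      Summable fun n : ℕ ↦ Var[chaos F P κ 1 (n + 2) (ballIndicator d R); P] :=
    Summable.of_nonneg_of_le (fun n ↦ variance_nonneg _ _)
      (fun n ↦ variance_chaos_le hF hd hκ.le (n + 2) hR) (ENNReal.summable_toReal (hlt R hR))
  refine ⟨fun n R hR ↦ isMultipleIntegral_chaos hF hd hκ.le n hR, hsum, ?_⟩
  -- Both decay exponents exceed `2`, so each ball bound is of smaller order than `R ^ (2 * d - 2)`.
  have hlim : Tendsto (fun R : ℝ ↦ 4 * M.toReal *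
      ((ballBound d (lowerDecay d) R).toReal / R ^ (2 * d - 2) +
        (ballBound d (upperDecay d) R).toReal / R ^ (2 * d - 2))) atTop (𝓝 0) := by
    have h2 := two_lt_lowerDecay hd
    simpa using ((tendsto_ballBound_div hd h2).add (tendsto_ballBound_div hd
      (h2.trans_le (lowerDecay_le_upperDecay hd)))).const_mul (4 * M.toReal)
  refine tendsto_of_tendsto_of_tendsto_of_le_of_le' tendsto_const_nhds hlim ?_ ?_
  · filter_upwards [eventually_gt_atTop 0] with R hR
    exact div_nonneg (tsum_nonneg fun n ↦ variance_nonneg _ _) (by positivity)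
  · filter_upwards [eventually_gt_atTop 0] with R hR
    rw [← add_div, ← mul_div_assoc]
    refine div_le_div_of_nonneg_right ?_ (by positivity)
    calc
      _ ≤ ∑' n : ℕ, (4 * rieszNormSq (chaosKernel κ 1 (ballIndicator d R) (n + 2))).toReal :=
        (hsum R hR).tsum_le_tsum (fun n ↦ variance_chaos_le hF hd hκ.le (n + 2) hR)
          (ENNReal.summable_toReal (hlt R hR))
      _ = (∑' n : ℕ, 4 * rieszNormSq (chaosKernel κ 1 (ballIndicator d R) (n + 2))).toReal :=
        (ENNReal.tsum_toReal_eq fun n ↦ ENNReal.ne_top_of_tsum_ne_top (hlt R hR) n).symm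
      _ ≤ (4 * (M * (ballBound d (lowerDecay d) R + ballBound d (upperDecay d) R))).toReal :=
        ENNReal.toReal_mono (ENNReal.mul_ne_top (by simp) (hBt R).ne) (hle R hR)
      _ = _ := by
        rw [ENNReal.toReal_mul, ENNReal.toReal_mul, ENNReal.toReal_add (ballBound_lt_top _ _).ne
          (ballBound_lt_top _ _).ne]
        simp [mul_assoc]
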